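/- **Diagrams.** Let $\delta_0,\delta_1\in\mathbb C$ and $n\in\mathbb N$. A two-colour bubble diagram from $n$ to $k$ nodes is a rectangle with $n$ nodes on its top edge and $k$ nodes on its bottom edge, each node having colour $0$ or $1$, together with a partition of the set of all nodes into pairs of nodes of the same colour, such that the pairs of each single colour can be drawn inside the rectangle without crossings (lines of different colours may cross). The bubble algebra $\mathbb T_{n,2}(\delta_0,\delta_1)$ over $\mathbb C$ has the bubble diagrams from $n$ to $n$ nodes as a basis. The product $ab$ of two diagrams is obtained by placing $a$ above $b$: it is $0$ if the colours of the bottom nodes of $a$ differ from those of the top nodes of $b$, and otherwise it is the resulting diagram, with every closed loop of colour $i$ removed and replaced by the factor $\delta_i$. **Cell modules.** For $\lambda=(\lambda_0,\lambda_1)\in\mathbb N^2$ let $\Delta_n(\lambda)$ be the left $\mathbb T_{n,2}(\delta_0,\delta_1)$-module with basis the half-diagrams on $n$ nodes with exactly $\lambda_i$ defects of colour $i$ (the upper halves of bubble diagrams with exactly $\lambda_i$ propagating lines of colour $i$, for $i=0,1$). A diagram acts on a half-diagram by being placed above it, with the rules above, and the result is $0$ if it has fewer than $\lambda_i$ defects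 of some colour $i$. Thus $\Delta_n(\lambda)=0$ if $\lambda_0+\lambda_1>n$. On $\Delta_n(\lambda)$ there is the bilinear form which for half-diagrams $x,y$ is given as follows: reflect $x$ and glue it on top of $y$; then $\langle x,y\rangle=\delta_0^{c_0}\delta_1^{c_1}$, with $c_i$ the number of closed loops of colour $i$, if the colours of the nodes of $x$ and $y$ agree and every defect of $x$ becomes joined to a defect of $y$, and $\langle x,y\rangle=0$ otherwise. Let $$\operatorname{Rad}(\Delta_n(\lambda))=\{y\in\Delta_n(\lambda) : \langle x,y\rangle=0\text{ for all }x\in\Delta_n(\lambda)\},$$ and let $L_n(\lambda)$ be the head of $\Delta_n(\lambda)$, that is, the quotient of $\Delta_n(\lambda)$ by the intersection of its maximal submodules (so $L_n(\lambda)=0$ if $\lambda_0+\lambda_1>n$). **Theorem.** For $i=0,1$ let $\delta_i=q_i+q_i^{-1}$ with $q_i\in\mathbb C$ a root of unity, and let $l_i$ be the smallest positive integer with $q_i^{2l_i}=1$. Let $\lambda_0,\lambda_1,v\in\mathbb N$ with $\lambda_0+\lambda_1=n-2v$, and let $t=(t_0,t_1)$ be integers with $0<t_i<l_i$ and $\lambda_i+t_i+1\equiv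 0 \pmod{l_i}$ for $i=0,1$. Then there is a short exact sequence of $\mathbb T_{n,2}(\delta_0,\delta_1)$-modules $$0\to L_n(\lambda+2t)\to \operatorname{Rad}(\Delta_n(\lambda))\to L_n(\lambda_0+2t_0,\lambda_1)\oplus L_n(\lambda_0,\lambda_1+2t_1)\to 0 .$$ Moreover, define the radical series of $\Delta_n(\lambda)$ by $\operatorname{rad}^0=\Delta_n(\lambda)$ and by letting $\operatorname{rad}^{k+1}$ be the intersection of the maximal submodules of $\operatorname{rad}^k$. Then $\operatorname{rad}^3=0$, so the Loewy length of $\Delta_n(\lambda)$ is at most $3$. If the bilinear form on $\Delta_n(\lambda)$ is not zero, the exact sequence can be chosen such that $\operatorname{rad}^1=\operatorname{Rad}(\Delta_n(\lambda))$ and $\operatorname{rad}^2$ is the image of $L_n(\lambda+2t)$; thus the radical layers of $\Delta_n(\lambda)$ are $L_n(\lambda)$, $L_n(\lambda_0+2t_0,\lambda_1)\oplus L_n(\lambda_0,\lambda_1+2t_1)$ and $L_n(\lambda+2t)$. -/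

import Mathlib

namespace Bubble

section Gluing

variable {X Y Z W : Type}

/-- When a diagram with rows `X`, `Y` is placed on top of one with rows `Y`, `Z`, the two copies of
the row `Y` are identified and the nodes of the picture are `X ⊕ (Y ⊕ Z)`.  The nodes of the upper
diagram in this picture. -/
def upper : X ⊕ Y → X ⊕ (Y ⊕ Z) := Sum.map id Sum.inl
/-- The nodes of the lower diagram. -/
def lower : Y ⊕ Z → X ⊕ (Y ⊕ Z) := Sum.inr
/-- The nodes of the first and the last row. -/
def outer : X ⊕ Z → X ⊕ (Y ⊕ Z) := Sum.map id Sum.inr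
/-- The nodes of the middle row. -/
def mid : Y → X ⊕ (Y ⊕ Z) := Sum.inr ∘ Sum.inl

/-- The connected components of the picture: the equivalence relation generated by the relations of
the two diagrams. -/
def glue (r : Setoid (X ⊕ Y)) (s : Setoid (Y ⊕ Z)) : Setoid (X ⊕ (Y ⊕ Z)) :=
  r.map upper ⊔ s.map lower

theorem map_le_iff {A B : Type} {f : A → B} {r : Setoid A} {s : Setoid B} :
    r.map f ≤ s ↔ r ≤ s.comap f := by
  constructor
  · intro h a b hab
    exact h (Relation.EqvGen.rel _ _ ⟨a, b, hab, rfl, rfl⟩)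
  · intro h
    apply Setoid.eqvGen_le
    rintro _ _ ⟨a, b, hab, rfl, rfl⟩
    exact h hab

theorem map_rel_of_injective {A B : Type} {f : A → B} (hf : f.Injective) {r : Setoid A} {a b : B} :
    r.map f a b ↔ a = b ∨ ∃ u v, f u = a ∧ f v = b ∧ r u v := by
  constructor
  · let t : Setoid B :=
      { r := fun a b => a = b ∨ ∃ u v, f u = a ∧ f v = b ∧ r u v
        iseqv := by
          refine ⟨fun _ => Or.inl rfl, ?_, ?_⟩
          · rintro _ _ (rfl | ⟨u, v, rfl, rfl, h⟩)
            · exact Or.inl rfl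
            · exact Or.inr ⟨v, u, rfl, rfl, r.symm h⟩
          · rintro _ _ _ (rfl | ⟨u, v, rfl, rfl, h⟩) (rfl | ⟨u', v', h1, rfl, h'⟩)
            · exact Or.inl rfl
            · exact Or.inr ⟨u', v', h1, rfl, h'⟩
            · exact Or.inr ⟨u, v, rfl, rfl, h⟩
            · obtain rfl := hf h1
              exact Or.inr ⟨u, v', rfl, rfl, r.trans h h'⟩ }
    have : r.map f ≤ t := map_le_iff.2 fun u v h => Or.inr ⟨u, v, rfl, rfl, h⟩
    exact fun h => this h
  · rintro (rfl | ⟨u, v, rfl, rfl, h⟩)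
    · exact Setoid.refl' _ _
    · exact (map_le_iff.1 le_rfl : r ≤ (r.map f).comap f) h

theorem map_sup {A B : Type} (f : A → B) (r s : Setoid A) :
    (r ⊔ s).map f = r.map f ⊔ s.map f := by
  apply le_antisymm
  · rw [map_le_iff]
    exact sup_le (map_le_iff.1 le_sup_left) (map_le_iff.1 le_sup_right)
  · refine sup_le ?_ ?_ <;> rw [map_le_iff]
    · exact le_sup_left.trans (map_le_iff.1 le_rfl)
    · exact le_sup_right.trans (map_le_iff.1 le_rfl)

theorem map_map {A B C : Type} (f : A → B) (g : B → C) (r : Setoid A) :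
    (r.map f).map g = r.map (g ∘ f) := by
  apply le_antisymm
  · rw [map_le_iff, map_le_iff, ← Setoid.comap_comp]
    exact map_le_iff.1 le_rfl
  · rw [map_le_iff, Setoid.comap_comp, ← map_le_iff, ← map_le_iff]

theorem sup_map_rel {G P : Type} (j : P → G) (A : Setoid G) (s : Setoid P) {a b : G} :
    (A ⊔ s.map j) a b ↔
      A a b ∨ ∃ p q, A a (j p) ∧ (A.comap j ⊔ s) p q ∧ A (j q) b := by
  constructor
  · let t : Setoid G :=
      { r := fun a b => A a b ∨ ∃ p q, A a (j p) ∧ (A.comap j ⊔ s) p q ∧ A (j q) b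
        iseqv := by
          refine ⟨fun _ => Or.inl (A.refl _), ?_, ?_⟩
          · rintro a b (h | ⟨p, q, h1, h2, h3⟩)
            · exact Or.inl (A.symm h)
            · exact Or.inr ⟨q, p, A.symm h3, Setoid.symm' _ h2, A.symm h1⟩
          · rintro a b c (h | ⟨p, q, h1, h2, h3⟩) (h' | ⟨p', q', h1', h2', h3'⟩)
            · exact Or.inl (A.trans h h')
            · exact Or.inr ⟨p', q', A.trans h h1', h2', h3'⟩
            · exact Or.inr ⟨p, q, h1, h2, A.trans h3 h'⟩
            · refine Or.inr ⟨p, q', h1, ?_, h3'⟩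
              have : (A.comap j ⊔ s) q p' :=
                (le_sup_left : A.comap j ≤ A.comap j ⊔ s) (A.trans h3 h1')
              exact Setoid.trans' _ h2 (Setoid.trans' _ this h2') }
    have : A ⊔ s.map j ≤ t := by
      refine sup_le (fun _ _ h => Or.inl h) (map_le_iff.2 fun p q h => ?_)
      exact Or.inr ⟨p, q, A.refl _, (le_sup_right : s ≤ A.comap j ⊔ s) h, A.refl _⟩
    exact fun h => this h
  · have hA : A ≤ A ⊔ s.map j := le_sup_left
    have hQ : A.comap j ⊔ s ≤ (A ⊔ s.map j).comap j :=
      sup_le (fun _ _ h => hA h) (map_le_iff.1 le_sup_right)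
    rintro (h | ⟨p, q, h1, h2, h3⟩)
    · exact hA h
    · exact Setoid.trans' _ (hA h1) (Setoid.trans' _ (hQ h2) (hA h3))

theorem comap_sup_map {G P : Type} (j : P → G) (A : Setoid G) (s : Setoid P) :
    (A ⊔ s.map j).comap j = A.comap j ⊔ s := by
  ext p q
  rw [Setoid.comap_rel, sup_map_rel]
  constructor
  · have hA : A.comap j ≤ A.comap j ⊔ s := le_sup_left
    rintro (h | ⟨p', q', h1, h2, h3⟩)
    · exact hA h
    · exact Setoid.trans' _ (hA h1) (Setoid.trans' _ h2 (hA h3))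
  · exact fun h => Or.inr ⟨p, q, A.refl _, h, A.refl _⟩

theorem ncard_classes_sup_map {G P : Type} [Finite G] (j : P → G)
    (A : Setoid G) (s : Setoid P) (M : Set G)
    (hM : ∀ a p, a ∉ Set.range j → (A ⊔ s.map j) a (j p) → j p ∈ M → a ∈ M) :
    {S ∈ (A ⊔ s.map j).classes | S ⊆ M}.ncard =
      {S ∈ A.classes | S ⊆ M \ Set.range j}.ncard +
        {S ∈ (A.comap j ⊔ s).classes | S ⊆ j ⁻¹' M}.ncard := by
  set B := A ⊔ s.map j with hB
  have hAB : A ≤ B := le_sup_left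
  have key : {S ∈ B.classes | S ⊆ M} =
      {S ∈ A.classes | S ⊆ M \ Set.range j} ∪
        {S ∈ B.classes | S ⊆ M ∧ ∃ p, j p ∈ S} := by
    ext S
    simp only [Set.mem_ofPred_eq, Set.mem_union]
    constructor
    · rintro ⟨⟨a, rfl⟩, hS⟩
      by_cases h : ∃ p, B (j p) a
      · exact Or.inr ⟨⟨a, rfl⟩, hS, h⟩
      · left
        have e : {x | B x a} = {x | A x a} := by
          ext x
          refine ⟨fun hx => ?_, fun hx => hAB hx⟩
          rcases (sup_map_rel j A s).1 hx with h' | ⟨p, q, h1, h2, h3⟩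
          · exact h'
          · exact absurd ⟨q, hAB h3⟩ h
        refine ⟨⟨a, e⟩, fun x hx => ⟨hS hx, ?_⟩⟩
        rintro ⟨p, rfl⟩
        exact h ⟨p, hx⟩
    · rintro (⟨⟨a, rfl⟩, hS⟩ | ⟨h1, h2, -⟩)
      · have e : {x | A x a} = {x | B x a} := by
          ext x
          refine ⟨fun hx => hAB hx, fun hx => ?_⟩
          rcases (sup_map_rel j A s).1 hx with h' | ⟨p, q, h1, h2, h3⟩
          · exact h'
          · exact absurd ⟨q, rfl⟩ (hS (show A (j q) a from h3)).2
        exact ⟨⟨a, e⟩, fun x hx => (hS hx).1⟩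
      · exact ⟨h1, h2⟩
  have hdisj : Disjoint {S ∈ A.classes | S ⊆ M \ Set.range j}
      {S ∈ B.classes | S ⊆ M ∧ ∃ p, j p ∈ S} := by
    rw [Set.disjoint_left]
    rintro S ⟨-, h⟩ ⟨-, -, p, hp⟩
    exact (h hp).2 ⟨p, rfl⟩
  rw [key, Set.ncard_union_eq hdisj (Set.toFinite _) (Set.toFinite _)]
  congr 1
  have hc : B.comap j = A.comap j ⊔ s := comap_sup_map j A s
  rw [← hc]
  refine Set.ncard_congr (fun S _ => j ⁻¹' S) ?_ ?_ ?_
  · rintro _ ⟨⟨a, rfl⟩, hS, p, hp⟩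
    refine ⟨⟨p, ?_⟩, fun x hx => hS hx⟩
    ext x
    exact ⟨fun hx => B.trans hx (B.symm hp), fun hx => B.trans hx hp⟩
  · rintro _ _ ⟨⟨a, rfl⟩, hS, p, hp⟩ ⟨⟨b, rfl⟩, hS', p', hp'⟩ h
    have h1 : p ∈ j ⁻¹' {x | B x b} := by rw [← h]; exact hp
    have hab : B a b := B.trans (B.symm hp) h1
    ext x
    exact ⟨fun hx => B.trans hx hab, fun hx => B.trans hx (B.symm hab)⟩
  · rintro _ ⟨⟨p, rfl⟩, hS⟩
    refine ⟨{x | B x (j p)}, ⟨⟨j p, rfl⟩, fun x hx => ?_, p, B.refl _⟩, rfl⟩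
    by_cases hxr : x ∈ Set.range j
    · obtain ⟨q, rfl⟩ := hxr
      exact hS hx
    · exact hM x p hxr hx (hS (B.refl (j p)))

theorem ncard_classes_map {G V : Type} {k : V → G} (hk : k.Injective)
    (r : Setoid V) (N : Set G) (hN : N ⊆ Set.range k) :
    {S ∈ (r.map k).classes | S ⊆ N}.ncard = {S ∈ r.classes | S ⊆ k ⁻¹' N}.ncard := by
  symm
  refine Set.ncard_congr (fun S _ => k '' S) ?_ ?_ ?_
  · rintro _ ⟨⟨u, rfl⟩, hS⟩
    refine ⟨⟨k u, ?_⟩, by simpa using hS⟩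
    ext x
    simp only [Set.mem_image, Set.mem_ofPred_eq, map_rel_of_injective hk]
    constructor
    · rintro ⟨v, hv, rfl⟩
      exact Or.inr ⟨v, u, rfl, rfl, hv⟩
    · rintro (rfl | ⟨v, w, rfl, h2, h⟩)
      · exact ⟨u, r.refl _, rfl⟩
      · obtain rfl := hk h2
        exact ⟨v, h, rfl⟩
  · intro S T _ _ h
    exact hk.image_injective h
  · rintro _ ⟨⟨a, rfl⟩, hS⟩
    obtain ⟨u, rfl⟩ := hN (hS (Setoid.refl' _ _ : r.map k a a))
    have e : k '' {v | r v u} = {x | r.map k x (k u)} := by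
      ext x
      simp only [Set.mem_image, Set.mem_ofPred_eq, map_rel_of_injective hk]
      constructor
      · rintro ⟨v, hv, rfl⟩
        exact Or.inr ⟨v, u, rfl, rfl, hv⟩
      · rintro (rfl | ⟨v, w, rfl, h2, h⟩)
        · exact ⟨u, r.refl _, rfl⟩
        · obtain rfl := hk h2
          exact ⟨v, h, rfl⟩
    refine ⟨{v | r v u}, ⟨⟨u, rfl⟩, fun v hv => ?_⟩, e⟩
    exact hS (show r.map k (k v) (k u) from (map_rel_of_injective hk).2 (Or.inr ⟨v, u, rfl, rfl, hv⟩))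

theorem upper_injective : (upper : X ⊕ Y → X ⊕ (Y ⊕ Z)).Injective :=
  Function.Injective.sumMap Function.injective_id Sum.inl_injective

theorem lower_injective : (lower : Y ⊕ Z → X ⊕ (Y ⊕ Z)).Injective := Sum.inr_injective


theorem comap_outer_map_upper (g : Setoid (X ⊕ (Y ⊕ Z))) :
    (g.map (Sum.map id (Sum.map id Sum.inl) : X ⊕ (Y ⊕ Z) → X ⊕ (Y ⊕ (Z ⊕ W)))).comap outer =
      (g.comap outer).map upper := by
  have hk : (Sum.map id (Sum.map id Sum.inl) : X ⊕ (Y ⊕ Z) → X ⊕ (Y ⊕ (Z ⊕ W))).Injective :=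
    Function.Injective.sumMap Function.injective_id
      (Function.Injective.sumMap Function.injective_id Sum.inl_injective)
  ext a b
  rw [Setoid.comap_rel, map_rel_of_injective hk, map_rel_of_injective upper_injective]
  constructor
  · rintro (h | ⟨u, v, hu, hv, h⟩)
    · left
      rcases a with a | a | a <;> rcases b with b | b | b <;> simp_all [outer]
    · right
      rcases a with a | a | a <;> rcases b with b | b | b <;> rcases u with u | u | u <;>
        rcases v with v | v | v <;> simp_all [outer, upper, Setoid.comap_rel]
  · rintro (rfl | ⟨u, v, rfl, rfl, h⟩)
    · exact Or.inl rfl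
    · refine Or.inr ⟨outer u, outer v, ?_, ?_, h⟩
      · rcases u with u | u <;> rfl
      · rcases v with v | v <;> rfl

theorem comap_outer_map_lower (g : Setoid (Y ⊕ (Z ⊕ W))) :
    (g.map (lower : Y ⊕ (Z ⊕ W) → X ⊕ (Y ⊕ (Z ⊕ W)))).comap (Sum.map id outer) =
      (g.comap outer).map lower := by
  ext a b
  rw [Setoid.comap_rel, map_rel_of_injective lower_injective,
    map_rel_of_injective lower_injective]
  constructor
  · rintro (h | ⟨u, v, hu, hv, h⟩)
    · left
      rcases a with a | a | a <;> rcases b with b | b | b <;> simp_all [outer]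
    · right
      rcases a with a | a | a <;> rcases b with b | b | b <;>
        simp_all [outer, lower, Setoid.comap_rel]
  · rintro (rfl | ⟨u, v, rfl, rfl, h⟩)
    · exact Or.inl rfl
    · exact Or.inr ⟨outer u, outer v, rfl, rfl, h⟩

/-- Three diagrams placed on top of each other. -/
def glue₃ (r : Setoid (X ⊕ Y)) (s : Setoid (Y ⊕ Z)) (t : Setoid (Z ⊕ W)) :
    Setoid (X ⊕ (Y ⊕ (Z ⊕ W))) :=
  r.map upper ⊔ (glue s t).map lower

theorem glue₃_left (r : Setoid (X ⊕ Y)) (s : Setoid (Y ⊕ Z)) (t : Setoid (Z ⊕ W)) :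
    glue₃ r s t =
      (glue r s).map (Sum.map id (Sum.map id Sum.inl)) ⊔ (t.map lower).map outer := by
  unfold glue₃ glue
  simp only [map_sup, map_map, sup_assoc]
  have e1 : (Sum.map id (Sum.map id Sum.inl) ∘ upper : X ⊕ Y → X ⊕ (Y ⊕ (Z ⊕ W))) = upper := by
    ext x; rcases x with x | x <;> rfl
  rw [e1]
  rfl

theorem glue₃_right (r : Setoid (X ⊕ Y)) (s : Setoid (Y ⊕ Z)) (t : Setoid (Z ⊕ W)) :
    glue₃ r s t = (glue s t).map lower ⊔ (r.map upper).map (Sum.map id outer) := by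
  unfold glue₃
  have e1 : (Sum.map id outer ∘ upper : X ⊕ Y → X ⊕ (Y ⊕ (Z ⊕ W))) = upper := by
    ext x; rcases x with x | x <;> rfl
  rw [map_map, e1, sup_comm]

theorem comap_glue₃_left (r : Setoid (X ⊕ Y)) (s : Setoid (Y ⊕ Z)) (t : Setoid (Z ⊕ W)) :
    (glue₃ r s t).comap outer = glue ((glue r s).comap outer) t := by
  rw [glue₃_left, comap_sup_map, comap_outer_map_upper]
  rfl

theorem comap_glue₃_right (r : Setoid (X ⊕ Y)) (s : Setoid (Y ⊕ Z)) (t : Setoid (Z ⊕ W)) :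
    (glue₃ r s t).comap (Sum.map id outer) = glue r ((glue s t).comap outer) := by
  rw [glue₃_right, comap_sup_map, comap_outer_map_lower, sup_comm]
  rfl

/-- The number of closed components of colour `i` which arise when two diagrams are glued: the
connected components all of whose nodes lie in the middle row and have the colour `i`. -/
noncomputable def loops {K : Type} (r : Setoid (X ⊕ Y)) (s : Setoid (Y ⊕ Z)) (c : Y → K) (i : K) :
    ℕ :=
  {S ∈ (glue r s).classes | S ⊆ mid '' {y | c y = i}}.ncard

theorem loops_assoc {K : Type} [Finite X] [Finite Y] [Finite Z] [Finite W]
    (r : Setoid (X ⊕ Y)) (s : Setoid (Y ⊕ Z)) (t : Setoid (Z ⊕ W))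
    (cX : X → K) (cY : Y → K) (cZ : Z → K) (cW : W → K)
    (hr : r ≤ Setoid.ker (Sum.elim cX cY)) (hs : s ≤ Setoid.ker (Sum.elim cY cZ))
    (ht : t ≤ Setoid.ker (Sum.elim cZ cW)) (i : K) :
    loops r s cY i + loops ((glue r s).comap outer) t cZ i =
      loops s t cZ i + loops r ((glue s t).comap outer) cY i := by
  have hker : glue₃ r s t ≤
      Setoid.ker (Sum.elim cX (Sum.elim cY (Sum.elim cZ cW))) := by
    rw [glue₃, glue]
    simp only [map_sup, map_map, sup_le_iff, map_le_iff]
    refine ⟨fun a b h => ?_, fun a b h => ?_, fun a b h => ?_⟩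
    · have := hr h
      rcases a with a | a <;> rcases b with b | b <;> exact this
    · have := hs h
      rcases a with a | a <;> rcases b with b | b <;> exact this
    · have := ht h
      rcases a with a | a <;> rcases b with b | b <;> exact this
  let M : Set (X ⊕ (Y ⊕ (Z ⊕ W))) :=
    {g | Sum.elim (fun _ => False) (Sum.elim (fun y => cY y = i)
      (Sum.elim (fun z => cZ z = i) (fun _ => False))) g}
  have hL : {S ∈ (glue₃ r s t).classes | S ⊆ M}.ncard =
      loops r s cY i + loops ((glue r s).comap outer) t cZ i := by
    have h := hker
    rw [glue₃_left] at h ⊢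
    rw [ncard_classes_sup_map, comap_outer_map_upper, ncard_classes_map]
    · unfold loops
      have e1 : (Sum.map id (Sum.map id Sum.inl) : X ⊕ (Y ⊕ Z) → X ⊕ (Y ⊕ (Z ⊕ W))) ⁻¹'
          (M \ Set.range outer) = mid '' {y | cY y = i} := by
        ext g
        rcases g with x | y | z <;> simp [M, mid, outer]
      have e2 : (outer : X ⊕ (Z ⊕ W) → X ⊕ (Y ⊕ (Z ⊕ W))) ⁻¹' M = mid '' {z | cZ z = i} := by
        ext g
        rcases g with x | z | w <;> simp [M, mid, outer]
      rw [e1, e2]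
      rfl
    · exact Function.Injective.sumMap Function.injective_id
        (Function.Injective.sumMap Function.injective_id Sum.inl_injective)
    · rintro (x | y | z | w) ⟨h1, h2⟩
      · exact h1.elim
      · exact ⟨.inr (.inl y), rfl⟩
      · exact ⟨.inr (.inr z), rfl⟩
      · exact h1.elim
    · rintro (x | y | z) (x' | z' | w') h1 h2 h3
      all_goals first
        | exact h3.elim
        | exact (h1 ⟨.inl _, rfl⟩).elim
        | exact (h1 ⟨.inr _, rfl⟩).elim
        | exact (h h2).trans h3
  have hR : {S ∈ (glue₃ r s t).classes | S ⊆ M}.ncard =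
      loops s t cZ i + loops r ((glue s t).comap outer) cY i := by
    have h := hker
    rw [glue₃_right] at h ⊢
    rw [ncard_classes_sup_map, comap_outer_map_lower, ncard_classes_map lower_injective]
    · unfold loops
      have e1 : (lower : Y ⊕ (Z ⊕ W) → X ⊕ (Y ⊕ (Z ⊕ W))) ⁻¹'
          (M \ Set.range (Sum.map id outer)) = mid '' {z | cZ z = i} := by
        ext g
        rcases g with x | y | z <;> simp [M, mid, outer, lower]
      have e2 : (Sum.map id outer : X ⊕ (Y ⊕ W) → X ⊕ (Y ⊕ (Z ⊕ W))) ⁻¹' M =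
          mid '' {y | cY y = i} := by
        ext g
        rcases g with x | z | w <;> simp [M, mid, outer]
      rw [e1, e2, sup_comm]
      rfl
    · rintro (x | y | z | w) ⟨h1, h2⟩
      · exact h1.elim
      · exact ⟨.inl y, rfl⟩
      · exact ⟨.inr (.inl z), rfl⟩
      · exact h1.elim
    · rintro (x | y | z | w) (x' | y' | w') h1 h2 h3
      all_goals first
        | exact h3.elim
        | exact (h1 ⟨.inl _, rfl⟩).elim
        | exact (h1 ⟨.inr (.inl _), rfl⟩).elim
        | exact (h1 ⟨.inr (.inr _), rfl⟩).elim
        | exact (h h2).trans h3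
  rw [← hL, hR]


/-- Reflection of the three rows of a glued picture. -/
def rev : Z ⊕ (Y ⊕ X) → X ⊕ (Y ⊕ Z) :=
  Sum.elim (fun z => .inr (.inr z)) (Sum.elim (fun y => .inr (.inl y)) .inl)

theorem rev_rev (g : X ⊕ (Y ⊕ Z)) : rev (rev g) = g := by
  rcases g with x | y | z <;> rfl

theorem glue_swap_le (r : Setoid (X ⊕ Y)) (s : Setoid (Y ⊕ Z)) :
    glue (s.comap Sum.swap) (r.comap Sum.swap) ≤ (glue r s).comap rev := by
  have h1 : r ≤ (glue r s).comap upper := map_le_iff.1 le_sup_left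
  have h2 : s ≤ (glue r s).comap lower := map_le_iff.1 le_sup_right
  refine sup_le (map_le_iff.2 fun a b h => ?_) (map_le_iff.2 fun a b h => ?_)
  · have := h2 h
    rcases a with a | a <;> rcases b with b | b <;> exact this
  · have := h1 h
    rcases a with a | a <;> rcases b with b | b <;> exact this

theorem comap_swap_swap {A B : Type} (r : Setoid (A ⊕ B)) :
    (r.comap Sum.swap).comap Sum.swap = r := by
  ext a b
  simp [Setoid.comap_rel]

theorem glue_swap (r : Setoid (X ⊕ Y)) (s : Setoid (Y ⊕ Z)) :
    glue (s.comap Sum.swap) (r.comap Sum.swap) = (glue r s).comap rev := by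
  apply le_antisymm (glue_swap_le r s)
  intro a b h
  have h2 := glue_swap_le (s.comap Sum.swap) (r.comap Sum.swap)
  rw [comap_swap_swap, comap_swap_swap] at h2
  have h3 := h2 h
  rwa [Setoid.comap_rel, rev_rev, rev_rev] at h3

theorem loops_swap {K : Type} (r : Setoid (X ⊕ Y)) (s : Setoid (Y ⊕ Z)) (c : Y → K) (i : K) :
    loops (s.comap Sum.swap) (r.comap Sum.swap) c i = loops r s c i := by
  unfold loops
  rw [glue_swap]
  symm
  refine Set.ncard_congr (fun S _ => rev ⁻¹' S) ?_ ?_ ?_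
  · rintro _ ⟨⟨a, rfl⟩, hS⟩
    refine ⟨⟨rev a, ?_⟩, ?_⟩
    · ext x
      simp [Setoid.comap_rel, rev_rev]
    · intro x hx
      obtain ⟨y, hy, h⟩ := hS hx
      refine ⟨y, hy, ?_⟩
      rw [← rev_rev x, ← h]
      rfl
  · intro S T _ _ h
    have hs : Function.Surjective (rev : Z ⊕ (Y ⊕ X) → X ⊕ (Y ⊕ Z)) := fun g => ⟨rev g, rev_rev g⟩
    exact hs.preimage_injective h
  · rintro _ ⟨⟨a, rfl⟩, hS⟩
    refine ⟨{x | glue r s x (rev a)}, ⟨⟨rev a, rfl⟩, fun x hx => ?_⟩, rfl⟩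
    have h' : rev x ∈ {x | ((glue r s).comap rev) x a} := by
      simpa [Setoid.comap_rel, rev_rev] using hx
    obtain ⟨y, hy, h⟩ := hS h'
    refine ⟨y, hy, ?_⟩
    rw [← rev_rev x, ← h]
    rfl

/-- The relation of the identity diagram: node `x` of the top is connected with node `x` of the
bottom. -/
abbrev idRel (X : Type) : Setoid (X ⊕ X) := Setoid.ker (Sum.elim id id)

theorem glue_id (r : Setoid (X ⊕ Y)) :
    glue (idRel X) r = r.comap (Sum.elim Sum.inl (Sum.elim Sum.inl Sum.inr)) := by
  apply le_antisymm
  · refine sup_le (map_le_iff.2 fun a b h => ?_) (map_le_iff.2 fun a b h => ?_)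
    · rcases a with a | a <;> rcases b with b | b <;> (obtain rfl : a = b := h) <;>
        exact Setoid.refl' r _
    · rcases a with a | a <;> rcases b with b | b <;> exact h
  · have h1 : idRel X ≤ (glue (idRel X) r).comap upper := map_le_iff.1 le_sup_left
    have h2 : r ≤ (glue (idRel X) r).comap lower := map_le_iff.1 le_sup_right
    have h3 : ∀ g : X ⊕ (X ⊕ Y), glue (idRel X) r g
        (lower (Sum.elim Sum.inl (Sum.elim Sum.inl Sum.inr) g)) := by
      rintro (x | x | y)
      · exact h1 (show idRel X (.inl x) (.inr x) from rfl)
      · exact Setoid.refl' _ _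
      · exact Setoid.refl' _ _
    intro a b h
    exact Setoid.trans' _ (h3 a) (Setoid.trans' _ (h2 h) (Setoid.symm' _ (h3 b)))

theorem loops_id {K : Type} (r : Setoid (X ⊕ Y)) (c : X → K) (i : K) :
    loops (idRel X) r c i = 0 := by
  unfold loops
  suffices h : {S ∈ (glue (idRel X) r).classes | S ⊆ mid '' {y | c y = i}} = ∅ by
    rw [h, Set.ncard_empty]
  rw [Set.eq_empty_iff_forall_notMem]
  rintro _ ⟨⟨a, rfl⟩, hS⟩
  obtain ⟨x, -, rfl⟩ := hS (Setoid.refl' (glue (idRel X) r) a)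
  have h : glue (idRel X) r (.inl x) (mid x) := by
    rw [glue_id]
    exact Setoid.refl' r _
  obtain ⟨y, -, hy⟩ := hS h
  cases hy

end Gluing

section Diagrams

variable {K X Y Z W : Type}

/-- A multi-colour partition diagram with colours in `K`, top row `X` and bottom row `Y`: all nodes
are coloured and partitioned, and nodes in the same part have the same colour.  This is the same as
a partition, for each colour `i`, of the set of nodes of colour `i`. -/
@[ext]
structure Diagram (K X Y : Type) where
  colour : X ⊕ Y → K
  rel : Setoid (X ⊕ Y)
  colour_eq : ∀ a b, rel a b → colour a = colour b

namespace Diagram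

/-- `d` can be placed on top of `e`: the colours in the middle row agree. -/
def Match (d : Diagram K X Y) (e : Diagram K Y Z) : Prop :=
  ∀ y, d.colour (.inr y) = e.colour (.inl y)

theorem glue_colour (d : Diagram K X Y) (e : Diagram K Y Z) (h : d.Match e) :
    glue d.rel e.rel ≤ Setoid.ker (Sum.elim (d.colour ∘ .inl) e.colour) := by
  refine sup_le (map_le_iff.2 fun a b hab => ?_) (map_le_iff.2 fun a b hab => ?_)
  · have := d.colour_eq a b hab
    rcases a with a | a <;> rcases b with b | b <;>
      simpa [Setoid.comap_rel, Setoid.ker_def, upper, ← h _] using this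
  · exact e.colour_eq a b hab

/-- `d` placed on top of `e`; closed components in the middle row are dropped. -/
def comp (d : Diagram K X Y) (e : Diagram K Y Z) (h : d.Match e) : Diagram K X Z where
  colour := Sum.elim (d.colour ∘ .inl) (e.colour ∘ .inr)
  rel := (glue d.rel e.rel).comap outer
  colour_eq a b hab := by
    have := d.glue_colour e h hab
    rcases a with a | a <;> rcases b with b | b <;> exact this

/-- The diagram connecting each node of the top to the same node of the bottom. -/
def idDiagram (c : X → K) : Diagram K X X where
  colour := Sum.elim c c
  rel := idRel X
  colour_eq a b hab := by
    rcases a with a | a <;> rcases b with b | b <;> (obtain rfl : a = b := hab) <;> rfl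

/-- Reflection of a diagram in a horizontal line. -/
def flip (d : Diagram K X Y) : Diagram K Y X where
  colour := d.colour ∘ Sum.swap
  rel := d.rel.comap Sum.swap
  colour_eq _ _ hab := d.colour_eq _ _ hab

theorem flip_flip (d : Diagram K X Y) : d.flip.flip = d := by
  ext a
  · simp [flip]
  · change d.rel (Sum.swap (Sum.swap _)) (Sum.swap (Sum.swap _)) ↔ _
    rw [Sum.swap_swap, Sum.swap_swap]

theorem flip_idDiagram (c : X → K) : (idDiagram c).flip = idDiagram c := by
  ext a b
  · rcases a with a | a <;> rfl
  · rcases a with a | a <;> rcases b with b | b <;> rfl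

theorem match_flip {d : Diagram K X Y} {e : Diagram K Y Z} : e.flip.Match d.flip ↔ d.Match e :=
  ⟨fun h y => (h y).symm, fun h y => (h y).symm⟩

theorem flip_comp (d : Diagram K X Y) (e : Diagram K Y Z) (h : d.Match e) :
    (d.comp e h).flip = e.flip.comp d.flip (match_flip.2 h) := by
  ext a b
  · rcases a with a | a <;> rfl
  · change _ ↔ ((glue (e.rel.comap Sum.swap) (d.rel.comap Sum.swap)).comap outer) a b
    rw [glue_swap]
    rcases a with a | a <;> rcases b with b | b <;> rfl

theorem idDiagram_comp (c : X → K) (d : Diagram K X Y) (h : (idDiagram c).Match d) :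
    (idDiagram c).comp d h = d := by
  ext a b
  · rcases a with a | a
    · exact h a
    · rfl
  · change ((glue (idRel X) d.rel).comap outer) a b ↔ _
    rw [glue_id]
    rcases a with a | a <;> rcases b with b | b <;> rfl

theorem comp_assoc (d : Diagram K X Y) (e : Diagram K Y Z) (f : Diagram K Z W)
    (h1 : d.Match e) (h2 : e.Match f) :
    (d.comp e h1).comp f h2 = d.comp (e.comp f h2) h1 := by
  ext a b
  · rcases a with a | a <;> rfl
  · change ((glue ((glue d.rel e.rel).comap outer) f.rel).comap outer) a b ↔
      ((glue d.rel ((glue e.rel f.rel).comap outer)).comap outer) a b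
    rw [← comap_glue₃_left, ← comap_glue₃_right]
    rcases a with a | a <;> rcases b with b | b <;> rfl

/-- The order in which one meets the nodes on the boundary of the rectangle: the top row from left
to right, then the bottom row from right to left. -/
def Before [LT X] [LT Y] : X ⊕ Y → X ⊕ Y → Prop
  | .inl a, .inl b => a < b
  | .inl _, .inr _ => True
  | .inr _, .inl _ => False
  | .inr a, .inr b => b < a

/-- There are no crossings between parts of the same colour. -/
def IsPlanar [LT X] [LT Y] (d : Diagram K X Y) : Prop :=
  ∀ a b c e, Before a b → Before b c → Before c e → d.colour a = d.colour b →
    d.rel a c → d.rel b e → d.rel a b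

/-- All parts have size two. -/
def IsPairing (d : Diagram K X Y) : Prop := ∀ a, ∃! b, b ≠ a ∧ d.rel a b

/-- The diagrams of the bubble algebra: planar, and all parts have size two. -/
def IsBubble [LT X] [LT Y] (d : Diagram K X Y) : Prop := d.IsPlanar ∧ d.IsPairing

theorem before_swap [LT X] [LT Y] {a b : X ⊕ Y} : Before a.swap b.swap ↔ Before b a := by
  rcases a with a | a <;> rcases b with b | b <;> simp [Before]

theorem IsBubble.flip [LT X] [LT Y] {d : Diagram K X Y} (h : d.IsBubble) : d.flip.IsBubble := by
  refine ⟨fun a b c e h1 h2 h3 h4 h5 h6 => ?_, fun a => ?_⟩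
  · have hba := before_swap.2 h1
    have hcb := before_swap.2 h2
    have hec := before_swap.2 h3
    have h7 : d.rel e.swap c.swap :=
      h.1 e.swap c.swap b.swap a.swap (by simpa using hec) (by simpa using hcb)
        (by simpa using hba) (by
          have e1 : d.colour a.swap = d.colour c.swap := d.colour_eq _ _ h5
          have e2 : d.colour b.swap = d.colour e.swap := d.colour_eq _ _ h6
          have e3 : d.colour a.swap = d.colour b.swap := h4
          rw [← e2, ← e1, e3]) (Setoid.symm' _ h6) (Setoid.symm' _ h5)
    have h8 := Setoid.symm' _ h7
    exact Setoid.trans' _ h5 (Setoid.trans' _ h8 (Setoid.symm' _ h6))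
  · obtain ⟨b, ⟨hb1, hb2⟩, hb3⟩ := h.2 a.swap
    refine ⟨b.swap, ⟨fun hh => hb1 (by rw [← hh]; simp), ?_⟩, ?_⟩
    · change d.rel a.swap b.swap.swap
      simpa using hb2
    · rintro c ⟨hc1, hc2⟩
      have := hb3 c.swap ⟨fun hh => hc1 (by simpa using congrArg Sum.swap hh), hc2⟩
      rw [← this]
      simp

end Diagram


section Algebra

variable (δ : K → ℂ)

/-- The vector space with basis the multi-colour partition diagrams with top row `X` and bottom row
`Y`; the parameters `δ` are recorded in the type since they determine the product. -/
def DiagramSpace (_ : K → ℂ) (X Y : Type) : Type := Diagram K X Y →₀ ℂ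

noncomputable instance : AddCommGroup (DiagramSpace δ X Y) :=
  inferInstanceAs (AddCommGroup (Diagram K X Y →₀ ℂ))

noncomputable instance : Module ℂ (DiagramSpace δ X Y) :=
  inferInstanceAs (Module ℂ (Diagram K X Y →₀ ℂ))

/-- A diagram as a basis vector. -/
noncomputable def single (d : Diagram K X Y) : DiagramSpace δ X Y := Finsupp.single d (1 : ℂ)

/-- The coefficient of a diagram. -/
noncomputable def coeff (d : Diagram K X Y) : DiagramSpace δ X Y →ₗ[ℂ] ℂ := Finsupp.lapply d

/-- The linear extension of the reflection of diagrams. -/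
noncomputable def flipLin : DiagramSpace δ X Y →ₗ[ℂ] DiagramSpace δ Y X :=
  Finsupp.linearCombination ℂ (fun d : Diagram K X Y => single δ d.flip)

variable {δ}

theorem flipLin_single (d : Diagram K X Y) : flipLin δ (single δ d) = single δ d.flip := by
  unfold flipLin single
  erw [Finsupp.linearCombination_single, one_smul]

theorem coeff_single_self (d : Diagram K X Y) : coeff δ d (single δ d) = 1 :=
  Finsupp.single_eq_same

theorem coeff_single_of_ne {d e : Diagram K X Y} (h : d ≠ e) : coeff δ d (single δ e) = 0 :=
  Finsupp.single_eq_of_ne h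

theorem space_induction {p : DiagramSpace δ X Y → Prop} (a : DiagramSpace δ X Y) (h0 : p 0)
    (hadd : ∀ a b, p a → p b → p (a + b)) (hs : ∀ (c : ℂ) d, p (c • single δ d)) : p a := by
  refine Finsupp.induction_linear (motive := p) a h0 hadd fun d c => ?_
  have := hs c d
  unfold single at this
  erw [Finsupp.smul_single, smul_eq_mul, mul_one] at this
  exact this

theorem flipLin_flipLin (a : DiagramSpace δ X Y) : flipLin δ (flipLin δ a) = a := by
  induction a using space_induction with
  | h0 => simp
  | hadd a a' ha ha' => simp [ha, ha']
  | hs x d => simp only [map_smul, flipLin_single, Diagram.flip_flip]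

section Product

variable [Fintype K] (δ)

open Classical in
/-- The product of two diagrams, the first one on top of the second one: zero if the colours in the
middle row differ; otherwise every closed component of colour `i` is replaced by `δ i`. -/
noncomputable def mulDiagram (d : Diagram K X Y) (e : Diagram K Y Z) : DiagramSpace δ X Z :=
  if h : d.Match e then
    (∏ i, δ i ^ loops d.rel e.rel (fun y => d.colour (.inr y)) i) • single δ (d.comp e h)
  else 0

/-- The bilinear extension of the product of diagrams. -/
noncomputable def mulLin :
    DiagramSpace δ X Y →ₗ[ℂ] DiagramSpace δ Y Z →ₗ[ℂ] DiagramSpace δ X Z :=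
  Finsupp.linearCombination ℂ (fun d : Diagram K X Y =>
    (Finsupp.linearCombination ℂ (fun e : Diagram K Y Z => mulDiagram δ d e) :
      DiagramSpace δ Y Z →ₗ[ℂ] DiagramSpace δ X Z))

variable {δ}

theorem mulLin_single (d : Diagram K X Y) (e : Diagram K Y Z) :
    mulLin δ (single δ d) (single δ e) = mulDiagram δ d e := by
  unfold mulLin single
  erw [Finsupp.linearCombination_single, one_smul, Finsupp.linearCombination_single, one_smul]

theorem mulLin_assoc [Finite X] [Finite Y] [Finite Z] [Finite W] (a : DiagramSpace δ X Y)
    (b : DiagramSpace δ Y Z) (c : DiagramSpace δ Z W) :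
    mulLin δ (mulLin δ a b) c = mulLin δ a (mulLin δ b c) := by
  induction a using space_induction with
  | h0 => simp
  | hadd a a' ha ha' => simp [ha, ha']
  | hs x d =>
  induction b using space_induction with
  | h0 => simp
  | hadd b b' hb hb' =>
    simp only [map_add, LinearMap.add_apply, hb, hb']
  | hs y e =>
  induction c using space_induction with
  | h0 => simp
  | hadd c c' hc hc' => simp only [map_add, hc, hc']
  | hs z f =>
  simp only [map_smul, LinearMap.smul_apply, mulLin_single]
  congr 3
  unfold mulDiagram
  by_cases h1 : d.Match e
  · by_cases h2 : e.Match f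
    · have h1' : d.Match (e.comp f h2) := h1
      have h2' : (d.comp e h1).Match f := h2
      rw [dif_pos h1, dif_pos h2, map_smul, map_smul, LinearMap.smul_apply, mulLin_single,
        mulLin_single, mulDiagram, mulDiagram, dif_pos h1', dif_pos h2', smul_smul, smul_smul,
        ← Finset.prod_mul_distrib, ← Finset.prod_mul_distrib,
        show (d.comp e h1).comp f h2' = d.comp (e.comp f h2) h1' from
          Diagram.comp_assoc d e f h1 h2]
      congr 1
      refine Finset.prod_congr rfl fun i _ => ?_
      rw [← pow_add, ← pow_add]
      congr 1
      have hfun : (fun z => e.colour (.inr z)) = fun z => f.colour (.inl z) := funext h2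
      have := loops_assoc d.rel e.rel f.rel (fun x => d.colour (.inl x))
        (fun y => d.colour (.inr y)) (fun z => e.colour (.inr z)) (fun w => f.colour (.inr w))
        (fun a b hab => by
          have := d.colour_eq a b hab
          rcases a with a | a <;> rcases b with b | b <;> exact this)
        (fun a b hab => by
          have := e.colour_eq a b hab
          rcases a with a | a <;> rcases b with b | b <;>
            simpa [Setoid.ker_def, h1 _] using this)
        (fun a b hab => by
          have := f.colour_eq a b hab
          rcases a with a | a <;> rcases b with b | b <;>
            simpa [Setoid.ker_def, h2 _] using this) i
      exact this
    · have h2' : ¬ (d.comp e h1).Match f := h2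
      rw [dif_pos h1, dif_neg h2, map_zero, map_smul, LinearMap.smul_apply, mulLin_single,
        mulDiagram, dif_neg h2', smul_zero]
  · rw [dif_neg h1, map_zero, LinearMap.zero_apply]
    by_cases h2 : e.Match f
    · have h1' : ¬ d.Match (e.comp f h2) := h1
      rw [dif_pos h2, map_smul, mulLin_single, mulDiagram, dif_neg h1', smul_zero]
    · rw [dif_neg h2, map_zero]

theorem flipLin_mulLin (a : DiagramSpace δ X Y) (b : DiagramSpace δ Y Z) :
    flipLin δ (mulLin δ a b) = mulLin δ (flipLin δ b) (flipLin δ a) := by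
  induction a using space_induction with
  | h0 => simp
  | hadd a a' ha ha' => simp [ha, ha']
  | hs x d =>
  induction b using space_induction with
  | h0 => simp
  | hadd b b' hb hb' =>
    simp only [map_add, LinearMap.add_apply, hb, hb']
  | hs y e =>
  simp only [map_smul, LinearMap.smul_apply, mulLin_single, flipLin_single]
  rw [smul_comm]
  congr 2
  unfold mulDiagram
  by_cases h : d.Match e
  · rw [dif_pos h, dif_pos (Diagram.match_flip.2 h), map_smul, flipLin_single, Diagram.flip_comp]
    congr 1
    refine Finset.prod_congr rfl fun i _ => ?_
    have := loops_swap d.rel e.rel (fun y => d.colour (.inr y)) i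
    have hc : (fun y => e.flip.colour (.inr y)) = fun y => d.colour (.inr y) :=
      funext fun y => (h y).symm
    rw [hc]
    exact congrArg _ this.symm
  · rw [dif_neg h, dif_neg (mt Diagram.match_flip.1 h), map_zero]

variable (δ) in
/-- The sum of all colourings of the identity diagram. -/
noncomputable def oneSpace (X : Type) [Fintype X] [DecidableEq X] : DiagramSpace δ X X :=
  ∑ c : X → K, single δ (Diagram.idDiagram c)

theorem oneSpace_mulLin [Fintype X] [DecidableEq X] (a : DiagramSpace δ X Y) :
    mulLin δ (oneSpace δ X) a = a := by
  induction a using space_induction with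
  | h0 => simp
  | hadd a a' ha ha' => simp [ha, ha']
  | hs x d =>
  rw [map_smul]
  congr 1
  rw [oneSpace, map_sum, LinearMap.sum_apply, Finset.sum_eq_single (fun x => d.colour (.inl x))]
  · have h : (Diagram.idDiagram (fun x => d.colour (.inl x))).Match d := fun x => rfl
    rw [mulLin_single, mulDiagram, dif_pos h, Diagram.idDiagram_comp]
    convert one_smul ℂ _
    refine Finset.prod_eq_one fun i _ => ?_
    erw [loops_id, pow_zero]
  · intro c _ hc
    have h : ¬ (Diagram.idDiagram c).Match d := fun h => hc (funext h)
    rw [mulLin_single, mulDiagram, dif_neg h]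
  · intro h
    exact absurd (Finset.mem_univ _) h

theorem flipLin_oneSpace [Fintype X] [DecidableEq X] :
    flipLin δ (oneSpace δ X) = oneSpace δ X := by
  simp only [oneSpace, map_sum, flipLin_single, Diagram.flip_idDiagram]

theorem mulLin_oneSpace [Fintype Y] [DecidableEq Y] (a : DiagramSpace δ X Y) :
    mulLin δ a (oneSpace δ Y) = a := by
  rw [← flipLin_flipLin (mulLin δ a (oneSpace δ Y)), flipLin_mulLin, flipLin_oneSpace,
    oneSpace_mulLin, flipLin_flipLin]

/-- The multi-colour partition algebra on `n` nodes with colours `K` and parameters `δ`. -/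
abbrev PartitionAlgebra (δ : K → ℂ) (n : ℕ) : Type := DiagramSpace δ (Fin n) (Fin n)

noncomputable instance (n : ℕ) : Ring (PartitionAlgebra δ n) :=
  { (inferInstance : AddCommGroup (PartitionAlgebra δ n)) with
    mul := fun a b => mulLin δ a b
    one := oneSpace δ (Fin n)
    left_distrib := fun a b c => map_add (mulLin δ a) b c
    right_distrib := fun a b c => LinearMap.map_add₂ (mulLin δ) a b c
    zero_mul := fun a => LinearMap.map_zero₂ (mulLin δ) a
    mul_zero := fun a => map_zero (mulLin δ a)
    mul_assoc := fun a b c => mulLin_assoc a b c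
    one_mul := fun a => oneSpace_mulLin a
    mul_one := fun a => mulLin_oneSpace a }

noncomputable instance (n : ℕ) : Algebra ℂ (PartitionAlgebra δ n) :=
  Algebra.ofModule (fun r a b => LinearMap.map_smul₂ (mulLin δ) r a b)
    (fun r a b => map_smul (mulLin δ a) r b)

/-- Diagrams with `n` nodes on the top act on the left, from above, on diagrams with `n` nodes in
the top row. -/
noncomputable instance (n : ℕ) [Finite Y] :
    Module (PartitionAlgebra δ n) (DiagramSpace δ (Fin n) Y) where
  smul a x := mulLin δ a x
  one_smul a := oneSpace_mulLin a
  mul_smul a b x := mulLin_assoc a b x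
  smul_zero a := map_zero (mulLin δ a)
  smul_add a x y := map_add (mulLin δ a) x y
  add_smul a b x := LinearMap.map_add₂ (mulLin δ) a b x
  zero_smul x := LinearMap.map_zero₂ (mulLin δ) x

instance (n : ℕ) [Finite Y] :
    IsScalarTower ℂ (PartitionAlgebra δ n) (DiagramSpace δ (Fin n) Y) :=
  ⟨fun r a x => LinearMap.map_smul₂ (mulLin δ) r a x⟩

/-- The bubble algebra: the subalgebra of the multi-colour partition algebra consisting of the
combinations of planar diagrams all of whose parts have size two.  Products of such diagrams are
multiples of such diagrams, so the subalgebra which they generate is also their linear span. -/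
noncomputable def bubbleAlgebra (δ : K → ℂ) (n : ℕ) : Subalgebra ℂ (PartitionAlgebra δ n) :=
  Algebra.adjoin ℂ {a | ∃ d : Diagram K (Fin n) (Fin n), d.IsBubble ∧ a = single δ d}

theorem flipLin_mem {n : ℕ} {a : PartitionAlgebra δ n} (ha : a ∈ bubbleAlgebra δ n) :
    flipLin δ a ∈ bubbleAlgebra δ n := by
  unfold bubbleAlgebra at ha
  induction ha using Algebra.adjoin_induction with
  | mem x hx =>
    obtain ⟨d, hd, rfl⟩ := hx
    rw [flipLin_single]
    exact Algebra.subset_adjoin ⟨_, hd.flip, rfl⟩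
  | algebraMap r =>
    have h : flipLin δ (algebraMap ℂ (PartitionAlgebra δ n) r) = algebraMap ℂ _ r := by
      rw [Algebra.algebraMap_eq_smul_one, map_smul]
      exact congrArg _ flipLin_oneSpace
    rw [h]
    exact Subalgebra.algebraMap_mem _ r
  | add x y _ _ hx hy => rw [map_add]; exact add_mem hx hy
  | mul x y _ _ hx hy =>
    have h : flipLin δ (x * y) = flipLin δ y * flipLin δ x := flipLin_mulLin x y
    rw [h]
    exact mul_mem hy hx

end Product

end Algebra

end Diagrams

section CellModules

variable (δ : Fin 2 → ℂ) (n : ℕ) (μ : Fin 2 → ℕ)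

/-- `μ 0` nodes of the first colour followed by `μ 1` nodes of the second colour. -/
def standardColour : Fin (μ 0 + μ 1) → Fin 2 := Fin.append (fun _ => 0) (fun _ => 1)

/-- Planar diagrams with all parts of size two, with `n` nodes on the top (of any colours) and, on the
bottom, `μ 0` nodes of the first colour followed by `μ 1` nodes of the second colour.  Those in which
all bottom nodes are on propagating lines are the half-diagrams with `μ i` defects of colour `i`: the
bottom nodes are the ends of the defects. -/
def IsUpper (d : Diagram (Fin 2) (Fin n) (Fin (μ 0 + μ 1))) : Prop :=
  d.IsBubble ∧ ∀ b, d.colour (.inr b) = standardColour μ b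

/-- Some two nodes of the bottom are joined by an arc, that is, there are fewer than `μ i`
propagating lines of some colour `i`. -/
def HasBottomArc (d : Diagram (Fin 2) (Fin n) (Fin (μ 0 + μ 1))) : Prop :=
  ∃ b b', b ≠ b' ∧ d.rel (.inr b) (.inr b')

/-- The module generated by all these diagrams, with `bubbleAlgebra δ n` acting from above. -/
noncomputable def upperModule :
    Submodule (bubbleAlgebra δ n) (DiagramSpace δ (Fin n) (Fin (μ 0 + μ 1))) :=
  Submodule.span _ {x | ∃ d, IsUpper n μ d ∧ x = single δ d}

/-- The submodule generated by the diagrams with fewer propagating lines. -/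
noncomputable def lowerModule :
    Submodule (bubbleAlgebra δ n) (DiagramSpace δ (Fin n) (Fin (μ 0 + μ 1))) :=
  Submodule.span _ {x | ∃ d, IsUpper n μ d ∧ HasBottomArc n μ d ∧ x = single δ d}

/-- The cell module `Δ_n(μ)`: its basis is the set of half-diagrams with `μ i` defects of colour `i`,
and a product is zero when it has fewer defects.  It is zero if `μ 0 + μ 1 > n`, as then every diagram
has an arc on the bottom. -/
abbrev CellModule : Type :=
  upperModule δ n μ ⧸ (lowerModule δ n μ).submoduleOf (upperModule δ n μ)

/-- The bilinear form on diagrams: the coefficient of the identity diagram in the product of the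
reflection of `x`, on top, and `y`.  For half-diagrams `x`, `y`, this is the product of the parameters
of the closed loops if the colours of the nodes agree and all defects of `x` are joined to
defects of `y`, and it is zero otherwise. -/
noncomputable def pairing :
    DiagramSpace δ (Fin n) (Fin (μ 0 + μ 1)) →ₗ[ℂ]
      DiagramSpace δ (Fin n) (Fin (μ 0 + μ 1)) →ₗ[ℂ] ℂ :=
  ((mulLin δ).compr₂ (coeff δ (Diagram.idDiagram (standardColour μ)))).comp (flipLin δ)

variable {δ n μ}

theorem pairing_apply (x y : DiagramSpace δ (Fin n) (Fin (μ 0 + μ 1))) :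
    pairing δ n μ x y =
      coeff δ (Diagram.idDiagram (standardColour μ)) (mulLin δ (flipLin δ x) y) := rfl

theorem coeff_id_flipLin (a : DiagramSpace δ (Fin (μ 0 + μ 1)) (Fin (μ 0 + μ 1))) :
    coeff δ (Diagram.idDiagram (standardColour μ)) (flipLin δ a) =
      coeff δ (Diagram.idDiagram (standardColour μ)) a := by
  induction a using space_induction with
  | h0 => simp
  | hadd a a' ha ha' => simp [ha, ha']
  | hs x d =>
    simp only [map_smul, flipLin_single]
    congr 1
    by_cases h : Diagram.idDiagram (standardColour μ) = d
    · rw [← h, Diagram.flip_idDiagram]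
    · rw [coeff_single_of_ne h, coeff_single_of_ne]
      intro h'
      apply h
      rw [← Diagram.flip_idDiagram, h', Diagram.flip_flip]

theorem pairing_comm (x y : DiagramSpace δ (Fin n) (Fin (μ 0 + μ 1))) :
    pairing δ n μ x y = pairing δ n μ y x := by
  rw [pairing_apply, pairing_apply, ← coeff_id_flipLin, flipLin_mulLin, flipLin_flipLin]

theorem pairing_smul (a : bubbleAlgebra δ n) (x y : DiagramSpace δ (Fin n) (Fin (μ 0 + μ 1))) :
    pairing δ n μ x (a • y) =
      pairing δ n μ ((⟨flipLin δ a.1, flipLin_mem a.2⟩ : bubbleAlgebra δ n) • x) y := by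
  change coeff δ _ (mulLin δ (flipLin δ x) (mulLin δ a.1 y)) =
    coeff δ _ (mulLin δ (flipLin δ (mulLin δ (flipLin δ a.1) x)) y)
  rw [flipLin_mulLin, flipLin_flipLin, mulLin_assoc]

theorem pairing_lower (x : DiagramSpace δ (Fin n) (Fin (μ 0 + μ 1)))
    {y : DiagramSpace δ (Fin n) (Fin (μ 0 + μ 1))} (hy : y ∈ lowerModule δ n μ) :
    pairing δ n μ x y = 0 := by
  unfold lowerModule at hy
  induction hy using Submodule.span_induction generalizing x with
  | zero => rw [map_zero]
  | add y z _ _ hy hz => rw [map_add, hy, hz, add_zero]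
  | smul a y _ hy => rw [pairing_smul, hy]
  | mem y hy =>
    obtain ⟨d, -, ⟨b, b', hb, h⟩, rfl⟩ := hy
    induction x using space_induction with
    | h0 => simp
    | hadd x x' hx hx' => rw [map_add, LinearMap.add_apply, hx, hx', add_zero]
    | hs c e =>
      rw [map_smul, LinearMap.smul_apply, pairing_apply, flipLin_single, mulLin_single, mulDiagram]
      split_ifs with hm
      · rw [map_smul, coeff_single_of_ne, smul_zero, smul_zero]
        intro h'
        have h1 : (e.flip.comp d hm).rel (.inr b) (.inr b') :=
          (map_le_iff.1 le_sup_right : d.rel ≤ (glue e.flip.rel d.rel).comap lower) h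
        rw [← h'] at h1
        exact hb h1
      · rw [map_zero, smul_zero]

variable (δ n μ)

/-- The bilinear form of the cell module, induced by `pairing`. -/
noncomputable def cellForm : CellModule δ n μ →ₗ[ℂ] CellModule δ n μ →ₗ[ℂ] ℂ :=
  LinearMap.mk₂ ℂ
    (fun x y => Quotient.liftOn₂' x y (fun x y => pairing δ n μ x.1 y.1) (by
      intro x y x' y' hx hy
      rw [Submodule.quotientRel_def] at hx hy
      have h1 : pairing δ n μ (x.1 - x'.1) y.1 = 0 := by
        rw [pairing_comm]
        exact pairing_lower _ hx
      have h2 : pairing δ n μ x'.1 (y.1 - y'.1) = 0 := pairing_lower _ hy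
      rw [map_sub, LinearMap.sub_apply] at h1
      rw [map_sub] at h2
      exact (sub_eq_zero.1 h1).trans (sub_eq_zero.1 h2)))
    (by
      intro x x' y
      induction x using Submodule.Quotient.induction_on
      induction x' using Submodule.Quotient.induction_on
      induction y using Submodule.Quotient.induction_on
      exact LinearMap.map_add₂ (pairing δ n μ) _ _ _)
    (by
      intro c x y
      induction x using Submodule.Quotient.induction_on
      induction y using Submodule.Quotient.induction_on
      exact LinearMap.map_smul₂ (pairing δ n μ) _ _ _)
    (by
      intro x y y'
      induction x using Submodule.Quotient.induction_on
      induction y using Submodule.Quotient.induction_on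
      induction y' using Submodule.Quotient.induction_on
      exact map_add (pairing δ n μ _) _ _)
    (by
      intro c x y
      induction x using Submodule.Quotient.induction_on
      induction y using Submodule.Quotient.induction_on
      exact map_smul (pairing δ n μ _) _ _)

theorem cellForm_mk (x y : upperModule δ n μ) :
    cellForm δ n μ (Submodule.Quotient.mk x) (Submodule.Quotient.mk y) =
      pairing δ n μ x.1 y.1 := rfl

/-- The radical of the bilinear form of the cell module. -/
noncomputable def cellRadical : Submodule (bubbleAlgebra δ n) (CellModule δ n μ) where
  carrier := {y | ∀ x, cellForm δ n μ x y = 0}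
  zero_mem' x := map_zero _
  add_mem' {y z} hy hz x := by rw [map_add, hy, hz, add_zero]
  smul_mem' a y hy x := by
    induction x using Submodule.Quotient.induction_on with | _ x
    induction y using Submodule.Quotient.induction_on with | _ y
    exact (pairing_smul a x.1 y.1).trans
      (hy (Submodule.Quotient.mk ((⟨flipLin δ a.1, flipLin_mem a.2⟩ : bubbleAlgebra δ n) • x)))

/-- The head `L_n(μ)` of the cell module: the quotient by the intersection of the maximal submodules. -/
abbrev Head : Type :=
  CellModule δ n μ ⧸ Module.jacobson (bubbleAlgebra δ n) (CellModule δ n μ)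

end CellModules

/-- The radical series of a module: each term is the intersection of the maximal submodules of the
preceding one. -/
def radicalSeries (R M : Type) [Ring R] [AddCommGroup M] [Module R M] : ℕ → Submodule R M
  | 0 => ⊤
  | k + 1 =>
      (Module.jacobson R (radicalSeries R M k)).map (radicalSeries R M k).subtype

end Bubble

/-!
The two colours of a diagram do not see each other.  Once the colours of the top row are fixed, say with
`a₀` nodes of the first and `a₁` nodes of the second colour, a planar diagram of two colours is a pair of
planar diagrams of one colour (`Diagram.join`).  Hence the elements of a cell module are families of
matrices, one for each colouring, which are indexed by pairs of half-diagrams of one colour (`cellOf`).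
If `G₀` and `G₁` are the Gram matrices of the forms of the two colours, the radical consists of the
families with `G₀ z G₁ᵀ = 0` (`cellOf_mem_cellRadical`).

In one colour, that is, for the Temperley–Lieb algebras, the fact which is needed is
`exists_rightMatrix`: if `l ∣ k + t + 1` and `0 < t < l`, there is a combination `s` of planar diagrams
from `k + 2t` to `k` nodes such that right multiplication by `s` maps the cell modules with `k + 2t`
defects to those with `k` defects, the image is the radical of the form of the target and the kernel is
the radical of the form of the source.  As `s` one takes a vector in the radical on `k + 2t` nodes.
Everything then follows from a comparison of dimensions.  The dimension of the radical is at most the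
order of vanishing of the Gram determinant, as a polynomial in the loop value
(`finrank_ker_le_rootMultiplicity`).  A recursion for the Gram determinants (`det_gram_succ`), and the
fact that the zeros of the quantum integers are simple (`qOrder_eq`), show that the orders for `k` and
`k + 2t` add up to the number of half-diagrams with `k + 2t` defects (`gramOrder_eq`).  So both
inclusions are equalities.

Let `A` and `B` be the matrices of these homomorphisms for the two colours.  The maps `u ↦ A u`,
`v ↦ v Bᵀ` and `x ↦ A x Bᵀ` are homomorphisms to `Δ_n(λ)` from the cell modules of the weights
`(λ₀ + 2t₀, λ₁)`, `(λ₀, λ₁ + 2t₁)` and `λ + 2t`.  By linear algebra (`IsKerRange`), the sum of the first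
two images is the radical of the form, their intersection is the third image, the first two maps induce
embeddings of the quotients by the radicals of the forms into the quotient by the third image, and the
kernel of the third map is the radical of the form.  This diamond gives the exact sequence
(`exists_exact_of_diamond`), because for the three weights the radical of the form is the intersection
of the maximal submodules: an element outside the radical of the form generates the cell module
(`exists_smul_eq`), and the form is not zero for these weights (`gram_ne_zero`) unless the cell module is.

The radical has semisimple quotient by the third image, and this image is semisimple, so the Loewy length
is at most three.  It remains to see that the third image lies in every maximal submodule of the radical.
It is contained in the first image, and there is a colouring, with `λ₁` nodes of the second colour, whose
idempotent fixes a generator of the first module and annihilates the third one (`range_le_radStep`).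
-/

namespace Bubble

/-! ### Connected components of glued diagrams -/

section Components

variable {A B G G' : Type}

theorem eq_comap_of_retract {r : Setoid G} {s : Setoid G'} (p : G → G') (i : G' → G)
    (h1 : r ≤ s.comap p) (h2 : s ≤ r.comap i) (h3 : ∀ g, r g (i (p g))) : r = s.comap p := by
  refine le_antisymm h1 fun a b h => ?_
  exact r.trans (h3 a) (r.trans (h2 h) (r.symm (h3 b)))

/-- The number of classes of `r` which are contained in `M`. -/
noncomputable def classesIn (r : Setoid G) (M : Set G) : ℕ := {S ∈ r.classes | S ⊆ M}.ncard

theorem classesIn_comap {s : Setoid G'} {p : G → G'} (hp : p.Surjective) (M : Set G) :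
    classesIn (s.comap p) M = classesIn s {g' | ∀ g, p g = g' → g ∈ M} := by
  symm
  refine Set.ncard_congr (fun S _ => p ⁻¹' S) ?_ ?_ ?_
  · rintro _ ⟨⟨a, rfl⟩, hS⟩
    obtain ⟨a, rfl⟩ := hp a
    exact ⟨⟨a, rfl⟩, fun x hx => hS hx x rfl⟩
  · intro S T _ _ h
    exact hp.preimage_injective h
  · rintro _ ⟨⟨a, rfl⟩, hS⟩
    refine ⟨{x | s x (p a)}, ⟨⟨p a, rfl⟩, fun x hx g hg => ?_⟩, rfl⟩
    subst hg
    exact hS hx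

theorem classesIn_empty (r : Setoid G) : classesIn r ∅ = 0 := by
  unfold classesIn
  convert Set.ncard_empty (Set G)
  rw [Set.eq_empty_iff_forall_notMem]
  rintro _ ⟨⟨a, rfl⟩, h⟩
  exact h (r.refl a)

/-- The disjoint union of two equivalence relations. -/
def sumRel (r : Setoid A) (s : Setoid B) : Setoid (A ⊕ B) where
  r := Sum.LiftRel r s
  iseqv := by
    refine ⟨?_, ?_, ?_⟩
    · rintro (a | a)
      · exact .inl (r.refl a)
      · exact .inr (s.refl a)
    · rintro _ _ (⟨h⟩ | ⟨h⟩)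
      · exact .inl (r.symm h)
      · exact .inr (s.symm h)
    · rintro _ _ _ (⟨h⟩ | ⟨h⟩) (⟨h'⟩ | ⟨h'⟩)
      · exact .inl (r.trans h h')
      · exact .inr (s.trans h h')

theorem sumRel_iff {r : Setoid A} {s : Setoid B} {a b : A ⊕ B} :
    sumRel r s a b ↔ Sum.LiftRel r s a b := Iff.rfl

theorem sumRel_le {r : Setoid A} {s : Setoid B} {t : Setoid (A ⊕ B)} (h1 : r ≤ t.comap Sum.inl)
    (h2 : s ≤ t.comap Sum.inr) : sumRel r s ≤ t := by
  rintro _ _ (⟨h⟩ | ⟨h⟩)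
  · exact h1 h
  · exact h2 h

theorem sumRel_map {r : Setoid A} {s : Setoid B} {r' : Setoid G} {s' : Setoid G'} {f : A → G}
    {g : B → G'} (h1 : r ≤ r'.comap f) (h2 : s ≤ s'.comap g) {a b : A ⊕ B}
    (h : sumRel r s a b) : sumRel r' s' (Sum.map f g a) (Sum.map f g b) := by
  rcases h with ⟨h⟩ | ⟨h⟩
  · exact .inl (h1 h)
  · exact .inr (h2 h)

theorem classesIn_sumRel [Finite A] [Finite B] (r : Setoid A) (s : Setoid B) (M : Set (A ⊕ B)) :
    classesIn (sumRel r s) M = classesIn r (Sum.inl ⁻¹' M) + classesIn s (Sum.inr ⁻¹' M) := by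
  have e1 : ∀ a, {x | sumRel r s x (.inl a)} = Sum.inl '' {x | r x a} := by
    intro a; ext (x | x) <;> simp [sumRel_iff]
  have e2 : ∀ a, {x | sumRel r s x (.inr a)} = Sum.inr '' {x | s x a} := by
    intro a; ext (x | x) <;> simp [sumRel_iff]
  have key : {S ∈ (sumRel r s).classes | S ⊆ M} =
      (Set.image Sum.inl) '' {S ∈ r.classes | S ⊆ Sum.inl ⁻¹' M} ∪
      (Set.image Sum.inr) '' {S ∈ s.classes | S ⊆ Sum.inr ⁻¹' M} := by
    ext S
    constructor
    · rintro ⟨⟨a | a, rfl⟩, hS⟩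
      · exact Or.inl ⟨_, ⟨⟨a, rfl⟩, fun x hx => hS (Sum.LiftRel.inl hx)⟩, (e1 a).symm⟩
      · exact Or.inr ⟨_, ⟨⟨a, rfl⟩, fun x hx => hS (Sum.LiftRel.inr hx)⟩, (e2 a).symm⟩
    · rintro (⟨_, ⟨⟨a, rfl⟩, hS⟩, rfl⟩ | ⟨_, ⟨⟨a, rfl⟩, hS⟩, rfl⟩)
      · exact ⟨⟨.inl a, (e1 a).symm⟩, by rintro _ ⟨x, hx, rfl⟩; exact hS hx⟩
      · exact ⟨⟨.inr a, (e2 a).symm⟩, by rintro _ ⟨x, hx, rfl⟩; exact hS hx⟩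
  unfold classesIn
  rw [key, Set.ncard_union_eq _ (Set.toFinite _) (Set.toFinite _),
    Set.ncard_image_of_injective _ Sum.inl_injective.image_injective,
    Set.ncard_image_of_injective _ Sum.inr_injective.image_injective]
  rw [Set.disjoint_left]
  rintro _ ⟨_, ⟨⟨a, rfl⟩, -⟩, rfl⟩ ⟨_, -, h⟩
  have : (Sum.inl a : A ⊕ B) ∈ Sum.inl '' {x | r x a} := ⟨a, r.refl a, rfl⟩
  rw [← h] at this
  obtain ⟨x, -, hx⟩ := this
  cases hx

end Components

section Gluing

variable {X Y Z K : Type}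

theorem rel_upper (r : Setoid (X ⊕ Y)) (s : Setoid (Y ⊕ Z)) : r ≤ (glue r s).comap upper :=
  map_le_iff.1 le_sup_left

theorem rel_lower (r : Setoid (X ⊕ Y)) (s : Setoid (Y ⊕ Z)) : s ≤ (glue r s).comap lower :=
  map_le_iff.1 le_sup_right

theorem glue_le {r : Setoid (X ⊕ Y)} {s : Setoid (Y ⊕ Z)} {t : Setoid (X ⊕ (Y ⊕ Z))}
    (h1 : r ≤ t.comap upper) (h2 : s ≤ t.comap lower) : glue r s ≤ t :=
  sup_le (map_le_iff.2 h1) (map_le_iff.2 h2)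

theorem loops_eq (r : Setoid (X ⊕ Y)) (s : Setoid (Y ⊕ Z)) (c : Y → K) (i : K) :
    loops r s c i = classesIn (glue r s) (mid '' {y | c y = i}) := rfl

end Gluing

/-! ### Juxtaposition of one-coloured diagrams -/

section Join

variable {K A₀ A₁ B₀ B₁ C₀ C₁ X Y Z : Type}

/-- If the top row `X` is divided into `A₀` and `A₁`, and the bottom row `Y` into `B₀` and `B₁`,
then so is the set of all nodes. -/
def splitRows (eX : A₀ ⊕ A₁ ≃ X) (eY : B₀ ⊕ B₁ ≃ Y) : X ⊕ Y ≃ (A₀ ⊕ B₀) ⊕ (A₁ ⊕ B₁) :=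
  (Equiv.sumCongr eX.symm eY.symm).trans (Equiv.sumSumSumComm _ _ _ _)

/-- The corresponding division of the nodes in three rows. -/
def splitRows₃ (eX : A₀ ⊕ A₁ ≃ X) (eY : B₀ ⊕ B₁ ≃ Y) (eZ : C₀ ⊕ C₁ ≃ Z) :
    X ⊕ (Y ⊕ Z) ≃ (A₀ ⊕ (B₀ ⊕ C₀)) ⊕ (A₁ ⊕ (B₁ ⊕ C₁)) :=
  (Equiv.sumCongr eX.symm (splitRows eY eZ)).trans (Equiv.sumSumSumComm _ _ _ _)

variable (eX : A₀ ⊕ A₁ ≃ X) (eY : B₀ ⊕ B₁ ≃ Y) (eZ : C₀ ⊕ C₁ ≃ Z)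

@[simp] theorem splitRows_inl_inl (a : A₀) : splitRows eX eY (.inl (eX (.inl a))) = .inl (.inl a) := by
  simp [splitRows]
@[simp] theorem splitRows_inl_inr (a : A₁) : splitRows eX eY (.inl (eX (.inr a))) = .inr (.inl a) := by
  simp [splitRows]
@[simp] theorem splitRows_inr_inl (b : B₀) : splitRows eX eY (.inr (eY (.inl b))) = .inl (.inr b) := by
  simp [splitRows]
@[simp] theorem splitRows_inr_inr (b : B₁) : splitRows eX eY (.inr (eY (.inr b))) = .inr (.inr b) := by
  simp [splitRows]

/-- The diagram which consists of a diagram `d₀`, drawn in the colour `k₀`, and a diagram `d₁`, drawn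
in the colour `k₁`. -/
def Diagram.join (k₀ k₁ : K) (d₀ : Diagram Unit A₀ B₀) (d₁ : Diagram Unit A₁ B₁) :
    Diagram K X Y where
  colour := Sum.elim (fun _ => k₀) (fun _ => k₁) ∘ splitRows eX eY
  rel := (sumRel d₀.rel d₁.rel).comap (splitRows eX eY)
  colour_eq a b h := by
    have h' : sumRel d₀.rel d₁.rel (splitRows eX eY a) (splitRows eX eY b) := h
    simp only [Function.comp]
    revert h'
    generalize splitRows eX eY a = u
    generalize splitRows eX eY b = v
    rintro (⟨h⟩ | ⟨h⟩) <;> rfl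

theorem glue_join (r₀ : Setoid (A₀ ⊕ B₀)) (r₁ : Setoid (A₁ ⊕ B₁)) (s₀ : Setoid (B₀ ⊕ C₀))
    (s₁ : Setoid (B₁ ⊕ C₁)) :
    glue ((sumRel r₀ r₁).comap (splitRows eX eY)) ((sumRel s₀ s₁).comap (splitRows eY eZ)) =
      (sumRel (glue r₀ s₀) (glue r₁ s₁)).comap (splitRows₃ eX eY eZ) := by
  set g := glue ((sumRel r₀ r₁).comap (splitRows eX eY)) ((sumRel s₀ s₁).comap (splitRows eY eZ))
  have hu : (sumRel r₀ r₁).comap (splitRows eX eY) ≤ g.comap upper := rel_upper _ _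
  have hl : (sumRel s₀ s₁).comap (splitRows eY eZ) ≤ g.comap lower := rel_lower _ _
  have hu' : sumRel r₀ r₁ ≤ g.comap (upper ∘ (splitRows eX eY).symm) := fun a b h =>
    hu (by simpa [Setoid.comap_rel] using h)
  have hl' : sumRel s₀ s₁ ≤ g.comap (lower ∘ (splitRows eY eZ).symm) := fun a b h =>
    hl (by simpa [Setoid.comap_rel] using h)
  refine eq_comap_of_retract _ (splitRows₃ eX eY eZ).symm ?_ ?_ (fun x => by simp)
  · refine glue_le (fun a b h => ?_) (fun a b h => ?_)
    · have h' : sumRel r₀ r₁ (splitRows eX eY a) (splitRows eX eY b) := h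
      have e : ∀ a, splitRows₃ eX eY eZ (upper a) =
          Sum.map upper upper (splitRows eX eY a) := by
        rintro (a | a)
        · obtain ⟨a | a, rfl⟩ := eX.surjective a <;> simp [splitRows₃, upper]
        · obtain ⟨a | a, rfl⟩ := eY.surjective a <;> simp [splitRows₃, upper]
      change sumRel _ _ (splitRows₃ eX eY eZ (upper a)) (splitRows₃ eX eY eZ (upper b))
      rw [e, e]
      exact sumRel_map (rel_upper _ _) (rel_upper _ _) h'
    · have h' : sumRel s₀ s₁ (splitRows eY eZ a) (splitRows eY eZ b) := h
      have e : ∀ a, splitRows₃ eX eY eZ (lower a) =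
          Sum.map lower lower (splitRows eY eZ a) := by
        rintro (a | a)
        · obtain ⟨a | a, rfl⟩ := eY.surjective a <;> simp [splitRows₃, lower]
        · obtain ⟨a | a, rfl⟩ := eZ.surjective a <;> simp [splitRows₃, lower]
      change sumRel _ _ (splitRows₃ eX eY eZ (lower a)) (splitRows₃ eX eY eZ (lower b))
      rw [e, e]
      exact sumRel_map (rel_lower _ _) (rel_lower _ _) h'
  · refine sumRel_le (glue_le ?_ ?_) (glue_le ?_ ?_)
    · intro a b h
      have := hu' (Sum.LiftRel.inl h : sumRel r₀ r₁ (.inl a) (.inl b))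
      rcases a with a | a <;> rcases b with b | b <;> exact this
    · intro a b h
      have := hl' (Sum.LiftRel.inl h : sumRel s₀ s₁ (.inl a) (.inl b))
      rcases a with a | a <;> rcases b with b | b <;> exact this
    · intro a b h
      have := hu' (Sum.LiftRel.inr h : sumRel r₀ r₁ (.inr a) (.inr b))
      rcases a with a | a <;> rcases b with b | b <;> exact this
    · intro a b h
      have := hl' (Sum.LiftRel.inr h : sumRel s₀ s₁ (.inr a) (.inr b))
      rcases a with a | a <;> rcases b with b | b <;> exact this

variable (k₀ k₁ : K)

namespace Diagram

theorem join_match (d₀ : Diagram Unit A₀ B₀) (d₁ : Diagram Unit A₁ B₁) (e₀ : Diagram Unit B₀ C₀)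
    (e₁ : Diagram Unit B₁ C₁) : (join eX eY k₀ k₁ d₀ d₁).Match (join eY eZ k₀ k₁ e₀ e₁) := by
  intro y
  obtain ⟨y | y, rfl⟩ := eY.surjective y <;> simp [join]

theorem ext_rel {d e : Diagram Unit X Y} (h : ∀ a b, d.rel a b ↔ e.rel a b) : d = e :=
  Diagram.ext (funext fun _ => rfl) (Setoid.ext h)

theorem match_unit (d : Diagram Unit X Y) (e : Diagram Unit Y Z) : d.Match e := fun _ => rfl

theorem join_comp (d₀ : Diagram Unit A₀ B₀) (d₁ : Diagram Unit A₁ B₁) (e₀ : Diagram Unit B₀ C₀)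
    (e₁ : Diagram Unit B₁ C₁) (h : (join eX eY k₀ k₁ d₀ d₁).Match (join eY eZ k₀ k₁ e₀ e₁)) :
    (join eX eY k₀ k₁ d₀ d₁).comp (join eY eZ k₀ k₁ e₀ e₁) h =
      join eX eZ k₀ k₁ (d₀.comp e₀ (match_unit _ _)) (d₁.comp e₁ (match_unit _ _)) := by
  have e : ∀ a, splitRows₃ eX eY eZ (outer a) = Sum.map outer outer (splitRows eX eZ a) := by
    rintro (a | a)
    · obtain ⟨a | a, rfl⟩ := eX.surjective a <;> simp [splitRows₃, outer]
    · obtain ⟨a | a, rfl⟩ := eZ.surjective a <;> simp [splitRows₃, outer]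
  ext a b
  · rcases a with a | a
    · obtain ⟨a | a, rfl⟩ := eX.surjective a <;> simp [comp, join]
    · obtain ⟨a | a, rfl⟩ := eZ.surjective a <;> simp [comp, join]
  · change ((glue _ _).comap outer) a b ↔ _
    rw [show glue (join eX eY k₀ k₁ d₀ d₁).rel (join eY eZ k₀ k₁ e₀ e₁).rel =
      (sumRel (glue d₀.rel e₀.rel) (glue d₁.rel e₁.rel)).comap (splitRows₃ eX eY eZ) from
      glue_join eX eY eZ _ _ _ _]
    change sumRel _ _ (splitRows₃ eX eY eZ (outer a)) (splitRows₃ eX eY eZ (outer b)) ↔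
      sumRel _ _ (splitRows eX eZ a) (splitRows eX eZ b)
    rw [e, e]
    rcases splitRows eX eZ a with a | a <;> rcases splitRows eX eZ b with b | b <;>
      simp only [sumRel_iff, Sum.map_inl, Sum.map_inr, Sum.liftRel_inl_inl, Sum.liftRel_inr_inr,
        Sum.not_liftRel_inl_inr, Sum.not_liftRel_inr_inl] <;> rfl

theorem join_flip (d₀ : Diagram Unit A₀ B₀) (d₁ : Diagram Unit A₁ B₁) :
    (join eX eY k₀ k₁ d₀ d₁).flip = join eY eX k₀ k₁ d₀.flip d₁.flip := by
  have e : ∀ a, splitRows eX eY (Sum.swap a) = Sum.map Sum.swap Sum.swap (splitRows eY eX a) := by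
    rintro (a | a)
    · obtain ⟨a | a, rfl⟩ := eY.surjective a <;> simp
    · obtain ⟨a | a, rfl⟩ := eX.surjective a <;> simp
  ext a b
  · simp only [flip, join, Function.comp, e]
    rcases splitRows eY eX a with a | a <;> rfl
  · change sumRel _ _ (splitRows eX eY a.swap) (splitRows eX eY b.swap) ↔
      sumRel _ _ (splitRows eY eX a) (splitRows eY eX b)
    rw [e, e]
    rcases splitRows eY eX a with a | a <;> rcases splitRows eY eX b with b | b <;>
      simp only [sumRel_iff, Sum.map_inl, Sum.map_inr, Sum.liftRel_inl_inl, Sum.liftRel_inr_inr,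
        Sum.not_liftRel_inl_inr, Sum.not_liftRel_inr_inl] <;> rfl

theorem join_inj {d₀ d₀' : Diagram Unit A₀ B₀} {d₁ d₁' : Diagram Unit A₁ B₁}
    (h : join eX eY k₀ k₁ d₀ d₁ = join eX eY k₀ k₁ d₀' d₁') : d₀ = d₀' ∧ d₁ = d₁' := by
  have hr : ∀ u v, sumRel d₀.rel d₁.rel u v ↔ sumRel d₀'.rel d₁'.rel u v := by
    intro u v
    have := congrArg (fun d => d.rel ((splitRows eX eY).symm u) ((splitRows eX eY).symm v)) h
    have h' : sumRel d₀.rel d₁.rel (splitRows eX eY ((splitRows eX eY).symm u))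
        (splitRows eX eY ((splitRows eX eY).symm v)) ↔ sumRel d₀'.rel d₁'.rel
        (splitRows eX eY ((splitRows eX eY).symm u))
        (splitRows eX eY ((splitRows eX eY).symm v)) := iff_of_eq this
    simpa only [Equiv.apply_symm_apply] using h'
  constructor
  · refine ext_rel fun a b => ?_
    simpa [sumRel_iff] using hr (.inl a) (.inl b)
  · refine ext_rel fun a b => ?_
    simpa [sumRel_iff] using hr (.inr a) (.inr b)

theorem join_id : join eX eX k₀ k₁ (idDiagram fun _ => ()) (idDiagram fun _ => ()) =
    idDiagram (Sum.elim (fun _ => k₀) (fun _ => k₁) ∘ eX.symm) := by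
  ext a b
  · rcases a with a | a <;> obtain ⟨a | a, rfl⟩ := eX.surjective a <;> simp [join, idDiagram]
  · change sumRel (idRel A₀) (idRel A₁) (splitRows eX eX a) (splitRows eX eX b) ↔
      Sum.elim id id a = Sum.elim id id b
    rcases a with a | a <;> obtain ⟨a | a, rfl⟩ := eX.surjective a <;>
    rcases b with b | b <;> obtain ⟨b | b, rfl⟩ := eX.surjective b <;>
    simp [sumRel_iff, Setoid.ker_def]

end Diagram

open Classical in
theorem loops_join [Finite A₀] [Finite A₁] [Finite B₀] [Finite B₁] [Finite C₀] [Finite C₁]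
    (d₀ : Diagram Unit A₀ B₀) (d₁ : Diagram Unit A₁ B₁)
    (e₀ : Diagram Unit B₀ C₀) (e₁ : Diagram Unit B₁ C₁) (i : K) :
    loops (Diagram.join eX eY k₀ k₁ d₀ d₁).rel (Diagram.join eY eZ k₀ k₁ e₀ e₁).rel
      (fun y => (Diagram.join eX eY k₀ k₁ d₀ d₁).colour (.inr y)) i =
    (if k₀ = i then loops d₀.rel e₀.rel (fun y => d₀.colour (.inr y)) () else 0) +
      (if k₁ = i then loops d₁.rel e₁.rel (fun y => d₁.colour (.inr y)) () else 0) := by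
  rw [loops_eq, show glue (Diagram.join eX eY k₀ k₁ d₀ d₁).rel (Diagram.join eY eZ k₀ k₁ e₀ e₁).rel =
      (sumRel (glue d₀.rel e₀.rel) (glue d₁.rel e₁.rel)).comap (splitRows₃ eX eY eZ) from
      glue_join eX eY eZ _ _ _ _, classesIn_comap (splitRows₃ eX eY eZ).surjective,
      classesIn_sumRel]
  set M : Set (X ⊕ (Y ⊕ Z)) :=
    mid '' {y | (Diagram.join eX eY k₀ k₁ d₀ d₁).colour (.inr y) = i} with hM
  have hE : {g' | ∀ g, splitRows₃ eX eY eZ g = g' → g ∈ M} =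
      (splitRows₃ eX eY eZ).symm ⁻¹' M := by
    ext g'
    refine ⟨fun h => h _ (by simp), ?_⟩
    rintro h g rfl
    simpa using h
  have m1 : ∀ x, Sum.inl x ∉ M := by rintro x ⟨y, -, hy⟩; cases hy
  have m2 : ∀ y, Sum.inr (Sum.inl y) ∈ M ↔
      (Diagram.join eX eY k₀ k₁ d₀ d₁).colour (.inr y) = i := by
    intro y
    constructor
    · rintro ⟨y', h, hy⟩
      cases hy
      exact h
    · exact fun h => ⟨y, h, rfl⟩
  have m3 : ∀ z, Sum.inr (Sum.inr z) ∉ M := by rintro x ⟨y, -, hy⟩; cases hy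
  have c0 : ∀ b, (Diagram.join eX eY k₀ k₁ d₀ d₁).colour (.inr (eY (.inl b))) = k₀ := by
    intro b; simp [Diagram.join]
  have c1 : ∀ b, (Diagram.join eX eY k₀ k₁ d₀ d₁).colour (.inr (eY (.inr b))) = k₁ := by
    intro b; simp [Diagram.join]
  rw [hE]
  congr 1
  · have e : (Sum.inl ⁻¹' ((splitRows₃ eX eY eZ).symm ⁻¹' M) : Set (A₀ ⊕ (B₀ ⊕ C₀))) =
        mid '' {y | k₀ = i} := by
      ext (a | b | c)
      · exact iff_of_false (m1 _) (by simp [mid])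
      · exact (m2 (eY (.inl b))).trans (by rw [c0]; simp [mid])
      · exact iff_of_false (m3 _) (by simp [mid])
    rw [e]
    split_ifs with h
    · simp [loops_eq, h]
    · simpa [h] using classesIn_empty _
  · have e : (Sum.inr ⁻¹' ((splitRows₃ eX eY eZ).symm ⁻¹' M) : Set (A₁ ⊕ (B₁ ⊕ C₁))) =
        mid '' {y | k₁ = i} := by
      ext (a | b | c)
      · exact iff_of_false (m1 _) (by simp [mid])
      · exact (m2 (eY (.inr b))).trans (by rw [c1]; simp [mid])
      · exact iff_of_false (m3 _) (by simp [mid])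
    rw [e]
    split_ifs with h
    · simp [loops_eq, h]
    · simpa [h] using classesIn_empty _

/-! ### The bilinear extension of juxtaposition -/

/-- The bilinear extension of `Diagram.join`. -/
noncomputable def joinLin (δ : K → ℂ) (δ₀ δ₁ : Unit → ℂ) :
    DiagramSpace δ₀ A₀ B₀ →ₗ[ℂ] DiagramSpace δ₁ A₁ B₁ →ₗ[ℂ] DiagramSpace δ X Y :=
  Finsupp.linearCombination ℂ (fun d : Diagram Unit A₀ B₀ =>
    (Finsupp.linearCombination ℂ (fun e : Diagram Unit A₁ B₁ =>
      single δ (Diagram.join eX eY k₀ k₁ d e)) : DiagramSpace δ₁ A₁ B₁ →ₗ[ℂ] DiagramSpace δ X Y))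

variable {δ : K → ℂ} {δ₀ δ₁ : Unit → ℂ}

theorem joinLin_single (d : Diagram Unit A₀ B₀) (e : Diagram Unit A₁ B₁) :
    joinLin eX eY k₀ k₁ δ δ₀ δ₁ (single δ₀ d) (single δ₁ e) =
      single δ (Diagram.join eX eY k₀ k₁ d e) := by
  unfold joinLin single
  erw [Finsupp.linearCombination_single, one_smul, Finsupp.linearCombination_single, one_smul]

theorem flipLin_joinLin (a : DiagramSpace δ₀ A₀ B₀) (b : DiagramSpace δ₁ A₁ B₁) :
    flipLin δ (joinLin eX eY k₀ k₁ δ δ₀ δ₁ a b) =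
      joinLin eY eX k₀ k₁ δ δ₀ δ₁ (flipLin δ₀ a) (flipLin δ₁ b) := by
  induction a using space_induction with
  | h0 => simp
  | hadd a a' ha ha' => simp [ha, ha']
  | hs x d =>
  induction b using space_induction with
  | h0 => simp
  | hadd b b' hb hb' => simp only [map_add, hb, hb']
  | hs y e =>
  simp only [map_smul, LinearMap.smul_apply, joinLin_single, flipLin_single, Diagram.join_flip]

open Classical in
/-- Juxtaposition is compatible with products. -/
theorem mulLin_joinLin [Fintype K] [Finite A₀] [Finite A₁] [Finite B₀] [Finite B₁] [Finite C₀]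
    [Finite C₁] (h₀ : δ k₀ = δ₀ ()) (h₁ : δ k₁ = δ₁ ())
    (a : DiagramSpace δ₀ A₀ B₀) (b : DiagramSpace δ₁ A₁ B₁)
    (a' : DiagramSpace δ₀ B₀ C₀) (b' : DiagramSpace δ₁ B₁ C₁) :
    mulLin δ (joinLin eX eY k₀ k₁ δ δ₀ δ₁ a b) (joinLin eY eZ k₀ k₁ δ δ₀ δ₁ a' b') =
      joinLin eX eZ k₀ k₁ δ δ₀ δ₁ (mulLin δ₀ a a') (mulLin δ₁ b b') := by
  induction a using space_induction with
  | h0 => simp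
  | hadd _ _ h h' => simp [h, h']
  | hs x d =>
  induction b using space_induction with
  | h0 => simp
  | hadd _ _ h h' => simp only [map_add, LinearMap.add_apply, h, h']
  | hs y e =>
  induction a' using space_induction with
  | h0 => simp
  | hadd _ _ h h' => simp only [map_add, LinearMap.add_apply, h, h']
  | hs x' d' =>
  induction b' using space_induction with
  | h0 => simp
  | hadd _ _ h h' => simp only [map_add, h, h']
  | hs y' e' =>
  have hm := Diagram.join_match eX eY eZ k₀ k₁ d e d' e'
  have key : mulDiagram δ (Diagram.join eX eY k₀ k₁ d e) (Diagram.join eY eZ k₀ k₁ d' e') =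
      joinLin eX eZ k₀ k₁ δ δ₀ δ₁ (mulDiagram δ₀ d d') (mulDiagram δ₁ e e') := by
    unfold mulDiagram
    rw [dif_pos hm, dif_pos (Diagram.match_unit d d'), dif_pos (Diagram.match_unit e e')]
    simp only [map_smul, LinearMap.smul_apply, joinLin_single, Diagram.join_comp, smul_smul]
    congr 1
    simp only [loops_join, pow_add, Finset.prod_mul_distrib, pow_ite, pow_zero,
      Finset.prod_ite_eq, Finset.mem_univ, if_true, h₀, h₁, Finset.univ_unique,
      Finset.prod_singleton]
    exact mul_comm _ _
  simp only [map_smul, LinearMap.smul_apply, joinLin_single, mulLin_single, key]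
  module

end Join

/-! ### Adding a strand and bending a strand -/

section Strand

/-- One-coloured diagrams with `a` nodes on the top and `b` nodes on the bottom. -/
abbrev TLDiagram (a b : ℕ) : Type := Diagram Unit (Fin a) (Fin b)

/-- The space of one-coloured diagrams, where a closed loop has the value `c`. -/
abbrev TL (c : ℂ) (a b : ℕ) : Type := DiagramSpace (fun _ : Unit => c) (Fin a) (Fin b)

variable {a b m : ℕ}

/-- The nodes of a diagram as nodes of the diagram with one more strand on the right. -/
def embed : Fin a ⊕ Fin b → Fin (a + 1) ⊕ Fin (b + 1) := Sum.map Fin.castSucc Fin.castSucc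

theorem embed_cases (g : Fin (a + 1) ⊕ Fin (b + 1)) :
    (∃ u, g = embed u) ∨ g = .inl (Fin.last a) ∨ g = .inr (Fin.last b) := by
  rcases g with i | i <;> induction i using Fin.lastCases with
  | last => simp
  | cast i => first | exact Or.inl ⟨.inl i, rfl⟩ | exact Or.inl ⟨.inr i, rfl⟩

/-- The identity diagram on `a` nodes. -/
def idTL (a : ℕ) : TLDiagram a a := Diagram.idDiagram fun _ => ()

/-- The diagram `d` with a vertical strand added on the right. -/
def TLDiagram.strand (d : TLDiagram a b) : TLDiagram (a + 1) (b + 1) :=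
  Diagram.join (finSumFinEquiv (m := a) (n := 1)) (finSumFinEquiv (m := b) (n := 1)) () () d (idTL 1)

theorem splitRows_embed (u : Fin a ⊕ Fin b) :
    splitRows (finSumFinEquiv (m := a) (n := 1)) (finSumFinEquiv (m := b) (n := 1)) (embed u) =
      .inl u := by
  rcases u with i | i
  · exact splitRows_inl_inl _ _ i
  · exact splitRows_inr_inl _ _ i

theorem splitRows_inl_last : splitRows (finSumFinEquiv (m := a) (n := 1))
    (finSumFinEquiv (m := b) (n := 1)) (.inl (Fin.last a)) = .inr (.inl 0) :=
  splitRows_inl_inr _ _ 0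

theorem splitRows_inr_last : splitRows (finSumFinEquiv (m := a) (n := 1))
    (finSumFinEquiv (m := b) (n := 1)) (.inr (Fin.last b)) = .inr (.inr 0) :=
  splitRows_inr_inr _ _ 0

namespace TLDiagram

theorem strand_rel (d : TLDiagram a b) (u v) : d.strand.rel u v ↔
    sumRel d.rel (idTL 1).rel
      (splitRows (finSumFinEquiv (m := a) (n := 1)) (finSumFinEquiv (m := b) (n := 1)) u)
      (splitRows (finSumFinEquiv (m := a) (n := 1)) (finSumFinEquiv (m := b) (n := 1)) v) := Iff.rfl

@[simp] theorem strand_rel_embed (d : TLDiagram a b) (u v) :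
    d.strand.rel (embed u) (embed v) ↔ d.rel u v := by
  rw [strand_rel, splitRows_embed, splitRows_embed]
  exact Sum.liftRel_inl_inl

theorem strand_rel_last (d : TLDiagram a b) :
    d.strand.rel (.inl (Fin.last a)) (.inr (Fin.last b)) := by
  rw [strand_rel, splitRows_inl_last, splitRows_inr_last]
  exact Sum.LiftRel.inr rfl

theorem not_strand_rel_inl_last (d : TLDiagram a b) (u) :
    ¬ d.strand.rel (embed u) (.inl (Fin.last a)) := by
  rw [strand_rel, splitRows_embed, splitRows_inl_last]
  exact Sum.not_liftRel_inl_inr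

theorem not_strand_rel_inr_last (d : TLDiagram a b) (u) :
    ¬ d.strand.rel (embed u) (.inr (Fin.last b)) := by
  rw [strand_rel, splitRows_embed, splitRows_inr_last]
  exact Sum.not_liftRel_inl_inr

end TLDiagram

/-- The last node of the top row becomes the last node of the bottom row: this is a bijection of the
nodes which preserves their order on the boundary. -/
def bendNodes (a b : ℕ) : Fin (a + 1) ⊕ Fin b ≃ Fin a ⊕ Fin (b + 1) where
  toFun := Sum.elim (Fin.lastCases (motive := fun _ => Fin a ⊕ Fin (b + 1)) (.inr (Fin.last b)) .inl)
    (fun j => .inr j.castSucc)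
  invFun := Sum.elim (fun i => .inl i.castSucc)
    (Fin.lastCases (motive := fun _ => Fin (a + 1) ⊕ Fin b) (.inl (Fin.last a)) .inr)
  left_inv := by
    rintro (i | i)
    · induction i using Fin.lastCases <;> simp
    · simp
  right_inv := by
    rintro (i | i)
    · simp
    · induction i using Fin.lastCases <;> simp

@[simp] theorem bendNodes_inl (i : Fin a) : bendNodes a b (.inl i.castSucc) = .inl i := by
  simp [bendNodes]
@[simp] theorem bendNodes_last : bendNodes a b (.inl (Fin.last a)) = .inr (Fin.last b) := by
  simp [bendNodes]
@[simp] theorem bendNodes_inr (i : Fin b) : bendNodes a b (.inr i) = .inr i.castSucc := by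
  simp [bendNodes]
@[simp] theorem bendNodes_symm_inl (i : Fin a) :
    (bendNodes a b).symm (.inl i) = .inl i.castSucc := by simp [bendNodes]
@[simp] theorem bendNodes_symm_last :
    (bendNodes a b).symm (.inr (Fin.last b)) = .inl (Fin.last a) := by simp [bendNodes]
@[simp] theorem bendNodes_symm_inr (i : Fin b) :
    (bendNodes a b).symm (.inr i.castSucc) = .inr i := by simp [bendNodes]

/-- Moving the last node of the bottom row to the end of the top row. -/
def bendDiagram (a b : ℕ) : TLDiagram a (b + 1) ≃ TLDiagram (a + 1) b where
  toFun d := ⟨fun _ => (), d.rel.comap (bendNodes a b), fun _ _ _ => rfl⟩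
  invFun d := ⟨fun _ => (), d.rel.comap (bendNodes a b).symm, fun _ _ _ => rfl⟩
  left_inv d := Diagram.ext_rel fun u v => by simp [Setoid.comap_rel]
  right_inv d := Diagram.ext_rel fun u v => by simp [Setoid.comap_rel]

theorem bendDiagram_rel (d : TLDiagram a (b + 1)) (u v) :
    (bendDiagram a b d).rel u v ↔ d.rel (bendNodes a b u) (bendNodes a b v) := Iff.rfl

theorem bendDiagram_symm_rel (d : TLDiagram (a + 1) b) (u v) :
    ((bendDiagram a b).symm d).rel u v ↔
      d.rel ((bendNodes a b).symm u) ((bendNodes a b).symm v) := Iff.rfl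

theorem flip_bendDiagram (d : TLDiagram a (b + 1)) :
    (bendDiagram a b d).flip = (bendDiagram b a).symm d.flip := by
  refine Diagram.ext_rel fun u v => ?_
  change d.rel (bendNodes a b u.swap) (bendNodes a b v.swap) ↔
    d.rel ((bendNodes b a).symm u).swap ((bendNodes b a).symm v).swap
  have e : ∀ u, bendNodes a b u.swap = ((bendNodes b a).symm u).swap := by
    rintro (i | i)
    · simp
    · induction i using Fin.lastCases <;> simp
  rw [e, e]

/-- The nodes of the picture of a product, after bending: see `glue_bend`. -/
def bendNodes₃ (a b m : ℕ) :
    Fin (a + 1) ⊕ (Fin (b + 1) ⊕ Fin m) → Fin a ⊕ (Fin b ⊕ Fin (m + 1)) :=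
  Sum.elim (Fin.lastCases (motive := fun _ => Fin a ⊕ (Fin b ⊕ Fin (m + 1)))
      (.inr (.inr (Fin.last m))) .inl)
    (Sum.elim (Fin.lastCases (motive := fun _ => Fin a ⊕ (Fin b ⊕ Fin (m + 1)))
      (.inr (.inr (Fin.last m))) (fun j => .inr (.inl j)))
      (fun j => .inr (.inr j.castSucc)))

/-- A section of `bendNodes₃`. -/
def bendSection (a b m : ℕ) :
    Fin a ⊕ (Fin b ⊕ Fin (m + 1)) → Fin (a + 1) ⊕ (Fin (b + 1) ⊕ Fin m) :=
  Sum.elim (fun i => .inl i.castSucc) (Sum.elim (fun j => .inr (.inl j.castSucc))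
    (Fin.lastCases (motive := fun _ => Fin (a + 1) ⊕ (Fin (b + 1) ⊕ Fin m))
      (.inl (Fin.last a)) (fun j => .inr (.inr j))))

theorem bendNodes₃_section (g) : bendNodes₃ a b m (bendSection a b m g) = g := by
  rcases g with i | i | i
  · simp [bendNodes₃, bendSection]
  · simp [bendNodes₃, bendSection]
  · induction i using Fin.lastCases <;> simp [bendNodes₃, bendSection]

theorem glue_bend (d : TLDiagram a b) (x : TLDiagram b (m + 1)) :
    glue d.strand.rel (bendDiagram b m x).rel =
      (glue d.rel x.rel).comap (bendNodes₃ a b m) := by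
  set g := glue d.strand.rel (bendDiagram b m x).rel
  have hu : d.strand.rel ≤ g.comap upper := rel_upper _ _
  have hl : (bendDiagram b m x).rel ≤ g.comap lower := rel_lower _ _
  have hlast : g (.inl (Fin.last a)) (.inr (.inl (Fin.last b))) := hu d.strand_rel_last
  refine eq_comap_of_retract _ (bendSection a b m) ?_ ?_ ?_
  · refine glue_le (fun u v h => ?_) (fun u v h => ?_)
    · change glue d.rel x.rel (bendNodes₃ a b m (upper u)) (bendNodes₃ a b m (upper v))
      have e : ∀ u, bendNodes₃ a b m (upper (embed u)) = upper u := by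
        rintro (i | i) <;> simp [bendNodes₃, upper, embed]
      rcases embed_cases u with ⟨u, rfl⟩ | rfl | rfl <;>
        rcases embed_cases v with ⟨v, rfl⟩ | rfl | rfl
      · rw [e, e]
        exact rel_upper _ _ ((d.strand_rel_embed _ _).1 h)
      · exact (d.not_strand_rel_inl_last _ h).elim
      · exact (d.not_strand_rel_inr_last _ h).elim
      · exact (d.not_strand_rel_inl_last _ (Setoid.symm' _ h)).elim
      · exact Setoid.refl' _ _
      · simp [bendNodes₃, upper]
      · exact (d.not_strand_rel_inr_last _ (Setoid.symm' _ h)).elim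
      · simp [bendNodes₃, upper]
      · exact Setoid.refl' _ _
    · have e : ∀ u, bendNodes₃ a b m (lower u) = lower (bendNodes b m u) := by
        rintro (i | i)
        · induction i using Fin.lastCases <;> simp [bendNodes₃, lower]
        · simp [bendNodes₃, lower]
      change glue d.rel x.rel (bendNodes₃ a b m (lower u)) (bendNodes₃ a b m (lower v))
      rw [e, e]
      exact rel_lower _ _ h
  · refine glue_le (fun u v h => ?_) (fun u v h => ?_)
    · have e : ∀ u, bendSection a b m (upper u) = upper (embed u) := by
        rintro (i | i) <;> simp [bendSection, upper, embed]
      change g (bendSection a b m (upper u)) (bendSection a b m (upper v))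
      rw [e, e]
      exact hu ((d.strand_rel_embed _ _).2 h)
    · have e : ∀ u, g (bendSection a b m (lower u)) (lower ((bendNodes b m).symm u)) := by
        rintro (i | i)
        · simp [bendSection, lower]
        · induction i using Fin.lastCases with
          | last => simpa [bendSection, lower] using hlast
          | cast i => simp [bendSection, lower]
      change g (bendSection a b m (lower u)) (bendSection a b m (lower v))
      refine Setoid.trans' g (e u) (Setoid.trans' g (hl ?_) (Setoid.symm' g (e v)))
      simpa [bendDiagram_rel] using h
  · rintro (i | i | i)
    · induction i using Fin.lastCases <;>
        simp [bendSection, bendNodes₃]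
    · induction i using Fin.lastCases with
      | last => simpa [bendSection, bendNodes₃] using Setoid.symm' _ hlast
      | cast i => simp [bendSection, bendNodes₃]
    · simp [bendSection, bendNodes₃]

theorem bend_comp (d : TLDiagram a b) (x : TLDiagram b (m + 1)) :
    d.strand.comp (bendDiagram b m x) (Diagram.match_unit _ _) =
      bendDiagram a m (d.comp x (Diagram.match_unit _ _)) := by
  refine Diagram.ext_rel fun u v => ?_
  change (glue d.strand.rel (bendDiagram b m x).rel) (outer u) (outer v) ↔
    glue d.rel x.rel (outer (bendNodes a m u)) (outer (bendNodes a m v))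
  rw [glue_bend, Setoid.comap_rel]
  have e : ∀ u, bendNodes₃ a b m (outer u) = outer (bendNodes a m u) := by
    rintro (i | i)
    · induction i using Fin.lastCases <;> simp [bendNodes₃, outer]
    · simp [bendNodes₃, outer]
  rw [e, e]

theorem loops_bend (d : TLDiagram a b) (x : TLDiagram b (m + 1)) (i : Unit) :
    loops d.strand.rel (bendDiagram b m x).rel (fun y => d.strand.colour (.inr y)) i =
      loops d.rel x.rel (fun y => d.colour (.inr y)) i := by
  rw [loops_eq, loops_eq, glue_bend,
    classesIn_comap fun g => ⟨bendSection a b m g, bendNodes₃_section g⟩]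
  congr 1
  ext (j | j | j)
  · refine iff_of_false (fun h => ?_) (by simp [mid])
    have := h (.inl j.castSucc) (by simp [bendNodes₃])
    simp [mid] at this
  · refine iff_of_true ?_ ⟨j, rfl, rfl⟩
    rintro (k | k | k) hk
    · induction k using Fin.lastCases <;> simp [bendNodes₃] at hk
    · exact ⟨k, rfl, rfl⟩
    · simp [bendNodes₃] at hk
  · refine iff_of_false (fun h => ?_) (by simp [mid])
    have := h (bendSection a b m (.inr (.inr j))) (bendNodes₃_section _)
    induction j using Fin.lastCases <;> simp [mid, bendSection] at this

/-- The diagram with `a` strands and an arc which joins the last two nodes of the top row. -/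
def cupDiagram (a : ℕ) : TLDiagram (a + 2) a := bendDiagram (a + 1) a (idTL (a + 1))

/-- In the picture of the product of the reflection of `cupDiagram a` with `cupDiagram a`, all nodes
over and under the same strand are identified; the last point is the closed loop. -/
def cupNodes (a : ℕ) : Fin a ⊕ (Fin (a + 2) ⊕ Fin a) → Fin (a + 1) :=
  Sum.elim Fin.castSucc (Sum.elim (Fin.lastCases (motive := fun _ => Fin (a + 1)) (Fin.last a) id)
    Fin.castSucc)

theorem cupDiagram_rel (u v) : (cupDiagram a).rel u v ↔
    cupNodes a (lower u) = cupNodes a (lower v) := by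
  have e : ∀ u, cupNodes a (lower u) = Sum.elim id id (bendNodes (a + 1) a u) := by
    rintro (i | i)
    · induction i using Fin.lastCases <;> simp [cupNodes, lower]
    · simp [cupNodes, lower]
  rw [e, e]
  rfl

theorem glue_cup : glue (cupDiagram a).flip.rel (cupDiagram a).rel =
    (⊥ : Setoid (Fin (a + 1))).comap (cupNodes a) := by
  set g := glue (cupDiagram a).flip.rel (cupDiagram a).rel
  have hu : (cupDiagram a).flip.rel ≤ g.comap upper := rel_upper _ _
  have hl : (cupDiagram a).rel ≤ g.comap lower := rel_lower _ _
  have hu' : ∀ u, cupNodes a (upper u) = cupNodes a (lower u.swap) := by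
    rintro (i | i) <;> simp [cupNodes, upper, lower]
  refine eq_comap_of_retract _ (fun i => .inr (.inl i.castSucc)) ?_ ?_ ?_
  · refine glue_le (fun u v h => ?_) (fun u v h => ?_)
    · change cupNodes a (upper u) = cupNodes a (upper v)
      rw [hu', hu']
      exact (cupDiagram_rel _ _).1 h
    · exact (cupDiagram_rel _ _).1 h
  · rintro i j (rfl : i = j)
    exact Setoid.refl' _ _
  · rintro (i | i | i)
    · refine @hu (.inl i) (.inr i.castSucc.castSucc) ((cupDiagram_rel _ _).2 ?_)
      simp [cupNodes, lower]
    · refine @hl (.inl i) (.inl (Fin.castSucc _)) ((cupDiagram_rel _ _).2 ?_)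
      simp [cupNodes, lower]
    · refine @hl (.inr i) (.inl (Fin.castSucc _)) ((cupDiagram_rel _ _).2 ?_)
      simp [cupNodes, lower]

theorem cup_comp : (cupDiagram a).flip.comp (cupDiagram a) (Diagram.match_unit _ _) = idTL a := by
  refine Diagram.ext_rel fun u v => ?_
  change (glue (cupDiagram a).flip.rel (cupDiagram a).rel) (outer u) (outer v) ↔ _
  rw [glue_cup]
  change cupNodes a (outer u) = cupNodes a (outer v) ↔ Sum.elim id id u = Sum.elim id id v
  rcases u with u | u <;> rcases v with v | v <;> simp [cupNodes, outer]

theorem loops_cup (f : Fin (a + 2) → Unit) (i : Unit) :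
    loops (cupDiagram a).flip.rel (cupDiagram a).rel f i = 1 := by
  have hs : Function.Surjective (cupNodes a) := fun i =>
    ⟨.inr (.inl i.castSucc), by simp [cupNodes]⟩
  rw [loops_eq, glue_cup, classesIn_comap hs, classesIn]
  have e : {g' | ∀ g, cupNodes a g = g' → g ∈ mid '' {y | f y = i}} = {Fin.last a} := by
    ext j
    constructor
    · intro h
      induction j using Fin.lastCases with
      | last => rfl
      | cast j =>
        have := h (.inl j) (by simp [cupNodes])
        simp [mid] at this
    · rintro rfl (k | k | k) hk
      · simp [cupNodes] at hk
      · exact ⟨k, rfl, rfl⟩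
      · simp [cupNodes] at hk
  rw [e, Set.ncard_eq_one]
  refine ⟨{Fin.last a}, Set.ext fun S => ⟨?_, ?_⟩⟩
  · rintro ⟨⟨j, rfl⟩, hS⟩
    have : j = Fin.last a := hS (Setoid.refl' ⊥ j)
    subst this
    rfl
  · rintro rfl
    exact ⟨⟨Fin.last a, rfl⟩, le_rfl⟩

end Strand

/-! ### The Temperley–Lieb category -/

section Category

variable {c : ℂ} {a b m k : ℕ}

local notation:70 x:70 " ⬝ " y:71 => mulLin (fun _ : Unit => _) x y

/-- The identity diagram as a basis vector. -/
noncomputable def oneTL (c : ℂ) (a : ℕ) : TL c a a := single _ (idTL a)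

theorem mulDiagram_unit (d : TLDiagram a b) (e : TLDiagram b m) :
    mulDiagram (fun _ : Unit => c) d e =
      c ^ loops d.rel e.rel (fun y => d.colour (.inr y)) () •
        single _ (d.comp e (Diagram.match_unit _ _)) := by
  rw [mulDiagram, dif_pos (Diagram.match_unit d e)]
  simp

theorem oneTL_mul (x : TL c a b) : oneTL c a ⬝ x = x := by
  have h : oneTL c a = oneSpace (fun _ : Unit => c) (Fin a) := by
    rw [oneSpace, Finset.sum_eq_single (fun _ => ())]
    · rfl
    · exact fun d _ h => (h (funext fun _ => rfl)).elim
    · exact fun h => (h (Finset.mem_univ _)).elim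
  rw [h, oneSpace_mulLin]

theorem flipLin_oneTL : flipLin _ (oneTL c a) = oneTL c a := by
  rw [oneTL, flipLin_single]
  exact congrArg _ (Diagram.flip_idDiagram _)

theorem mul_oneTL (x : TL c a b) : x ⬝ oneTL c b = x := by
  rw [← flipLin_flipLin (x ⬝ oneTL c b), flipLin_mulLin, flipLin_oneTL, oneTL_mul, flipLin_flipLin]

/-- Adding a vertical strand on the right. -/
noncomputable def addStrand : TL c a b →ₗ[ℂ] TL c (a + 1) (b + 1) :=
  (joinLin (finSumFinEquiv (m := a) (n := 1)) (finSumFinEquiv (m := b) (n := 1)) () ()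
    (fun _ : Unit => c) (fun _ => c) (fun _ => c)).flip (oneTL c 1)

theorem addStrand_single (d : TLDiagram a b) :
    addStrand (single (fun _ : Unit => c) d) = single _ d.strand := by
  rw [addStrand, LinearMap.flip_apply, oneTL, joinLin_single]
  rfl

theorem addStrand_oneTL : addStrand (oneTL c a) = oneTL c (a + 1) := by
  rw [oneTL, addStrand_single]
  refine congrArg _ ((Diagram.join_id _ _ _).trans ?_)
  rfl

theorem addStrand_mul (x : TL c a b) (y : TL c b m) :
    addStrand (x ⬝ y) = addStrand x ⬝ addStrand y := by
  refine Eq.trans ?_ (mulLin_joinLin _ _ _ () () rfl rfl x (oneTL c 1) y (oneTL c 1)).symm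
  rw [oneTL_mul]
  rfl

theorem flipLin_addStrand (x : TL c a b) :
    flipLin _ (addStrand x) = addStrand (flipLin _ x) := by
  refine Eq.trans (flipLin_joinLin _ _ () () x (oneTL c 1)) ?_
  rw [flipLin_oneTL]
  rfl

/-- Moving the last node of the bottom row to the end of the top row. -/
noncomputable def bend : TL c a (b + 1) ≃ₗ[ℂ] TL c (a + 1) b :=
  Finsupp.domLCongr (bendDiagram a b)

theorem bend_single (d : TLDiagram a (b + 1)) :
    bend (single (fun _ : Unit => c) d) = single _ (bendDiagram a b d) :=
  Finsupp.domLCongr_single _ _ _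

theorem bend_symm_single (d : TLDiagram (a + 1) b) :
    bend.symm (single (fun _ : Unit => c) d) = single _ ((bendDiagram a b).symm d) := by
  rw [LinearEquiv.symm_apply_eq, bend_single, Equiv.apply_symm_apply]

theorem flipLin_bend (x : TL c a (b + 1)) : flipLin _ (bend x) = bend.symm (flipLin _ x) := by
  induction x using space_induction with
  | h0 => simp
  | hadd a a' ha ha' => simp [ha, ha']
  | hs x d =>
  simp only [map_smul, bend_single, flipLin_single, bend_symm_single, flip_bendDiagram]

theorem flipLin_bend_symm (x : TL c (a + 1) b) :
    flipLin _ (bend.symm x) = bend (flipLin _ x) := by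
  rw [← LinearEquiv.symm_apply_eq, ← flipLin_bend, LinearEquiv.apply_symm_apply]

theorem addStrand_mul_bend (d : TL c a b) (x : TL c b (m + 1)) :
    addStrand d ⬝ bend x = bend (d ⬝ x) := by
  induction x using space_induction with
  | h0 => simp
  | hadd a a' ha ha' => simp only [map_add, ha, ha']
  | hs s x =>
  induction d using space_induction with
  | h0 => simp
  | hadd a a' ha ha' => simp only [map_add, map_smul, LinearMap.add_apply, smul_add] at *; rw [ha, ha']
  | hs r d =>
  simp only [map_smul, LinearMap.smul_apply, bend_single, addStrand_single, mulLin_single]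
  rw [mulDiagram_unit, mulDiagram_unit, map_smul, bend_single, bend_comp, loops_bend]

theorem mul_bend_symm (d : TL c a b) (y : TL c (b + 1) m) :
    d ⬝ bend.symm y = bend.symm (addStrand d ⬝ y) := by
  rw [LinearEquiv.eq_symm_apply, ← addStrand_mul_bend, LinearEquiv.apply_symm_apply]

theorem bend_symm_mul_addStrand (y : TL c (a + 1) b) (e : TL c b m) :
    bend.symm y ⬝ addStrand e = bend.symm (y ⬝ e) := by
  rw [← flipLin_flipLin (bend.symm y ⬝ addStrand e), flipLin_mulLin, flipLin_addStrand,
    flipLin_bend_symm, addStrand_mul_bend, flipLin_bend, flipLin_mulLin, flipLin_flipLin,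
    flipLin_flipLin]

theorem bend_mul (x : TL c a (b + 1)) (e : TL c b m) : bend x ⬝ e = bend (x ⬝ addStrand e) := by
  rw [← LinearEquiv.symm_apply_eq, ← bend_symm_mul_addStrand, LinearEquiv.symm_apply_apply]

/-- `a` strands and an arc which joins the last two nodes of the top row. -/
noncomputable def cup (c : ℂ) (a : ℕ) : TL c (a + 2) a := bend (oneTL c (a + 1))

/-- `a` strands and an arc which joins the last two nodes of the bottom row. -/
noncomputable def cap (c : ℂ) (a : ℕ) : TL c a (a + 2) := bend.symm (oneTL c (a + 1))

theorem cup_eq : cup c a = single _ (cupDiagram a) := bend_single _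

theorem flipLin_cup : flipLin _ (cup c a) = cap c a := by
  rw [cup, flipLin_bend, flipLin_oneTL, cap]

theorem flipLin_cap : flipLin _ (cap c a) = cup c a := by
  rw [← flipLin_cup, flipLin_flipLin]

theorem addStrand_mul_cup (x : TL c a (b + 1)) : addStrand x ⬝ cup c b = bend x := by
  rw [cup, addStrand_mul_bend, mul_oneTL]

theorem cup_mul (d : TL c a b) : cup c a ⬝ d = bend (addStrand d) := by
  rw [cup, bend_mul, oneTL_mul]

theorem addStrand_addStrand_mul_cup (d : TL c a b) :
    addStrand (addStrand d) ⬝ cup c b = cup c a ⬝ d := by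
  rw [addStrand_mul_cup, cup_mul]

theorem mul_cap (d : TL c a b) : d ⬝ cap c b = bend.symm (addStrand d) := by
  rw [cap, mul_bend_symm, mul_oneTL]

theorem cap_mul_addStrand (x : TL c (a + 1) b) : cap c a ⬝ addStrand x = bend.symm x := by
  rw [cap, bend_symm_mul_addStrand, oneTL_mul]

theorem cap_mul_addStrand_addStrand (d : TL c a b) :
    cap c a ⬝ addStrand (addStrand d) = d ⬝ cap c b := by
  rw [cap_mul_addStrand, mul_cap]

theorem cap_mul_cup : cap c a ⬝ cup c a = c • oneTL c a := by
  rw [← flipLin_cup, cup_eq, flipLin_single, mulLin_single, mulDiagram_unit, loops_cup, pow_one,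
    cup_comp]
  rfl

theorem cap_mul_addStrand_cup : cap c (a + 1) ⬝ addStrand (cup c a) = oneTL c (a + 1) := by
  rw [cap_mul_addStrand, cup, LinearEquiv.symm_apply_apply]

theorem addStrand_cap_mul_cup : addStrand (cap c a) ⬝ cup c (a + 1) = oneTL c (a + 1) := by
  rw [addStrand_mul_cup, cap, LinearEquiv.apply_symm_apply]

end Category

/-! ### Planar diagrams and half-diagrams -/

section Planar

variable {c : ℂ} {a b m k : ℕ}

local notation:70 x:70 " ⬝ " y:71 => mulLin (fun _ : Unit => _) x y

/-- Some two nodes of the bottom row are joined by an arc. -/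
def Diagram.HasArc {K X Y : Type} (d : Diagram K X Y) : Prop := ∃ i j, i ≠ j ∧ d.rel (.inr i) (.inr j)

/-- A pairing is determined by giving, for each node, the partner. -/
theorem isPairing_comap {X Y X' Y' : Type} {d : Diagram Unit X Y} {d' : Diagram Unit X' Y'}
    (e : X' ⊕ Y' ≃ X ⊕ Y) (hd : d.IsPairing) (h : ∀ u v, d'.rel u v ↔ d.rel (e u) (e v)) :
    d'.IsPairing := by
  intro u
  obtain ⟨v, ⟨h1, h2⟩, h3⟩ := hd (e u)
  refine ⟨e.symm v, ⟨fun h' => h1 (by rw [← h']; simp), by rw [h]; simpa using h2⟩, ?_⟩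
  rintro w ⟨hw1, hw2⟩
  rw [Equiv.eq_symm_apply]
  exact h3 _ ⟨fun h' => hw1 (e.injective h'), (h _ _).1 hw2⟩

theorem before_bendNodes {u v : Fin (a + 1) ⊕ Fin b} (h : Diagram.Before u v) :
    Diagram.Before (bendNodes a b u) (bendNodes a b v) := by
  rcases u with i | i <;> rcases v with j | j
  · induction i using Fin.lastCases with
    | last => exact absurd h (not_lt.2 (Fin.le_last j))
    | cast i =>
      induction j using Fin.lastCases with
      | last => simp [Diagram.Before]
      | cast j => simpa [Diagram.Before] using h
  · induction i using Fin.lastCases <;> simp [Diagram.Before, Fin.castSucc_lt_last]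
  · exact h.elim
  · simpa [Diagram.Before] using h

theorem before_bendNodes_symm {u v : Fin a ⊕ Fin (b + 1)} (h : Diagram.Before u v) :
    Diagram.Before ((bendNodes a b).symm u) ((bendNodes a b).symm v) := by
  rcases u with i | i <;> rcases v with j | j
  · simpa [Diagram.Before] using h
  · induction j using Fin.lastCases <;> simp [Diagram.Before, Fin.castSucc_lt_last]
  · exact h.elim
  · induction j using Fin.lastCases with
    | last => exact absurd h (not_lt.2 (Fin.le_last i))
    | cast j =>
      induction i using Fin.lastCases with
      | last => simp [Diagram.Before]
      | cast i => simpa [Diagram.Before] using h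

theorem IsBubble.bend {d : TLDiagram a (b + 1)} (hd : d.IsBubble) :
    (bendDiagram a b d).IsBubble :=
  ⟨fun _ _ _ _ h1 h2 h3 _ h5 h6 => hd.1 _ _ _ _ (before_bendNodes h1) (before_bendNodes h2)
    (before_bendNodes h3) rfl h5 h6, isPairing_comap (bendNodes a b) hd.2 fun _ _ => Iff.rfl⟩

theorem IsBubble.bend_symm {d : TLDiagram (a + 1) b} (hd : d.IsBubble) :
    ((bendDiagram a b).symm d).IsBubble :=
  ⟨fun _ _ _ _ h1 h2 h3 _ h5 h6 => hd.1 _ _ _ _ (before_bendNodes_symm h1)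
    (before_bendNodes_symm h2) (before_bendNodes_symm h3) rfl h5 h6,
    isPairing_comap (bendNodes a b).symm hd.2 fun _ _ => Iff.rfl⟩

theorem before_embed {u v : Fin a ⊕ Fin b} :
    Diagram.Before (embed u) (embed v) ↔ Diagram.Before u v := by
  rcases u with i | i <;> rcases v with j | j <;> simp [Diagram.Before, embed]

theorem embed_injective : (embed : Fin a ⊕ Fin b → _).Injective :=
  Function.Injective.sumMap (Fin.castSucc_injective _) (Fin.castSucc_injective _)

theorem embed_ne_inl_last (u : Fin a ⊕ Fin b) : embed u ≠ .inl (Fin.last a) := by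
  rcases u with i | i <;> simp [embed, Fin.castSucc_ne_last]

theorem embed_ne_inr_last (u : Fin a ⊕ Fin b) : embed u ≠ .inr (Fin.last b) := by
  rcases u with i | i <;> simp [embed, Fin.castSucc_ne_last]

theorem IsBubble.strand {d : TLDiagram a b} (hd : d.IsBubble) : d.strand.IsBubble := by
  have hnb : ∀ g : Fin (a + 1) ⊕ Fin (b + 1), Diagram.Before (.inl (Fin.last a)) g →
      ¬ Diagram.Before g (.inr (Fin.last b)) := by
    rintro (i | i) h1 h2
    · exact absurd h1 (not_lt.2 (Fin.le_last i))
    · exact absurd h2 (not_lt.2 (Fin.le_last i))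
  constructor
  · intro u v w x h1 h2 h3 _ h5 h6
    have tr : ∀ {u v w : Fin (a + 1) ⊕ Fin (b + 1)}, Diagram.Before u v → Diagram.Before v w →
        Diagram.Before u w := by
      rintro (u | u) (v | v) (w | w) h h' <;>
        first | trivial | exact lt_trans h h' | exact lt_trans h' h
    have irr : ∀ {u : Fin (a + 1) ⊕ Fin (b + 1)}, ¬ Diagram.Before u u := by
      rintro (u | u) h <;> exact lt_irrefl _ h
    -- The last nodes of the two rows are joined and neighbours, so they take part in no crossing.
    have key : ∀ {p r : Fin (a + 1) ⊕ Fin (b + 1)}, d.strand.rel p r → Diagram.Before p r →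
        (∃ p' r', p = embed p' ∧ r = embed r' ∧ d.rel p' r') ∨
          (p = .inl (Fin.last a) ∧ r = .inr (Fin.last b)) := by
      intro p r h hb
      rcases embed_cases p with ⟨p, rfl⟩ | rfl | rfl <;>
        rcases embed_cases r with ⟨r, rfl⟩ | rfl | rfl
      · exact Or.inl ⟨p, r, rfl, rfl, (d.strand_rel_embed _ _).1 h⟩
      · exact (d.not_strand_rel_inl_last _ h).elim
      · exact (d.not_strand_rel_inr_last _ h).elim
      · exact (d.not_strand_rel_inl_last _ (Setoid.symm' _ h)).elim
      · exact (irr hb).elim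
      · exact Or.inr ⟨rfl, rfl⟩
      · exact (d.not_strand_rel_inr_last _ (Setoid.symm' _ h)).elim
      · exact hb.elim
      · exact (irr hb).elim
    rcases key h5 (tr h1 h2) with ⟨u, w, rfl, rfl, h⟩ | ⟨rfl, rfl⟩
    · rcases key h6 (tr h2 h3) with ⟨v, x, rfl, rfl, h'⟩ | ⟨rfl, rfl⟩
      · exact (d.strand_rel_embed _ _).2 (hd.1 _ _ _ _ (before_embed.1 h1) (before_embed.1 h2)
          (before_embed.1 h3) rfl h h')
      · exact (hnb _ h2 h3).elim
    · exact (hnb _ h1 h2).elim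
  · intro u
    rcases embed_cases u with ⟨u, rfl⟩ | rfl | rfl
    · obtain ⟨v, ⟨h1, h2⟩, h3⟩ := hd.2 u
      refine ⟨embed v, ⟨fun h => h1 (embed_injective h), (d.strand_rel_embed _ _).2 h2⟩, ?_⟩
      rintro w ⟨hw1, hw2⟩
      rcases embed_cases w with ⟨w, rfl⟩ | rfl | rfl
      · exact congrArg _ (h3 w ⟨fun h => hw1 (congrArg _ h), (d.strand_rel_embed _ _).1 hw2⟩)
      · exact (d.not_strand_rel_inl_last _ hw2).elim
      · exact (d.not_strand_rel_inr_last _ hw2).elim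
    · refine ⟨_, ⟨by simp, d.strand_rel_last⟩, ?_⟩
      rintro w ⟨hw1, hw2⟩
      rcases embed_cases w with ⟨w, rfl⟩ | rfl | rfl
      · exact (d.not_strand_rel_inl_last _ (Setoid.symm' _ hw2)).elim
      · exact (hw1 rfl).elim
      · rfl
    · refine ⟨_, ⟨by simp, Setoid.symm' _ d.strand_rel_last⟩, ?_⟩
      rintro w ⟨hw1, hw2⟩
      rcases embed_cases w with ⟨w, rfl⟩ | rfl | rfl
      · exact (d.not_strand_rel_inr_last _ (Setoid.symm' _ hw2)).elim
      · rfl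
      · exact (hw1 rfl).elim

theorem isBubble_idTL : (idTL a).IsBubble := by
  induction a with
  | zero => exact ⟨fun u => by rcases u with i | i <;> exact i.elim0,
      fun u => by rcases u with i | i <;> exact i.elim0⟩
  | succ a ih =>
    have : (idTL a).strand = idTL (a + 1) := Diagram.join_id _ _ _
    exact this ▸ IsBubble.strand ih

/-- Without arcs on the bottom, a strand which ends in the last node of the top row is the last
strand, and can be removed. -/
theorem exists_eq_strand {d : TLDiagram (a + 1) b} (hd : d.IsBubble) (harc : ¬ d.HasArc) {j : Fin b}
    (hj : d.rel (.inl (Fin.last a)) (.inr j)) :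
    ∃ (k : ℕ) (h : b = k + 1) (d' : TLDiagram a k), d'.IsBubble ∧ ¬ d'.HasArc ∧
      h ▸ d = d'.strand := by
  obtain _ | k := b
  · exact j.elim0
  refine ⟨k, rfl, ?_⟩
  have huniq : ∀ {u v w}, d.rel u v → d.rel u w → v ≠ u → w ≠ u → v = w := fun h1 h2 h3 h4 =>
    (hd.2 _).unique ⟨h3, h1⟩ ⟨h4, h2⟩
  have hlast : d.rel (.inl (Fin.last a)) (.inr (Fin.last k)) := by
    by_cases hjl : j = Fin.last k
    · exact hjl ▸ hj
    obtain ⟨u, ⟨hu1, hu2⟩, -⟩ := hd.2 (.inr (Fin.last k))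
    rcases u with i | i
    · induction i using Fin.lastCases with
      | last => exact Setoid.symm' _ hu2
      | cast i =>
        have := hd.1 (.inl i.castSucc) (.inl (Fin.last a)) (.inr (Fin.last k)) (.inr j)
          (Fin.castSucc_lt_last i) trivial (Fin.lt_last_iff_ne_last.2 hjl) rfl
          (Setoid.symm' _ hu2) hj
        have := huniq (Setoid.symm' _ this) hj (by simp [Fin.castSucc_ne_last]) (by simp)
        cases this
    · exact (harc ⟨_, _, fun h => hu1 (by rw [h]), hu2⟩).elim
  have h1 : ∀ u, ¬ d.rel (embed u) (.inl (Fin.last a)) := fun u h =>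
    embed_ne_inr_last u (huniq (Setoid.symm' _ h) hlast (embed_ne_inl_last u) (by simp))
  have h2 : ∀ u, ¬ d.rel (embed u) (.inr (Fin.last k)) := fun u h =>
    h1 u (Setoid.trans' _ h (Setoid.symm' _ hlast))
  refine ⟨⟨fun _ => (), d.rel.comap embed, fun _ _ _ => rfl⟩, ⟨?_, ?_⟩, ?_, ?_⟩
  · intro u v w x b1 b2 b3 _ h5 h6
    exact hd.1 _ _ _ _ (before_embed.2 b1) (before_embed.2 b2) (before_embed.2 b3) rfl h5 h6
  · intro u
    obtain ⟨v, ⟨hv1, hv2⟩, hv3⟩ := hd.2 (embed u)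
    rcases embed_cases v with ⟨v, rfl⟩ | rfl | rfl
    · exact ⟨v, ⟨fun h => hv1 (congrArg _ h), hv2⟩, fun w hw => embed_injective
        (hv3 _ ⟨fun h => hw.1 (embed_injective h), hw.2⟩)⟩
    · exact (h1 _ hv2).elim
    · exact (h2 _ hv2).elim
  · rintro ⟨i, j, hij, h⟩
    exact harc ⟨i.castSucc, j.castSucc, fun h => hij (Fin.castSucc_injective _ h), h⟩
  · refine Diagram.ext_rel fun u v => ?_
    change d.rel u v ↔ _
    rcases embed_cases u with ⟨u, rfl⟩ | rfl | rfl <;>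
      rcases embed_cases v with ⟨v, rfl⟩ | rfl | rfl
    · rw [TLDiagram.strand_rel_embed]; rfl
    · exact iff_of_false (h1 _) (TLDiagram.not_strand_rel_inl_last _ _)
    · exact iff_of_false (h2 _) (TLDiagram.not_strand_rel_inr_last _ _)
    · exact iff_of_false (fun h => h1 _ (Setoid.symm' _ h))
        (fun h => TLDiagram.not_strand_rel_inl_last _ _ (Setoid.symm' _ h))
    · exact iff_of_true (Setoid.refl' _ _) (Setoid.refl' _ _)
    · exact iff_of_true hlast (TLDiagram.strand_rel_last _)
    · exact iff_of_false (fun h => h2 _ (Setoid.symm' _ h))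
        (fun h => TLDiagram.not_strand_rel_inr_last _ _ (Setoid.symm' _ h))
    · exact iff_of_true (Setoid.symm' _ hlast) (Setoid.symm' _ (TLDiagram.strand_rel_last _))
    · exact iff_of_true (Setoid.refl' _ _) (Setoid.refl' _ _)

end Planar

/-! ### Spans of diagrams -/

section Spans

variable {K X Y : Type} {δ : K → ℂ}

/-- The span of the diagrams with the property `P`. -/
noncomputable def diagramSpan (δ : K → ℂ) (P : Diagram K X Y → Prop) :
    Submodule ℂ (DiagramSpace δ X Y) :=
  Submodule.span ℂ {x | ∃ d, P d ∧ x = single δ d}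

theorem single_mem_diagramSpan {P : Diagram K X Y → Prop} {d : Diagram K X Y} (hd : P d) :
    single δ d ∈ diagramSpan δ P := Submodule.subset_span ⟨d, hd, rfl⟩

theorem diagramSpan_le {P : Diagram K X Y → Prop} {S : Submodule ℂ (DiagramSpace δ X Y)}
    (h : ∀ d, P d → single δ d ∈ S) : diagramSpan δ P ≤ S := by
  rw [diagramSpan, Submodule.span_le]
  rintro _ ⟨d, hd, rfl⟩
  exact h d hd

theorem diagramSpan_map {M : Type*} [AddCommGroup M] [Module ℂ M] {P : Diagram K X Y → Prop}
    (f : DiagramSpace δ X Y →ₗ[ℂ] M) {S : Submodule ℂ M} (h : ∀ d, P d → f (single δ d) ∈ S)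
    {x : DiagramSpace δ X Y} (hx : x ∈ diagramSpan δ P) : f x ∈ S :=
  diagramSpan_le (S := S.comap f) h hx

theorem coeff_eq_zero_of_mem {P : Diagram K X Y → Prop} {x : DiagramSpace δ X Y}
    (hx : x ∈ diagramSpan δ P) {d : Diagram K X Y} (hd : ¬ P d) : coeff δ d x = 0 :=
  diagramSpan_le (S := LinearMap.ker (coeff δ d))
    (fun _ he => coeff_single_of_ne fun h => hd (h ▸ he)) hx

theorem prop_of_single_mem {P : Diagram K X Y → Prop} {d : Diagram K X Y}
    (hx : single δ d ∈ diagramSpan δ P) : P d := by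
  by_contra h
  have := coeff_eq_zero_of_mem hx h
  rw [coeff_single_self] at this
  exact one_ne_zero this

instance [Finite X] [Finite Y] [Finite K] : Finite (Diagram K X Y) := by
  refine Finite.of_injective (β := (X ⊕ Y → K) × Set ((X ⊕ Y) × (X ⊕ Y)))
    (fun d => (d.colour, {p | d.rel p.1 p.2})) fun d e h => ?_
  have h1 := congrArg Prod.fst h
  have h2 := congrArg Prod.snd h
  refine Diagram.ext h1 (Setoid.ext fun u v => ?_)
  exact Set.ext_iff.1 h2 (u, v)

end Spans

/-! ### The planar part of the Temperley–Lieb category -/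

section Planar

variable {c : ℂ} {a b m k : ℕ}

local notation:70 x:70 " ⬝ " y:71 => mulLin (fun _ : Unit => _) x y

/-- The span of the planar diagrams. -/
noncomputable abbrev planarSpan (c : ℂ) (a b : ℕ) : Submodule ℂ (TL c a b) :=
  diagramSpan _ fun d => d.IsBubble

/-- The span of the planar diagrams with an arc on the bottom. -/
noncomputable abbrev arcSpan (c : ℂ) (a b : ℕ) : Submodule ℂ (TL c a b) :=
  diagramSpan _ fun d => d.IsBubble ∧ d.HasArc

theorem arcSpan_le : arcSpan c a b ≤ planarSpan c a b :=
  diagramSpan_le fun _ h => single_mem_diagramSpan h.1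

theorem oneTL_mem : oneTL c a ∈ planarSpan c a a := single_mem_diagramSpan isBubble_idTL

theorem bend_mem {x : TL c a (b + 1)} (hx : x ∈ planarSpan c a (b + 1)) :
    bend x ∈ planarSpan c (a + 1) b :=
  diagramSpan_map (bend : TL c a (b + 1) ≃ₗ[ℂ] TL c (a + 1) b).toLinearMap (fun d hd => by
    rw [LinearEquiv.coe_coe, bend_single]
    exact single_mem_diagramSpan (IsBubble.bend hd)) hx

theorem bend_symm_mem {x : TL c (a + 1) b} (hx : x ∈ planarSpan c (a + 1) b) :
    bend.symm x ∈ planarSpan c a (b + 1) :=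
  diagramSpan_map (bend : TL c a (b + 1) ≃ₗ[ℂ] TL c (a + 1) b).symm.toLinearMap (fun d hd => by
    rw [LinearEquiv.coe_coe, bend_symm_single]
    exact single_mem_diagramSpan (IsBubble.bend_symm hd)) hx

theorem addStrand_mem {x : TL c a b} (hx : x ∈ planarSpan c a b) :
    addStrand x ∈ planarSpan c (a + 1) (b + 1) :=
  diagramSpan_map addStrand (fun d hd => by
    rw [addStrand_single]
    exact single_mem_diagramSpan (IsBubble.strand hd)) hx

theorem HasArc.strand {d : TLDiagram a b} (h : d.HasArc) : d.strand.HasArc := by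
  obtain ⟨i, j, hij, h⟩ := h
  exact ⟨i.castSucc, j.castSucc, fun h => hij (Fin.castSucc_injective _ h),
    (d.strand_rel_embed (.inr i) (.inr j)).2 h⟩

theorem addStrand_mem_arc {x : TL c a b} (hx : x ∈ arcSpan c a b) :
    addStrand x ∈ arcSpan c (a + 1) (b + 1) :=
  diagramSpan_map addStrand (fun d hd => by
    rw [addStrand_single]
    exact single_mem_diagramSpan ⟨IsBubble.strand hd.1, HasArc.strand hd.2⟩) hx

theorem flip_mem {x : TL c a b} (hx : x ∈ planarSpan c a b) : flipLin _ x ∈ planarSpan c b a :=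
  diagramSpan_map (flipLin _) (fun d hd => by
    rw [flipLin_single]
    exact single_mem_diagramSpan hd.flip) hx

theorem cup_mem : cup c a ∈ planarSpan c (a + 2) a := bend_mem oneTL_mem

theorem cap_mem : cap c a ∈ planarSpan c a (a + 2) := bend_symm_mem oneTL_mem

/-- The diagrams with one arc, on the bottom, which joins two neighbours. -/
inductive IsCap {c : ℂ} : ∀ {a b : ℕ}, TL c a b → Prop
  | cap (b : ℕ) : IsCap (cap c b)
  | strand {a b : ℕ} {x : TL c a b} : IsCap x → IsCap (addStrand x)

theorem IsCap.eq {x : TL c a b} (hx : IsCap x) : b = a + 2 := by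
  induction hx with
  | cap b => rfl
  | strand _ ih => rw [ih]

/-- The products of a planar element with a diagram as in `IsCap`. -/
def IsCapMultiple (y : TL c a b) : Prop :=
  ∃ (m : ℕ) (e : TL c a m) (x : TL c m b), e ∈ planarSpan c a m ∧ IsCap x ∧ y = e ⬝ x

/-- Every planar diagram with an arc on the bottom has an arc on the bottom which joins two
neighbours. -/
theorem isCapMultiple_of_hasArc {d : TLDiagram a b} (hd : d.IsBubble) (h : d.HasArc) :
    IsCapMultiple (single (fun _ : Unit => c) d) := by
  induction b generalizing a with
  | zero =>
    obtain ⟨i, -⟩ := h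
    exact i.elim0
  | succ b ih =>
    obtain ⟨z, rfl⟩ := (bendDiagram a b).symm.surjective d
    have hz : z.IsBubble := by simpa using IsBubble.bend hd
    rw [← bend_symm_single]
    by_cases hza : z.HasArc
    · obtain ⟨_, e, x, he, hx, h⟩ := ih hz hza
      rw [h, ← bend_symm_mul_addStrand]
      exact ⟨_, _, _, bend_symm_mem he, hx.strand, rfl⟩
    · have key : ∃ j, z.rel (.inl (Fin.last a)) (.inr j) := by
        obtain ⟨i, j, hij, h⟩ := h
        rw [bendDiagram_symm_rel] at h
        induction i using Fin.lastCases with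
        | last =>
          induction j using Fin.lastCases with
          | last => exact (hij rfl).elim
          | cast j => exact ⟨j, by simpa using h⟩
        | cast i =>
          induction j using Fin.lastCases with
          | last => exact ⟨i, Setoid.symm' _ (by simpa using h)⟩
          | cast j =>
            exact (hza ⟨i, j, fun h => hij (congrArg _ h), by simpa using h⟩).elim
      obtain ⟨j, hj⟩ := key
      obtain ⟨k, rfl, z', hz', -, rfl⟩ := exists_eq_strand hz hza hj
      rw [← addStrand_single, ← mul_cap]
      exact ⟨_, _, _, single_mem_diagramSpan hz', .cap _, rfl⟩

theorem mul_isCap_mem {x : TL c b m} (hx : IsCap x) {e : TL c a b} (he : e ∈ planarSpan c a b) :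
    e ⬝ x ∈ planarSpan c a m := by
  induction hx generalizing a with
  | cap b => rw [mul_cap]; exact bend_symm_mem (addStrand_mem he)
  | strand _ ih =>
    rw [← LinearEquiv.symm_apply_apply bend e, bend_symm_mul_addStrand]
    exact bend_symm_mem (ih (bend_mem he))

/-- The partial trace, which closes the last strand, of a planar diagram is planar. -/
theorem partialTrace_mem {x : TL c (a + 1) (b + 1)} (hx : x ∈ planarSpan c (a + 1) (b + 1)) :
    cap c a ⬝ addStrand x ⬝ cup c b ∈ planarSpan c a b := by
  have hflip : ∀ {a b} (x : TL c (a + 1) (b + 1)), flipLin _ (cap c a ⬝ addStrand x ⬝ cup c b) =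
      cap c b ⬝ addStrand (flipLin _ x) ⬝ cup c a := fun x => by
    rw [flipLin_mulLin, flipLin_mulLin, flipLin_addStrand, flipLin_cap, flipLin_cup, mulLin_assoc]
  have hs : ∀ {a b} {x : TL c (a + 1) (b + 1)},
      (∀ d : TLDiagram (a + 1) (b + 1), d.IsBubble →
        cap c a ⬝ addStrand (single _ d) ⬝ cup c b ∈ planarSpan c a b) →
      x ∈ planarSpan c (a + 1) (b + 1) →
      cap c a ⬝ addStrand x ⬝ cup c b ∈ planarSpan c a b := fun {a b x} h hx =>
    diagramSpan_map ((mulLin _).flip (cup c b) ∘ₗ mulLin _ (cap c a) ∘ₗ addStrand) h hx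
  have main : ∀ N a b, a + b < N → ∀ d : TLDiagram (a + 1) (b + 1), d.IsBubble →
      cap c a ⬝ addStrand (single _ d) ⬝ cup c b ∈ planarSpan c a b := by
    intro N
    induction N with
    | zero => exact fun a b h => (Nat.not_lt_zero _ h).elim
    | succ N ih =>
    have harc : ∀ a b, a + b < N + 1 → ∀ d : TLDiagram (a + 1) (b + 1), d.IsBubble → d.HasArc →
        cap c a ⬝ addStrand (single _ d) ⬝ cup c b ∈ planarSpan c a b := by
      intro a b hab d hd h
      obtain ⟨m, e, x, he, hx, heq⟩ := isCapMultiple_of_hasArc (c := c) hd h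
      rw [heq, addStrand_mul]
      cases hx with
      | cap b =>
        rw [mulLin_assoc, mulLin_assoc, addStrand_cap_mul_cup, mul_oneTL, cap_mul_addStrand]
        exact bend_symm_mem he
      | @strand m _ x hx =>
        have := hx.eq
        rw [mulLin_assoc, mulLin_assoc, addStrand_addStrand_mul_cup, ← mulLin_assoc, ← mulLin_assoc]
        exact mul_isCap_mem hx (hs (ih a m (by omega)) he)
    intro a b hab d hd
    by_cases h : d.HasArc
    · exact harc a b hab d hd h
    by_cases h' : d.flip.HasArc
    · rw [← flipLin_flipLin (cap c a ⬝ addStrand (single _ d) ⬝ cup c b), hflip, flipLin_single]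
      exact flip_mem (harc b a (by omega) d.flip hd.flip h')
    · have key : ∃ j, d.rel (.inl (Fin.last a)) (.inr j) := by
        obtain ⟨u, ⟨hu1, hu2⟩, -⟩ := hd.2 (.inl (Fin.last a))
        rcases u with i | i
        · exact (h' ⟨_, _, fun h => hu1 (by rw [h]), hu2⟩).elim
        · exact ⟨i, hu2⟩
      obtain ⟨j, hj⟩ := key
      obtain ⟨k, hk, z', hz', -, hz⟩ := exists_eq_strand hd h hj
      cases hk
      obtain rfl : d = z'.strand := hz
      rw [← addStrand_single, cap_mul_addStrand_addStrand, mulLin_assoc, cap_mul_cup, map_smul,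
        mul_oneTL]
      exact Submodule.smul_mem _ _ (single_mem_diagramSpan hz')
  exact hs (main _ a b (Nat.lt_succ_self _)) hx

/-- Products of planar elements are planar. -/
theorem mul_mem {x : TL c a b} {y : TL c b m} (hx : x ∈ planarSpan c a b)
    (hy : y ∈ planarSpan c b m) : x ⬝ y ∈ planarSpan c a m := by
  induction b generalizing a m with
  | succ b ih =>
    have e : x ⬝ y = cap c a ⬝ addStrand (bend x ⬝ bend.symm y) ⬝ cup c m := by
      rw [mulLin_assoc, addStrand_mul_cup, ← addStrand_mul_bend, LinearEquiv.apply_symm_apply,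
        ← mulLin_assoc, cap_mul_addStrand, LinearEquiv.symm_apply_apply]
    rw [e]
    exact partialTrace_mem (ih (bend_mem hx) (bend_symm_mem hy))
  | zero =>
    suffices h : ∀ {a} {x : TL c 0 a} {y : TL c m 0}, x ∈ planarSpan c 0 a → y ∈ planarSpan c m 0 →
        y ⬝ x ∈ planarSpan c m a by
      rw [← flipLin_flipLin (x ⬝ y), flipLin_mulLin]
      exact flip_mem (h (flip_mem hx) (flip_mem hy))
    clear hx hy x y
    intro a x y hx hy
    have hs : (∀ d : TLDiagram 0 a, d.IsBubble → y ⬝ single _ d ∈ planarSpan c m a) →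
        y ⬝ x ∈ planarSpan c m a := fun h => diagramSpan_map (mulLin _ y) h hx
    refine hs fun d hd => ?_
    clear hx x hs
    induction a using Nat.strong_induction_on with
    | _ a ih =>
    obtain _ | a := a
    · have : single _ d = oneTL c 0 := congrArg _ (Diagram.ext_rel fun u v => by
        rcases u with i | i <;> exact i.elim0)
      rw [this, mul_oneTL]
      exact hy
    · have h : d.HasArc := by
        obtain ⟨u, ⟨hu1, hu2⟩, -⟩ := hd.2 (.inr 0)
        rcases u with i | i
        · exact i.elim0
        · exact ⟨_, _, fun h => hu1 (by rw [h]), hu2⟩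
      obtain ⟨k, e, x, he, hx, heq⟩ := isCapMultiple_of_hasArc (c := c) hd h
      have := hx.eq
      rw [heq, ← mulLin_assoc]
      exact mul_isCap_mem hx (diagramSpan_map (mulLin _ y) (ih k (by omega)) he)

theorem HasArc.comp {d : TLDiagram a b} {e : TLDiagram b m} (he : e.HasArc) :
    (d.comp e (Diagram.match_unit _ _)).HasArc := by
  obtain ⟨i, j, hij, h⟩ := he
  exact ⟨i, j, hij, rel_lower d.rel e.rel h⟩

theorem mul_mem_arc {x : TL c a b} {y : TL c b m} (hx : x ∈ planarSpan c a b)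
    (hy : y ∈ arcSpan c b m) : x ⬝ y ∈ arcSpan c a m := by
  refine diagramSpan_map (mulLin _ x) (fun e he => ?_) hy
  refine diagramSpan_map ((mulLin _).flip (single _ e)) (fun d hd => ?_) hx
  have h := mul_mem (c := c) (single_mem_diagramSpan hd) (single_mem_diagramSpan he.1)
  rw [LinearMap.flip_apply]
  rw [mulLin_single, mulDiagram_unit] at h ⊢
  generalize c ^ loops d.rel e.rel (fun y => d.colour (.inr y)) () = r at h
  by_cases hr : r = 0
  · rw [hr, zero_smul]
    exact zero_mem _
  · rw [Submodule.smul_mem_iff _ hr] at h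
    exact Submodule.smul_mem _ _ (single_mem_diagramSpan ⟨prop_of_single_mem h, HasArc.comp he.2⟩)

theorem cap_mem_arc : cap c a ∈ arcSpan c a (a + 2) := by
  rw [cap, oneTL, bend_symm_single]
  refine single_mem_diagramSpan ⟨IsBubble.bend_symm isBubble_idTL, Fin.last _,
    (Fin.last _).castSucc, (Fin.castSucc_ne_last _).symm, ?_⟩
  rw [bendDiagram_symm_rel, bendNodes_symm_last, bendNodes_symm_inr]
  rfl

theorem IsCap.mem_arc {x : TL c a b} (hx : IsCap x) : x ∈ arcSpan c a b := by
  induction hx with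
  | cap b => exact cap_mem_arc
  | strand _ ih => exact addStrand_mem_arc ih

/-- To show that the left ideal `arcSpan` has a property, it suffices to consider the generators. -/
theorem arcSpan_map {M : Type*} [AddCommGroup M] [Module ℂ M] (f : TL c a b →ₗ[ℂ] M)
    {S : Submodule ℂ M}
    (h : ∀ (m : ℕ) (e : TL c a m) (x : TL c m b), e ∈ planarSpan c a m → IsCap x → f (e ⬝ x) ∈ S)
    {y : TL c a b} (hy : y ∈ arcSpan c a b) : f y ∈ S := by
  refine diagramSpan_map f (fun d hd => ?_) hy
  obtain ⟨k, e, x, he, hx, heq⟩ := isCapMultiple_of_hasArc (c := c) hd.1 hd.2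
  rw [heq]
  exact h k e x he hx

end Planar

/-! ### Half-diagrams -/

section HalfDiagrams

variable {c : ℂ} {a b m k : ℕ}

local notation:70 x:70 " ⬝ " y:71 => mulLin (fun _ : Unit => _) x y

/-- The half-diagrams on `a` nodes with `k` defects: the planar diagrams all of whose bottom nodes
are on propagating lines. -/
abbrev HalfDiagram (a k : ℕ) : Type := {d : TLDiagram a k // d.IsBubble ∧ ¬ d.HasArc}

noncomputable instance : Fintype (HalfDiagram a k) := Fintype.ofFinite _

/-- A half-diagram as a basis vector. -/
noncomputable def halfVec (c : ℂ) (h : HalfDiagram a k) : TL c a k := single _ h.1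

theorem halfVec_mem (h : HalfDiagram a k) : halfVec c h ∈ planarSpan c a k :=
  single_mem_diagramSpan h.2.1

theorem coeff_halfVec [DecidableEq (HalfDiagram a k)] (h h' : HalfDiagram a k) :
    coeff _ h.1 (halfVec c h') = if h = h' then 1 else 0 := by
  split_ifs with e
  · subst e
    exact coeff_single_self _
  · exact coeff_single_of_ne fun e' => e (Subtype.ext e')

theorem coeff_arc (h : HalfDiagram a k) {x : TL c a k} (hx : x ∈ arcSpan c a k) :
    coeff _ h.1 x = 0 := coeff_eq_zero_of_mem hx fun h' => h.2.2 h'.2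

/-- Modulo the diagrams with an arc on the bottom, the half-diagrams span the planar diagrams. -/
theorem sub_sum_halfVec_mem {x : TL c a k} (hx : x ∈ planarSpan c a k) :
    x - ∑ h : HalfDiagram a k, coeff _ h.1 x • halfVec c h ∈ arcSpan c a k := by
  classical
  refine diagramSpan_map (LinearMap.id - ∑ h : HalfDiagram a k,
    (coeff (fun _ : Unit => c) h.1).smulRight (halfVec c h)) (fun d hd => ?_) hx |> fun h => by
      simpa [LinearMap.sum_apply] using h
  simp only [LinearMap.sub_apply, LinearMap.id_apply, LinearMap.sum_apply,
    LinearMap.smulRight_apply]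
  by_cases h : d.HasArc
  · rw [Finset.sum_eq_zero, sub_zero]
    · exact single_mem_diagramSpan ⟨hd, h⟩
    · intro h' _
      rw [coeff_arc h' (single_mem_diagramSpan ⟨hd, h⟩), zero_smul]
  · have e : single (fun _ : Unit => c) d = halfVec c ⟨d, hd, h⟩ := rfl
    rw [e]
    simp only [coeff_halfVec]
    simp

theorem not_hasArc_strand {d : TLDiagram a b} (h : ¬ d.HasArc) : ¬ d.strand.HasArc := by
  rintro ⟨i, j, hij, hr⟩
  induction i using Fin.lastCases with
  | last =>
    induction j using Fin.lastCases with
    | last => exact hij rfl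
    | cast j => exact d.not_strand_rel_inr_last (.inr j) (Setoid.symm' _ hr)
  | cast i =>
    induction j using Fin.lastCases with
    | last => exact d.not_strand_rel_inr_last (.inr i) hr
    | cast j =>
      exact h ⟨i, j, fun h => hij (congrArg _ h), (d.strand_rel_embed (.inr i) (.inr j)).1 hr⟩

theorem not_hasArc_bend {d : TLDiagram a (b + 1)} (h : ¬ d.HasArc) :
    ¬ (bendDiagram a b d).HasArc := by
  rintro ⟨i, j, hij, hr⟩
  rw [bendDiagram_rel, bendNodes_inr, bendNodes_inr] at hr
  exact h ⟨_, _, fun h => hij (Fin.castSucc_injective _ h), hr⟩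

/-- A half-diagram with a defect added on the right. -/
def HalfDiagram.strand (h : HalfDiagram a k) : HalfDiagram (a + 1) (k + 1) :=
  ⟨h.1.strand, IsBubble.strand h.2.1, not_hasArc_strand h.2.2⟩

/-- The half-diagram in which the last defect is replaced by an arc to a new node. -/
def HalfDiagram.bend (h : HalfDiagram a (k + 1)) : HalfDiagram (a + 1) k :=
  ⟨bendDiagram a k h.1, IsBubble.bend h.2.1, not_hasArc_bend h.2.2⟩

theorem halfVec_strand (h : HalfDiagram a k) : halfVec c h.strand = addStrand (halfVec c h) :=
  (addStrand_single _).symm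

theorem halfVec_bend (h : HalfDiagram a (k + 1)) : halfVec c h.bend = Bubble.bend (halfVec c h) :=
  (bend_single _).symm

theorem strand_injective : (TLDiagram.strand : TLDiagram a b → _).Injective := fun _ _ h =>
  (Diagram.join_inj _ _ _ _ h).1

theorem HalfDiagram.strand_injective : (HalfDiagram.strand : HalfDiagram a k → _).Injective :=
  fun _ _ h => Subtype.ext (Bubble.strand_injective (congrArg Subtype.val h))

theorem HalfDiagram.bend_injective : (HalfDiagram.bend : HalfDiagram a (k + 1) → _).Injective :=
  fun _ _ h => Subtype.ext ((bendDiagram a k).injective (congrArg Subtype.val h))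

theorem HalfDiagram.exists_eq (h : HalfDiagram (a + 1) k) :
    (∃ h' : HalfDiagram a (k + 1), h = h'.bend) ∨
      ∃ (k' : ℕ) (e : k = k' + 1) (h' : HalfDiagram a k'), e ▸ h = h'.strand := by
  obtain ⟨d, hd, harc⟩ := h
  by_cases key : ∃ j, d.rel (.inl (Fin.last a)) (.inr j)
  · obtain ⟨j, hj⟩ := key
    obtain ⟨k', rfl, z', hz', hz, e⟩ := exists_eq_strand hd harc hj
    exact Or.inr ⟨k', rfl, ⟨z', hz', hz⟩, Subtype.ext e⟩
  · refine Or.inl ⟨⟨(bendDiagram a k).symm d, IsBubble.bend_symm hd, ?_⟩, Subtype.ext (by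
      simp [HalfDiagram.bend])⟩
    rintro ⟨i, j, hij, h⟩
    rw [bendDiagram_symm_rel] at h
    induction i using Fin.lastCases with
    | last =>
      induction j using Fin.lastCases with
      | last => exact hij rfl
      | cast j => exact key ⟨j, by simpa using h⟩
    | cast i =>
      induction j using Fin.lastCases with
      | last => exact key ⟨i, Setoid.symm' _ (by simpa using h)⟩
      | cast j => exact harc ⟨i, j, fun h => hij (congrArg _ h), by simpa using h⟩

/-- The half-diagrams with a defect in the last node, and the other ones. -/
noncomputable def halfEquiv (a k : ℕ) :
    HalfDiagram a k ⊕ HalfDiagram a (k + 2) ≃ HalfDiagram (a + 1) (k + 1) :=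
  Equiv.ofBijective (Sum.elim HalfDiagram.strand HalfDiagram.bend) <| by
    constructor
    · have hne : ∀ (h : HalfDiagram a k) (h' : HalfDiagram a (k + 2)), h.strand ≠ h'.bend := by
        intro h h' e
        have h1 := h.1.strand_rel_last
        have e1 : h.1.strand = bendDiagram a (k + 1) h'.1 := congrArg Subtype.val e
        rw [e1, bendDiagram_rel, bendNodes_last, bendNodes_inr] at h1
        exact h'.2.2 ⟨_, _, (Fin.castSucc_ne_last _).symm, h1⟩
      exact Function.Injective.sumElim HalfDiagram.strand_injective HalfDiagram.bend_injective hne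
    · intro h
      obtain ⟨h', rfl⟩ | ⟨k', e, h', eh⟩ := h.exists_eq
      · exact ⟨.inr h', rfl⟩
      · cases e
        exact ⟨.inl h', eh.symm⟩

/-- Without defects, the last node is on an arc. -/
noncomputable def halfEquivZero (a : ℕ) : HalfDiagram a 1 ≃ HalfDiagram (a + 1) 0 :=
  Equiv.ofBijective HalfDiagram.bend <| by
    refine ⟨HalfDiagram.bend_injective, fun h => ?_⟩
    obtain ⟨h', rfl⟩ | ⟨k', e, h', eh⟩ := h.exists_eq
    · exact ⟨h', rfl⟩
    · cases e

theorem HalfDiagram.le (h : HalfDiagram a k) : k ≤ a := by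
  induction a generalizing k with
  | zero =>
    obtain _ | k := k
    · exact le_rfl
    · obtain ⟨u, ⟨hu1, hu2⟩, -⟩ := h.2.1.2 (.inr 0)
      rcases u with i | i
      · exact i.elim0
      · exact (h.2.2 ⟨_, _, fun e => hu1 (by rw [e]), hu2⟩).elim
  | succ a ih =>
    obtain ⟨h', -⟩ | ⟨k', rfl, h', -⟩ := h.exists_eq
    · have := ih h'
      omega
    · have := ih h'
      omega

theorem HalfDiagram.eq_id (h : HalfDiagram a a) : h.1 = idTL a := by
  induction a with
  | zero => exact Diagram.ext_rel fun u v => by rcases u with i | i <;> exact i.elim0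
  | succ a ih =>
    obtain ⟨h', -⟩ | ⟨k', e, h', eh⟩ := h.exists_eq
    · have := h'.le
      omega
    · cases e
      have e1 : h.1 = h'.1.strand := congrArg Subtype.val eh
      rw [e1, ih h']
      exact Diagram.join_id _ _ _

theorem not_hasArc_idTL : ¬ (idTL a).HasArc := by
  rintro ⟨i, j, hij, h⟩
  exact hij h

/-- The coefficient of the identity diagram. -/
noncomputable def coeffOne : TL c m m →ₗ[ℂ] ℂ := coeff _ (idTL m)

theorem coeffOne_arc {u : TL c m m} (hu : u ∈ arcSpan c m m) : coeffOne u = 0 :=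
  coeff_eq_zero_of_mem hu fun h => not_hasArc_idTL h.2

theorem coeffOne_oneTL : coeffOne (oneTL c m) = 1 := coeff_single_self _

/-- A planar diagram from `m` to `m` nodes is the identity, or has an arc on the bottom. -/
theorem sub_coeffOne_smul_mem {u : TL c m m} (hu : u ∈ planarSpan c m m) :
    u - coeffOne u • oneTL c m ∈ arcSpan c m m := by
  refine diagramSpan_map (LinearMap.id - coeffOne.smulRight (oneTL c m)) (fun d hd => ?_) hu
  simp only [LinearMap.sub_apply, LinearMap.id_apply, LinearMap.smulRight_apply]
  by_cases h : d.HasArc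
  · have h' := single_mem_diagramSpan (δ := fun _ : Unit => c) (P := fun d : TLDiagram m m =>
      d.IsBubble ∧ d.HasArc) ⟨hd, h⟩
    rw [coeffOne_arc h', zero_smul, sub_zero]
    exact h'
  · have e : d = idTL m := HalfDiagram.eq_id ⟨d, hd, h⟩
    have e' : single (fun _ : Unit => c) d = oneTL c m := congrArg _ e
    rw [e', coeffOne_oneTL, one_smul, sub_self]
    exact zero_mem _

theorem mem_arc_of_lt (h : a < m) {u : TL c a m} (hu : u ∈ planarSpan c a m) :
    u ∈ arcSpan c a m := by
  refine diagramSpan_le (fun d hd => single_mem_diagramSpan ⟨hd, ?_⟩) hu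
  by_contra harc
  exact absurd (HalfDiagram.le ⟨d, hd, harc⟩) (not_le.2 h)

theorem coeffOne_flip (u : TL c m m) : coeffOne (flipLin _ u) = coeffOne u := by
  induction u using space_induction with
  | h0 => simp
  | hadd a a' ha ha' => simp [ha, ha']
  | hs x d =>
    simp only [map_smul, flipLin_single]
    congr 1
    by_cases h : idTL m = d
    · rw [← h, idTL, Diagram.flip_idDiagram]
    · rw [coeffOne, coeff_single_of_ne h, coeff_single_of_ne]
      intro h'
      apply h
      rw [← d.flip_flip, ← h', idTL, Diagram.flip_idDiagram]

theorem coeffOne_addStrand (u : TL c m m) : coeffOne (addStrand u) = coeffOne u := by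
  induction u using space_induction with
  | h0 => simp
  | hadd a a' ha ha' => simp [ha, ha']
  | hs x d =>
    simp only [map_smul, addStrand_single]
    congr 1
    have e : idTL (m + 1) = (idTL m).strand := (Diagram.join_id _ _ _).symm
    by_cases h : idTL m = d
    · rw [← h, coeffOne, coeffOne, coeff_single_self, e, coeff_single_self]
    · rw [coeffOne, coeffOne, coeff_single_of_ne h, e, coeff_single_of_ne]
      exact fun h' => h (strand_injective h')

/-- The bilinear form: the coefficient of the identity in the product of the reflection of `x` with
`y`. -/
noncomputable def form (x y : TL c a k) : ℂ := coeffOne (flipLin _ x ⬝ y)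

theorem form_comm (x y : TL c a k) : form x y = form y x := by
  rw [form, ← coeffOne_flip, flipLin_mulLin, flipLin_flipLin, form]

theorem form_arc {x y : TL c a k} (hx : x ∈ planarSpan c a k) (hy : y ∈ arcSpan c a k) :
    form x y = 0 := coeffOne_arc (mul_mem_arc (flip_mem hx) hy)

theorem form_mul (x : TL c a k) (d : TL c a b) (y : TL c b k) :
    form x (d ⬝ y) = form (flipLin _ d ⬝ x) y := by
  rw [form, form, flipLin_mulLin, flipLin_flipLin, mulLin_assoc]

theorem form_addStrand (x y : TL c a k) : form (addStrand x) (addStrand y) = form x y := by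
  rw [form, flipLin_addStrand, ← addStrand_mul, coeffOne_addStrand, form]

end HalfDiagrams

/-! ### The orthogonal decomposition of the cell modules -/

section Orthogonal

variable {c : ℂ} {a b m k : ℕ}

local notation:70 x:70 " ⬝ " y:71 => mulLin (fun _ : Unit => _) x y

/-- The quantum integers, as functions of the loop value `c`. -/
def qInt (c : ℂ) : ℕ → ℂ
  | 0 => 0
  | 1 => 1
  | n + 2 => c * qInt c (n + 1) - qInt c n

/-- The combination of half-diagrams on `k + 2` nodes with one arc which is annihilated, modulo the
diagrams with an arc on the bottom, by all caps on the first `k + 1` nodes. -/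
noncomputable def singVec (c : ℂ) : ∀ k, TL c (k + 2) k
  | 0 => cup c 0
  | k + 1 => qInt c (k + 2) • cup c (k + 1) - addStrand (singVec c k)

theorem singVec_mem : singVec c k ∈ planarSpan c (k + 2) k := by
  induction k with
  | zero => exact cup_mem
  | succ k ih => exact sub_mem (Submodule.smul_mem _ _ cup_mem) (addStrand_mem ih)

theorem cap_mul_singVec : cap c k ⬝ singVec c k - qInt c (k + 2) • oneTL c k ∈ arcSpan c k k := by
  match k with
  | 0 =>
    rw [singVec, cap_mul_cup, show qInt c (0 + 2) = c by simp [qInt], sub_self]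
    exact zero_mem _
  | 1 =>
    have e : qInt c (1 + 2) = qInt c (0 + 2) * c - 1 := by simp [qInt]
    rw [singVec, map_sub, map_smul, cap_mul_cup, singVec, cap_mul_addStrand_cup, smul_smul,
      e, sub_smul, one_smul, sub_self]
    exact zero_mem _
  | k + 2 =>
    have e : qInt c (k + 2 + 2) = qInt c (k + 1 + 2) * c - qInt c (k + 2) := by
      rw [qInt]; ring
    rw [singVec, map_sub, map_smul, cap_mul_cup, singVec, map_sub, map_sub, map_smul, map_smul,
      cap_mul_addStrand_cup, cap_mul_addStrand_addStrand, smul_smul, e, sub_smul]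
    have := mul_mem_arc (singVec_mem (c := c) (k := k)) cap_mem_arc
    convert this using 1
    abel

theorem IsCap.addStrand_mul_singVec {x : TL c a (k + 1)} (hx : IsCap x) :
    addStrand x ⬝ singVec c k ∈ arcSpan c (a + 1) k := by
  induction k generalizing a with
  | zero =>
    have := hx.eq
    omega
  | succ k ih =>
    cases hx with
    | cap _ =>
      rw [singVec, map_sub, map_smul, addStrand_cap_mul_cup, ← addStrand_mul, ← addStrand_oneTL,
        ← map_smul, ← map_sub, ← neg_mem_iff, ← map_neg, neg_sub]
      exact addStrand_mem_arc cap_mul_singVec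
    | strand hx =>
      rw [singVec, map_sub, map_smul, addStrand_addStrand_mul_cup, ← addStrand_mul]
      exact sub_mem (Submodule.smul_mem _ _ (mul_mem_arc cup_mem hx.mem_arc))
        (addStrand_mem_arc (ih hx))

theorem addStrand_mul_singVec {x : TL c a (k + 1)} (hx : x ∈ arcSpan c a (k + 1)) :
    addStrand x ⬝ singVec c k ∈ arcSpan c (a + 1) k := by
  refine arcSpan_map ((mulLin _).flip (singVec c k) ∘ₗ addStrand) (fun m e x he hx => ?_) hx
  change addStrand (e ⬝ x) ⬝ singVec c k ∈ _
  rw [addStrand_mul, mulLin_assoc]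
  exact mul_mem_arc (addStrand_mem he) hx.addStrand_mul_singVec

theorem form_singVec : form (singVec c k) (singVec c k) = qInt c (k + 1) * qInt c (k + 2) := by
  have hk : coeffOne (cap c k ⬝ singVec c k) = qInt c (k + 2) := by
    have := coeffOne_arc (cap_mul_singVec (c := c) (k := k))
    rw [map_sub, map_smul, coeffOne_oneTL, sub_eq_zero] at this
    simpa using this
  rw [form]
  obtain _ | k := k
  · rw [show flipLin _ (singVec c 0) = cap c 0 from flipLin_cup, hk]
    simp [qInt]
  · have h2 := coeffOne_arc (addStrand_mul_singVec (mem_arc_of_lt (by omega)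
      (flip_mem (singVec_mem (c := c) (k := k)))))
    conv_lhs => enter [2, 1, 2]; rw [singVec, map_sub, map_smul, flipLin_cup, flipLin_addStrand]
    rw [map_sub, LinearMap.sub_apply, map_sub, h2, sub_zero, map_smul, LinearMap.smul_apply,
      map_smul, hk, smul_eq_mul]

/-- The part of a cell module which is orthogonal to the half-diagrams with a defect in the last node
is the image of this map. -/
noncomputable def orthVec : TL c a (k + 1) →ₗ[ℂ] TL c (a + 1) k :=
  (mulLin _).flip (singVec c k) ∘ₗ addStrand

theorem orthVec_apply (y : TL c a (k + 1)) : orthVec y = addStrand y ⬝ singVec c k := rfl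

theorem orthVec_zero (y : TL c a 1) : orthVec y = bend y := addStrand_mul_cup y

theorem orthVec_succ (y : TL c a (k + 2)) :
    orthVec y = qInt c (k + 2) • bend y - addStrand (y ⬝ singVec c k) := by
  rw [orthVec_apply, singVec, map_sub, map_smul, addStrand_mul_cup, addStrand_mul]

theorem form_orthVec {y y' : TL c a (k + 1)} (hy : y ∈ planarSpan c a (k + 1))
    (hy' : y' ∈ planarSpan c a (k + 1)) :
    form (orthVec y) (orthVec y') = qInt c (k + 1) * qInt c (k + 2) * form y y' := by
  have h1 := addStrand_mul_singVec (sub_coeffOne_smul_mem (mul_mem (flip_mem hy) hy'))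
  have h2 := coeffOne_arc (mul_mem_arc (flip_mem (singVec_mem (c := c) (k := k))) h1)
  simp only [map_sub, map_smul, LinearMap.sub_apply, LinearMap.smul_apply, addStrand_oneTL,
    oneTL_mul] at h2
  rw [form, orthVec_apply, orthVec_apply, flipLin_mulLin, mulLin_assoc,
    ← mulLin_assoc (flipLin _ (addStrand y)), flipLin_addStrand, ← addStrand_mul,
    sub_eq_zero.1 h2, smul_eq_mul, mul_comm]
  congr 1
  exact form_singVec

theorem form_addStrand_orthVec {x : TL c a k} {y : TL c a (k + 2)} (hx : x ∈ planarSpan c a k)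
    (hy : y ∈ planarSpan c a (k + 2)) : form (addStrand x) (orthVec y) = 0 := by
  rw [form, orthVec_apply, flipLin_addStrand, ← mulLin_assoc, ← addStrand_mul]
  exact coeffOne_arc (addStrand_mul_singVec (mem_arc_of_lt (by omega) (mul_mem (flip_mem hx) hy)))

end Orthogonal

/-! ### Gram matrices and their determinants -/

section Gram

open Polynomial

variable {c : ℂ} {a b m k : ℕ}

local notation:70 x:70 " ⬝ " y:71 => mulLin (fun _ : Unit => _) x y

open scoped Classical in
noncomputable instance : DecidableEq (HalfDiagram a k) := inferInstance

/-- `form` as a bilinear map. -/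
noncomputable def formLin : TL c a k →ₗ[ℂ] TL c a k →ₗ[ℂ] ℂ :=
  ((mulLin _).compr₂ coeffOne).comp (flipLin _)

theorem formLin_apply (x y : TL c a k) : formLin x y = form x y := rfl

/-- The matrix of the form on the half-diagrams. -/
noncomputable def gram (c : ℂ) (a k : ℕ) : Matrix (HalfDiagram a k) (HalfDiagram a k) ℂ :=
  Matrix.of fun x y => form (halfVec c x) (halfVec c y)

theorem gram_transform {ι : Type*} [Fintype ι] (e : ι ≃ HalfDiagram a k) (P : Matrix ι ι ℂ)
    (w : ι → TL c a k) (hw : ∀ i, w i ∈ planarSpan c a k)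
    (hP : ∀ j, w j - ∑ i, P i j • halfVec c (e i) ∈ arcSpan c a k) :
    P.transpose * (gram c a k).submatrix e e * P = Matrix.of fun i j => form (w i) (w j) := by
  have hs : ∀ j, ∑ i, P i j • halfVec c (e i) ∈ planarSpan c a k := fun j =>
    sum_mem fun i _ => Submodule.smul_mem _ _ (halfVec_mem _)
  ext i j
  have h1 := form_arc (hw i) (hP j)
  have h2 := form_arc (hs j) (hP i)
  rw [← formLin_apply, map_sub, sub_eq_zero] at h1 h2
  rw [Matrix.of_apply, ← formLin_apply, h1, formLin_apply, form_comm, ← formLin_apply, h2]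
  simp only [map_sum, map_smul, LinearMap.sum_apply, LinearMap.smul_apply, Matrix.mul_apply,
    Matrix.transpose_apply, Matrix.submatrix_apply, gram, Matrix.of_apply, smul_eq_mul,
    formLin_apply, Finset.mul_sum, Finset.sum_mul]
  rw [Finset.sum_comm]
  refine Finset.sum_congr rfl fun x _ => Finset.sum_congr rfl fun y _ => ?_
  rw [form_comm]
  ring

theorem halfVec_halfEquiv_inl (x : HalfDiagram a k) :
    halfVec c (halfEquiv a k (.inl x)) = addStrand (halfVec c x) := halfVec_strand x

theorem halfVec_halfEquiv_inr (y : HalfDiagram a (k + 2)) :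
    halfVec c (halfEquiv a k (.inr y)) = bend (halfVec c y) := halfVec_bend y

theorem halfVec_halfEquivZero (y : HalfDiagram a 1) :
    halfVec c (halfEquivZero a y) = bend (halfVec c y) := halfVec_bend y

/-- The half-diagrams with a defect in the last node and their orthogonal complement, which is spanned
by the values of `orthVec`, diagonalize the form into blocks.  The base change has a power of a quantum
integer as determinant, which therefore stands on the left. -/
theorem det_gram_succ : qInt c (k + 2) ^ (2 * Fintype.card (HalfDiagram a (k + 2))) *
    (gram c (a + 1) (k + 1)).det = (gram c a k).det *
      ((qInt c (k + 2) * qInt c (k + 3)) ^ Fintype.card (HalfDiagram a (k + 2)) *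
        (gram c a (k + 2)).det) := by
  let M : Matrix (HalfDiagram a k) (HalfDiagram a (k + 2)) ℂ :=
    Matrix.of fun x y => coeff _ x.1 (halfVec c y ⬝ singVec c k)
  let P : Matrix (HalfDiagram a k ⊕ HalfDiagram a (k + 2)) (HalfDiagram a k ⊕ HalfDiagram a (k + 2))
    ℂ := Matrix.fromBlocks 1 (-M) 0 (qInt c (k + 2) • 1)
  let w : HalfDiagram a k ⊕ HalfDiagram a (k + 2) → TL c (a + 1) (k + 1) :=
    Sum.elim (fun x => addStrand (halfVec c x)) (fun y => orthVec (halfVec c y))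
  have hsing : ∀ y : HalfDiagram a (k + 2), halfVec c y ⬝ singVec c k ∈ planarSpan c a k :=
    fun y => mul_mem (halfVec_mem y) singVec_mem
  have hw : ∀ i, w i ∈ planarSpan c (a + 1) (k + 1) := by
    rintro (x | y)
    · exact addStrand_mem (halfVec_mem x)
    · exact mul_mem (addStrand_mem (halfVec_mem y)) singVec_mem
  have hP : ∀ j, w j - ∑ i, P i j • halfVec c (halfEquiv a k i) ∈ arcSpan c (a + 1) (k + 1) := by
    rintro (x | y)
    · rw [Fintype.sum_sum_type, Finset.sum_eq_single x]
      · simp [P, w, halfVec_halfEquiv_inl]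
      · intro x' _ hx'
        simp [P, hx']
      · simp
    · have h1 := addStrand_mem_arc (sub_sum_halfVec_mem (hsing y))
      rw [← neg_mem_iff] at h1
      convert h1 using 1
      rw [Fintype.sum_sum_type]
      simp only [P, w, Sum.elim_inr, halfVec_halfEquiv_inl, halfVec_halfEquiv_inr,
        Matrix.fromBlocks_apply₁₂, Matrix.fromBlocks_apply₂₂,
        Matrix.smul_apply, Matrix.one_apply, Matrix.neg_apply, M, Matrix.of_apply, orthVec_succ,
        map_sub, map_sum, map_smul, neg_smul, Finset.sum_neg_distrib, smul_eq_mul, mul_ite,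
        mul_one, mul_zero, ite_smul, zero_smul, Finset.sum_ite_eq', Finset.mem_univ, if_true]
      abel
  have key := congrArg Matrix.det (gram_transform (halfEquiv a k) P w hw hP)
  have hB : (Matrix.of fun i j => form (w i) (w j)) = Matrix.fromBlocks (gram c a k) 0 0
      ((qInt c (k + 2) * qInt c (k + 3)) • gram c a (k + 2)) := by
    ext (i | i) (j | j)
    · exact form_addStrand _ _
    · exact form_addStrand_orthVec (halfVec_mem i) (halfVec_mem j)
    · exact (form_comm _ _).trans (form_addStrand_orthVec (halfVec_mem j) (halfVec_mem i))
    · exact form_orthVec (halfVec_mem i) (halfVec_mem j)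
  have hdP : P.det = qInt c (k + 2) ^ Fintype.card (HalfDiagram a (k + 2)) := by
    simp [P]
  rw [hB, Matrix.det_mul, Matrix.det_mul, Matrix.det_transpose, Matrix.det_submatrix_equiv_self,
    hdP, Matrix.det_fromBlocks_zero₂₁, Matrix.det_smul] at key
  rw [← key]
  ring

theorem det_gram_zero : (gram c (a + 1) 0).det =
    c ^ Fintype.card (HalfDiagram a 1) * (gram c a 1).det := by
  have h : (gram c (a + 1) 0).submatrix (halfEquivZero a) (halfEquivZero a) = c • gram c a 1 := by
    ext x y
    simp only [Matrix.submatrix_apply, gram, Matrix.of_apply, Matrix.smul_apply,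
      halfVec_halfEquivZero]
    rw [← orthVec_zero, ← orthVec_zero, form_orthVec (halfVec_mem x) (halfVec_mem y)]
    simp [qInt]
  rw [← Matrix.det_submatrix_equiv_self (halfEquivZero a), h, Matrix.det_smul]

theorem gram_self : gram c k k = 1 := by
  ext x y
  have e : x = y := Subtype.ext (x.eq_id.trans y.eq_id.symm)
  subst e
  have e' : halfVec c x = oneTL c k := congrArg _ x.eq_id
  rw [Matrix.one_apply_eq, gram, Matrix.of_apply, e', form, flipLin_oneTL, oneTL_mul,
    coeffOne_oneTL]

/-! ### The Gram determinants as polynomials in the loop value -/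

/-- The quantum integers as polynomials in the loop value (Chebyshev polynomials). -/
noncomputable def qPoly : ℕ → ℂ[X]
  | 0 => 0
  | 1 => 1
  | n + 2 => X * qPoly (n + 1) - qPoly n

theorem eval_qPoly (c : ℂ) : ∀ n, (qPoly n).eval c = qInt c n
  | 0 => by simp [qPoly, qInt]
  | 1 => by simp [qPoly, qInt]
  | n + 2 => by simp [qPoly, qInt, eval_qPoly c n, eval_qPoly c (n + 1)]

open Classical in
/-- The Gram matrix as a matrix of polynomials in the loop value. -/
noncomputable def gramPoly (a k : ℕ) : Matrix (HalfDiagram a k) (HalfDiagram a k) ℂ[X] :=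
  Matrix.of fun x y => if idTL k = x.1.flip.comp y.1 (Diagram.match_unit _ _) then
    X ^ loops x.1.flip.rel y.1.rel (fun y => x.1.flip.colour (.inr y)) () else 0

theorem gramPoly_map (c : ℂ) (a k : ℕ) : (gramPoly a k).map (eval c) = gram c a k := by
  ext x y
  rw [Matrix.map_apply, gram, gramPoly, Matrix.of_apply, Matrix.of_apply, form, halfVec, halfVec,
    flipLin_single, mulLin_single, mulDiagram_unit, map_smul, coeffOne]
  split_ifs with h
  · rw [← h, coeff_single_self]
    simp
  · rw [coeff_single_of_ne h]
    simp

theorem eval_det_gramPoly (c : ℂ) (a k : ℕ) : (gramPoly a k).det.eval c = (gram c a k).det := by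
  rw [← gramPoly_map, ← coe_evalRingHom, RingHom.map_det]
  rfl

theorem det_gramPoly_succ : qPoly (k + 2) ^ (2 * Fintype.card (HalfDiagram a (k + 2))) *
    (gramPoly (a + 1) (k + 1)).det = (gramPoly a k).det *
      ((qPoly (k + 2) * qPoly (k + 3)) ^ Fintype.card (HalfDiagram a (k + 2)) *
        (gramPoly a (k + 2)).det) := by
  refine Polynomial.funext fun c => ?_
  simp only [eval_mul, eval_pow, eval_det_gramPoly, eval_qPoly]
  exact det_gram_succ

theorem det_gramPoly_zero : (gramPoly (a + 1) 0).det =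
    qPoly 2 ^ Fintype.card (HalfDiagram a 1) * (gramPoly a 1).det := by
  refine Polynomial.funext fun c => ?_
  simp only [eval_mul, eval_pow, eval_det_gramPoly, eval_qPoly]
  rw [det_gram_zero]
  simp [qInt]

theorem det_gramPoly_self : (gramPoly k k).det = 1 := by
  refine Polynomial.funext fun c => ?_
  rw [eval_det_gramPoly, gram_self]
  simp

theorem isEmpty_halfDiagram (h : a < k) : IsEmpty (HalfDiagram a k) :=
  ⟨fun x => absurd x.le (not_le.2 h)⟩

theorem det_gramPoly_of_lt (h : a < k) : (gramPoly a k).det = 1 := by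
  have := isEmpty_halfDiagram h
  exact Matrix.det_isEmpty

theorem qInt_two (n : ℕ) : qInt 2 n = n ∧ qInt 2 (n + 1) = n + 1 := by
  induction n with
  | zero => simp [qInt]
  | succ n ih => exact ⟨by rw [ih.2]; push_cast; ring, by rw [qInt, ih.1, ih.2]; push_cast; ring⟩

theorem qPoly_ne_zero (n : ℕ) : qPoly (n + 1) ≠ 0 := by
  intro h
  have := congrArg (eval 2) h
  rw [eval_qPoly, (qInt_two n).2, eval_zero] at this
  exact Nat.cast_add_one_ne_zero n this

theorem det_gramPoly_ne_zero (a k : ℕ) : (gramPoly a k).det ≠ 0 := by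
  induction a generalizing k with
  | zero =>
    obtain _ | k := k
    · rw [det_gramPoly_self]; exact one_ne_zero
    · rw [det_gramPoly_of_lt (by omega)]; exact one_ne_zero
  | succ a ih =>
    obtain _ | k := k
    · rw [det_gramPoly_zero]
      exact mul_ne_zero (pow_ne_zero _ (qPoly_ne_zero 1)) (ih 1)
    · refine right_ne_zero_of_mul (a := qPoly (k + 2) ^ (2 * Fintype.card (HalfDiagram a (k + 2)))) ?_
      rw [det_gramPoly_succ]
      exact mul_ne_zero (ih k) (mul_ne_zero (pow_ne_zero _ (mul_ne_zero (qPoly_ne_zero _)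
        (qPoly_ne_zero _))) (ih _))

/-- The order of vanishing at `c` of the Gram determinant. -/
noncomputable def gramOrder (c : ℂ) (a k : ℕ) : ℕ := (gramPoly a k).det.rootMultiplicity c

/-- The order of vanishing at `c` of the quantum integer. -/
noncomputable def qOrder (c : ℂ) (n : ℕ) : ℕ := (qPoly n).rootMultiplicity c

theorem rootMultiplicity_pow_mul {p q : ℂ[X]} (hp : p ≠ 0) (hq : q ≠ 0) (c : ℂ) (n : ℕ) :
    (p ^ n * q).rootMultiplicity c = n * p.rootMultiplicity c + q.rootMultiplicity c := by
  classical
  rw [rootMultiplicity_mul (mul_ne_zero (pow_ne_zero n hp) hq), ← count_roots, roots_pow,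
    Multiset.count_nsmul, count_roots]

theorem gramOrder_succ (c : ℂ) (a k : ℕ) :
    gramOrder c (a + 1) (k + 1) + Fintype.card (HalfDiagram a (k + 2)) * qOrder c (k + 2) =
      gramOrder c a k + gramOrder c a (k + 2) +
        Fintype.card (HalfDiagram a (k + 2)) * qOrder c (k + 3) := by
  have h := congrArg (rootMultiplicity c) (det_gramPoly_succ (a := a) (k := k))
  have h2 := qPoly_ne_zero (k + 1)
  have h3 := qPoly_ne_zero (k + 2)
  have hg := det_gramPoly_ne_zero a (k + 2)
  rw [rootMultiplicity_pow_mul h2 (det_gramPoly_ne_zero _ _), rootMultiplicity_mul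
    (mul_ne_zero (det_gramPoly_ne_zero _ _) (mul_ne_zero (pow_ne_zero _ (mul_ne_zero h2 h3)) hg)),
    rootMultiplicity_pow_mul (mul_ne_zero h2 h3) hg,
    rootMultiplicity_mul (mul_ne_zero h2 h3)] at h
  simp only [gramOrder, qOrder]
  linarith

theorem gramOrder_zero (c : ℂ) (a : ℕ) :
    gramOrder c (a + 1) 0 = Fintype.card (HalfDiagram a 1) * qOrder c 2 + gramOrder c a 1 := by
  rw [gramOrder, det_gramPoly_zero,
    rootMultiplicity_pow_mul (qPoly_ne_zero 1) (det_gramPoly_ne_zero _ _)]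
  rfl

theorem gramOrder_of_le (c : ℂ) (h : a ≤ k) : gramOrder c a k = 0 := by
  rcases h.lt_or_eq with h | rfl
  · rw [gramOrder, det_gramPoly_of_lt h, rootMultiplicity_eq_zero]
    simp
  · rw [gramOrder, det_gramPoly_self, rootMultiplicity_eq_zero]
    simp

theorem card_halfDiagram_succ (a k : ℕ) : Fintype.card (HalfDiagram (a + 1) (k + 1)) =
    Fintype.card (HalfDiagram a k) + Fintype.card (HalfDiagram a (k + 2)) := by
  rw [← Fintype.card_congr (halfEquiv a k), Fintype.card_sum]

theorem card_halfDiagram_of_lt (h : a < k) : Fintype.card (HalfDiagram a k) = 0 := by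
  have := isEmpty_halfDiagram h
  exact Fintype.card_eq_zero

theorem card_halfDiagram_self (k : ℕ) : Fintype.card (HalfDiagram k k) = 1 :=
  Fintype.card_eq_one_iff.2 ⟨⟨idTL k, isBubble_idTL, not_hasArc_idTL⟩,
    fun x => Subtype.ext x.eq_id⟩

/-! ### The zeros of the quantum integers -/

theorem qInt_mul_sub {q : ℂ} (hq : q ≠ 0) (n : ℕ) :
    qInt (q + q⁻¹) n * (q - q⁻¹) = q ^ n - q⁻¹ ^ n ∧
      qInt (q + q⁻¹) (n + 1) * (q - q⁻¹) = q ^ (n + 1) - q⁻¹ ^ (n + 1) := by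
  induction n with
  | zero => simp [qInt]
  | succ n ih =>
    refine ⟨ih.2, ?_⟩
    rw [qInt]
    have h : q * q⁻¹ = 1 := mul_inv_cancel₀ hq
    linear_combination (q + q⁻¹) * ih.2 - ih.1 + (q ^ n - q⁻¹ ^ n) * h

theorem qPoly_identity (n : ℕ) : (qPoly (n + 1)) ^ 2 - X * qPoly (n + 1) * qPoly n + qPoly n ^ 2 = 1 := by
  induction n with
  | zero => simp [qPoly]
  | succ n ih => rw [qPoly]; linear_combination ih

theorem derivative_qPoly (n : ℕ) :
    (X ^ 2 - 4) * derivative (qPoly n) =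
      (n : ℂ[X]) * (2 * qPoly (n + 1) - X * qPoly n) - X * qPoly n ∧
    (X ^ 2 - 4) * derivative (qPoly (n + 1)) =
      ((n : ℂ[X]) + 1) * (2 * qPoly (n + 2) - X * qPoly (n + 1)) - X * qPoly (n + 1) := by
  induction n with
  | zero =>
    simp [qPoly]
    ring
  | succ n ih =>
    refine ⟨by push_cast; exact ih.2, ?_⟩
    have h1 := ih.1
    have h2 := ih.2
    have e3 : qPoly (n + 1 + 2) = X * qPoly (n + 2) - qPoly (n + 1) := by rw [qPoly]
    have e2 : qPoly (n + 2) = X * qPoly (n + 1) - qPoly n := by rw [qPoly]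
    have d2 : derivative (qPoly (n + 1 + 1)) =
        qPoly (n + 1) + X * derivative (qPoly (n + 1)) - derivative (qPoly n) := by
      rw [qPoly]; simp
    rw [d2, e3, show n + 1 + 1 = n + 2 from rfl]
    push_cast
    linear_combination X * h2 - h1 + X * (n + 1) * e2

/-- The zeros of the quantum integers are simple: at a zero, `derivative_qPoly` would make the preceding
quantum integer vanish too, against `qPoly_identity`. -/
theorem qOrder_eq {q c : ℂ} {l : ℕ} (hc : c = q + q⁻¹)
    (hl : IsLeast {k : ℕ | 0 < k ∧ q ^ (2 * k) = 1} l) (hl2 : 2 ≤ l) (n : ℕ) :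
    qOrder c (n + 1) = if l ∣ n + 1 then 1 else 0 := by
  have hq : q ≠ 0 := by
    rintro rfl
    have := hl.1.2
    rw [zero_pow (by omega)] at this
    exact zero_ne_one this
  have hqq : q * q⁻¹ = 1 := mul_inv_cancel₀ hq
  have hq2 : q ^ 2 ≠ 1 := fun h => by
    have : l ≤ 1 := hl.2 ⟨one_pos, by simpa using h⟩
    omega
  have hsub : q - q⁻¹ ≠ 0 := fun h => hq2 (by linear_combination q * h + hqq)
  have hord : orderOf (q ^ 2) = l := by
    rw [orderOf_eq_iff (by omega)]
    refine ⟨by rw [← pow_mul]; exact hl.1.2, fun m hm hm0 h => ?_⟩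
    have : l ≤ m := hl.2 ⟨hm0, by rw [pow_mul]; exact h⟩
    omega
  have hroot : ∀ n, qInt c n = 0 ↔ l ∣ n := by
    intro n
    rw [← hord, orderOf_dvd_iff_pow_eq_one, ← mul_left_inj' hsub, hc, (qInt_mul_sub hq n).1, zero_mul,
      inv_pow, sub_eq_zero, ← mul_eq_one_iff_eq_inv₀ (pow_ne_zero n hq), ← pow_add, ← pow_mul, two_mul]
  by_cases h : l ∣ n + 1
  · rw [if_pos h]
    have h0 := (hroot _).2 h
    refine le_antisymm (not_lt.1 fun h1 => ?_) ?_
    · rw [qOrder, one_lt_rootMultiplicity_iff_isRoot (qPoly_ne_zero n)] at h1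
      have hd := congrArg (eval c) (derivative_qPoly n).2
      have hi := congrArg (eval c) (qPoly_identity (n + 1))
      have h2 : eval c (derivative (qPoly (n + 1))) = 0 := h1.2
      simp only [eval_mul, eval_sub, eval_add, eval_pow, eval_X, eval_qPoly, eval_one, eval_natCast,
        eval_ofNat, h2, h0, mul_zero, sub_zero] at hd hi
      rw [eq_comm, mul_eq_zero, or_iff_right (Nat.cast_add_one_ne_zero n), mul_eq_zero,
        or_iff_right two_ne_zero] at hd
      rw [hd] at hi
      simp at hi
    · rw [Nat.succ_le_iff, qOrder, rootMultiplicity_pos (qPoly_ne_zero n), IsRoot.def, eval_qPoly, h0]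
  · rw [if_neg h, qOrder, rootMultiplicity_eq_zero]
    rw [IsRoot.def, eval_qPoly, hroot]
    exact h

/-! ### The orders of vanishing of the Gram determinants -/

/-- The form is nondegenerate if `l ∣ k + 1`, and the orders for two weights `k` and `k + 2t` which are
mirror images of each other add up to the number of half-diagrams of the larger weight. -/
theorem gramOrder_eq {c : ℂ} {l : ℕ} (hl : 2 ≤ l)
    (ho : ∀ n, qOrder c (n + 1) = if l ∣ n + 1 then 1 else 0) (a : ℕ) :
    (∀ k, l ∣ k + 1 → gramOrder c a k = 0) ∧
    ∀ k t, 0 < t → t < l → l ∣ k + t + 1 →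
      gramOrder c a k + gramOrder c a (k + 2 * t) = Fintype.card (HalfDiagram a (k + 2 * t)) := by
  have nd : ∀ {n m : ℕ}, l ∣ n → 0 < m → m < l → ¬ l ∣ n + m := fun h h1 h2 h3 =>
    absurd (Nat.le_of_dvd h1 ((Nat.dvd_add_right h).1 h3)) (by omega)
  induction a with
  | zero =>
    refine ⟨fun k _ => gramOrder_of_le c (Nat.zero_le _), fun k t h0 _ _ => ?_⟩
    rw [gramOrder_of_le c (Nat.zero_le _), gramOrder_of_le c (Nat.zero_le _),
      card_halfDiagram_of_lt (by omega)]
  | succ a ih =>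
    obtain ⟨ih1, ih2⟩ := ih
    constructor
    · intro k hk
      obtain _ | k := k
      · have := Nat.le_of_dvd one_pos hk
        omega
      · have h := gramOrder_succ c a k
        rw [ho, ho, if_pos hk, if_neg (nd hk one_pos (by omega))] at h
        have := ih2 k 1 one_pos (by omega) hk
        rw [mul_one] at this
        omega
    · intro k t h0 ht hk
      obtain ⟨u, hu⟩ : ∃ u, k + 2 * t = u + 1 := ⟨k + 2 * t - 1, by omega⟩
      have hμ := gramOrder_succ c a u
      -- The contribution of the half-diagrams with one more defect.
      have hup : gramOrder c a (u + 2) + Fintype.card (HalfDiagram a (u + 2)) * qOrder c (u + 3) +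
          (if k = 0 then 0 else gramOrder c a (k - 1)) =
            Fintype.card (HalfDiagram a (u + 2)) := by
        by_cases htl : t + 1 = l
        · have hd : l ∣ u + 3 := by
            have : u + 3 = (k + t + 1) + l := by omega
            rw [this]
            exact dvd_add hk dvd_rfl
          rw [ho, if_pos hd, ih1 _ hd]
          split_ifs with hk0
          · omega
          · have : l ∣ (k - 1) + 1 := by
              rw [← Nat.dvd_add_left (dvd_refl l)]
              convert hk using 1
              omega
            rw [ih1 _ this]
            omega
        · have hk0 : k ≠ 0 := by
            rintro rfl
            have := Nat.le_of_dvd (by omega) hk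
            omega
          have hd : ¬ l ∣ u + 3 := by
            rw [show u + 3 = (k + t + 1) + (t + 1) by omega]
            exact nd hk (by omega) (by omega)
          have := ih2 (k - 1) (t + 1) (by omega) (by omega) (by convert hk using 1; omega)
          rw [show k - 1 + 2 * (t + 1) = u + 2 by omega] at this
          rw [ho, if_neg hd, if_neg hk0]
          omega
      -- The contribution of the half-diagrams with one defect less.
      have hdown : gramOrder c a u + gramOrder c a (k + 1) +
          Fintype.card (HalfDiagram a (k + 1)) * qOrder c (k + 2) =
            Fintype.card (HalfDiagram a u) := by
        by_cases ht1 : t = 1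
        · subst ht1
          obtain rfl : u = k + 1 := by omega
          rw [ho, if_pos hk, ih1 _ hk]
          omega
        · have hd : ¬ l ∣ k + 2 := by
            intro h
            refine nd h (m := t - 1) (by omega) (by omega) ?_
            convert hk using 1
            omega
          have := ih2 (k + 1) (t - 1) (by omega) (by omega) (by convert hk using 1; omega)
          rw [show k + 1 + 2 * (t - 1) = u by omega] at this
          rw [ho, if_neg hd]
          omega
      have hu2 : ¬ l ∣ u + 2 := by
        rw [show u + 2 = (k + t + 1) + t by omega]
        exact nd hk h0 ht
      rw [ho, if_neg hu2] at hμ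
      rw [hu, card_halfDiagram_succ]
      obtain _ | k := k
      · have := gramOrder_zero c a
        rw [if_pos rfl] at hup
        simp only [zero_add] at *
        omega
      · have h := gramOrder_succ c a k
        have hk1 : ¬ l ∣ k + 2 := fun h => nd h h0 ht (by convert hk using 1; omega)
        rw [ho (k + 1), if_neg hk1] at h
        rw [if_neg (by omega), show k + 1 - 1 = k by omega] at hup
        simp only [show k + 1 + 1 = k + 2 from rfl, show k + 1 + 2 = k + 3 from rfl] at *
        omega

end Gram

/-! ### Corank and order of vanishing -/

section Corank

open Polynomial

/-- The dimension of the kernel of a specialized matrix of polynomials is at most the order of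
vanishing of the determinant: in a basis which extends one of the kernel, each column which belongs to
the kernel is divisible by `X - c`. -/
theorem finrank_ker_le_rootMultiplicity {ι : Type} [Fintype ι] [DecidableEq ι]
    (M : Matrix ι ι ℂ[X]) (c : ℂ) (hM : M.det ≠ 0) :
    Module.finrank ℂ (LinearMap.ker (M.map (eval c)).mulVecLin) ≤ M.det.rootMultiplicity c := by
  classical
  set N := LinearMap.ker (M.map (eval c)).mulVecLin with hN
  obtain ⟨N', h⟩ := N.exists_isCompl
  let b' := ((Module.finBasis ℂ N).prod (Module.finBasis ℂ N')).map (N.prodEquivOfIsCompl N' h)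
  let e := b'.indexEquiv (Pi.basisFun ℂ ι)
  let b := b'.reindex e
  let S : Finset ι := Finset.univ.map ⟨fun i : Fin (Module.finrank ℂ N) => e (.inl i),
    e.injective.comp Sum.inl_injective⟩
  have hS : ∀ j ∈ S, b j ∈ N := by
    intro j hj
    obtain ⟨i, -, rfl⟩ := Finset.mem_map.1 hj
    simp [b, b']
  let P : Matrix ι ι ℂ := (Pi.basisFun ℂ ι).toMatrix b
  have hP : IsUnit P.det := by
    rw [← Module.Basis.det_apply]
    exact (Pi.basisFun ℂ ι).isUnit_det b
  have hdvd : ∀ i j, (if j ∈ S then X - C c else 1) ∣ (M * P.map C) i j := by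
    intro i j
    split_ifs with hj
    · rw [dvd_iff_isRoot, IsRoot.def]
      have h1 := congrFun (LinearMap.mem_ker.1 (hS j hj)) i
      rw [Matrix.mulVecLin_apply, Matrix.mulVec, dotProduct] at h1
      rw [Matrix.mul_apply, eval_finsetSum]
      simpa [P, Module.Basis.toMatrix_apply] using h1
    · exact one_dvd _
  choose A hA using hdvd
  have hdet : (M * P.map C).det = (X - C c) ^ Module.finrank ℂ N * (Matrix.of A).det := by
    have h1 : M * P.map C = Matrix.of fun i j => (if j ∈ S then X - C c else 1) * A i j := by
      ext1 i j
      exact hA i j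
    have h2 := Matrix.det_mul_row (fun j => if j ∈ S then X - C c else 1) (Matrix.of A)
    rw [h1]
    refine h2.trans ?_
    rw [Finset.prod_ite_mem, Finset.univ_inter, Finset.prod_const]
    simp [S]
  rw [le_rootMultiplicity_iff hM]
  have h3 : (P.map C).det = C P.det := (RingHom.map_det C P).symm
  rw [Matrix.det_mul, h3] at hdet
  exact (IsUnit.dvd_mul_right (hP.map C)).1 ⟨_, hdet⟩

end Corank

/-! ### Homomorphisms between the cell modules of one colour -/

section Homs

open Matrix

variable {c : ℂ} {a b m k : ℕ}

local notation:70 x:70 " ⬝ " y:71 => mulLin (fun _ : Unit => _) x y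

theorem finrank_ker_gram_le (c : ℂ) (a k : ℕ) :
    Module.finrank ℂ (LinearMap.ker (gram c a k).mulVecLin) ≤ gramOrder c a k := by
  rw [← gramPoly_map]
  exact finrank_ker_le_rootMultiplicity _ _ (det_gramPoly_ne_zero a k)

theorem det_gram_eq_zero_iff : (gram c a k).det = 0 ↔ gramOrder c a k ≠ 0 := by
  rw [← eval_det_gramPoly, ← Polynomial.IsRoot.def, gramOrder, ← Nat.pos_iff_ne_zero,
    Polynomial.rootMultiplicity_pos (det_gramPoly_ne_zero a k)]

/-- The combination of half-diagrams with given coefficients. -/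
noncomputable def halfComb (c : ℂ) (a k : ℕ) : (HalfDiagram a k → ℂ) →ₗ[ℂ] TL c a k :=
  Fintype.linearCombination ℂ (halfVec c)

theorem halfComb_apply (v : HalfDiagram a k → ℂ) : halfComb c a k v = ∑ h, v h • halfVec c h :=
  Fintype.linearCombination_apply _ _ _

theorem halfComb_mem (v : HalfDiagram a k → ℂ) : halfComb c a k v ∈ planarSpan c a k := by
  rw [halfComb_apply]
  exact sum_mem fun h _ => Submodule.smul_mem _ _ (halfVec_mem h)

/-- The coefficients of the half-diagrams. -/
noncomputable def halfCoeff (c : ℂ) (a k : ℕ) : TL c a k →ₗ[ℂ] (HalfDiagram a k → ℂ) :=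
  LinearMap.pi fun h => coeff _ h.1

theorem halfCoeff_apply (x : TL c a k) (h : HalfDiagram a k) : halfCoeff c a k x h = coeff _ h.1 x :=
  rfl

theorem halfCoeff_halfComb (v : HalfDiagram a k → ℂ) : halfCoeff c a k (halfComb c a k v) = v := by
  classical
  ext h
  rw [halfCoeff_apply, halfComb_apply, map_sum]
  simp [coeff_halfVec]

theorem sub_halfComb_mem {x : TL c a k} (hx : x ∈ planarSpan c a k) :
    x - halfComb c a k (halfCoeff c a k x) ∈ arcSpan c a k := by
  rw [halfComb_apply]
  exact sub_sum_halfVec_mem hx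

theorem halfCoeff_arc {x : TL c a k} (hx : x ∈ arcSpan c a k) : halfCoeff c a k x = 0 :=
  funext fun h => coeff_arc h hx

theorem mem_arc_of_halfCoeff {x : TL c a k} (hx : x ∈ planarSpan c a k)
    (h : halfCoeff c a k x = 0) : x ∈ arcSpan c a k := by
  simpa [h] using sub_halfComb_mem hx

theorem gram_mulVec_halfCoeff {x : TL c a k} (hx : x ∈ planarSpan c a k) (h : HalfDiagram a k) :
    (gram c a k *ᵥ halfCoeff c a k x) h = form (halfVec c h) x := by
  have h1 := form_arc (halfVec_mem (c := c) h) (sub_halfComb_mem hx)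
  rw [← formLin_apply, map_sub, sub_eq_zero] at h1
  rw [← formLin_apply, h1, halfComb_apply, map_sum, mulVec, dotProduct]
  refine Finset.sum_congr rfl fun h' _ => ?_
  rw [map_smul, smul_eq_mul, mul_comm]
  rfl

theorem form_eq_zero_of_mulVec {w x : TL c a k} (hw : w ∈ planarSpan c a k)
    (hx : x ∈ planarSpan c a k) (h : gram c a k *ᵥ halfCoeff c a k x = 0) : form w x = 0 := by
  have h1 := form_arc hx (sub_halfComb_mem hw)
  rw [← formLin_apply, map_sub, sub_eq_zero, formLin_apply, formLin_apply] at h1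
  rw [form_comm, h1, form_comm, halfComb_apply, ← formLin_apply, map_sum, LinearMap.sum_apply]
  refine Finset.sum_eq_zero fun y _ => ?_
  rw [map_smul, LinearMap.smul_apply, formLin_apply, ← gram_mulVec_halfCoeff hx y, h]
  exact smul_zero _

/-- The matrix of right multiplication by `s` on the half-diagrams. -/
noncomputable def rightMatrix (a : ℕ) (s : TL c m k) :
    Matrix (HalfDiagram a k) (HalfDiagram a m) ℂ :=
  Matrix.of fun x y => coeff _ x.1 (halfVec c y ⬝ s)

theorem rightMatrix_mulVec (s : TL c m k) (v : HalfDiagram a m → ℂ) :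
    rightMatrix a s *ᵥ v = halfCoeff c a k (halfComb c a m v ⬝ s) := by
  ext x
  rw [halfCoeff_apply, halfComb_apply, map_sum, LinearMap.sum_apply, map_sum, mulVec, dotProduct]
  refine Finset.sum_congr rfl fun h' _ => ?_
  rw [map_smul, LinearMap.smul_apply, map_smul, smul_eq_mul, mul_comm]
  rfl

/-- If `l ∣ k + t + 1` with `0 < t < l`, there is a homomorphism to the cell modules with `k` defects
from those with `k + 2t` defects, given by right multiplication by an element `s`.  Its image is the
radical of the form of the target, and its kernel is that of the source: one inclusion is plain in both
cases, and the dimensions agree by `gramOrder_eq` and `finrank_ker_gram_le`. -/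
theorem exists_rightMatrix {l t : ℕ} (hl : 2 ≤ l)
    (ho : ∀ n, qOrder c (n + 1) = if l ∣ n + 1 then 1 else 0) (h0 : 0 < t) (ht : t < l)
    (hk : l ∣ k + t + 1) :
    ∃ s ∈ planarSpan c (k + 2 * t) k,
      (∀ b, ∀ u ∈ arcSpan c b (k + 2 * t), u ⬝ s ∈ arcSpan c b k) ∧
      ∀ a, LinearMap.range (rightMatrix a s).mulVecLin = LinearMap.ker (gram c a k).mulVecLin ∧
        LinearMap.ker (rightMatrix a s).mulVecLin =
          LinearMap.ker (gram c a (k + 2 * t)).mulVecLin := by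
  have hord := fun a => (gramOrder_eq hl ho a).2 k t h0 ht hk
  -- On `k + 2t` nodes, the two orders add up to the number of half-diagrams, and that for `k + 2t`
  -- defects is zero.  Hence the form for `k` defects is degenerate, and `s` is taken from its radical.
  obtain ⟨v, hv0, hv⟩ : ∃ v ≠ 0, gram c (k + 2 * t) k *ᵥ v = 0 := by
    rw [Matrix.exists_mulVec_eq_zero_iff, det_gram_eq_zero_iff]
    have := hord (k + 2 * t)
    rw [gramOrder_of_le c le_rfl, card_halfDiagram_self] at this
    omega
  set s := halfComb c (k + 2 * t) k v with hs
  have hsm : s ∈ planarSpan c (k + 2 * t) k := halfComb_mem v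
  have hsa : s ∉ arcSpan c (k + 2 * t) k := fun h => hv0 (by
    rw [← halfCoeff_halfComb (c := c) v]
    exact halfCoeff_arc h)
  have hform : ∀ w ∈ planarSpan c (k + 2 * t) k, form w s = 0 := by
    intro w hw
    refine form_eq_zero_of_mulVec hw hsm ?_
    rw [hs, halfCoeff_halfComb, hv]
  have harc : ∀ b, ∀ u ∈ arcSpan c b (k + 2 * t), u ⬝ s ∈ arcSpan c b k := by
    intro b u hu
    refine arcSpan_map ((mulLin _).flip s) (fun m e x he hx => ?_) hu
    rw [LinearMap.flip_apply, mulLin_assoc]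
    refine mul_mem_arc he ?_
    -- Closing an arc on top of `s` leaves fewer than `k + 2t` nodes, where the form for `k` defects is
    -- nondegenerate.
    have hxm : x ⬝ s ∈ planarSpan c m k := mul_mem (arcSpan_le hx.mem_arc) hsm
    refine mem_arc_of_halfCoeff hxm (Matrix.eq_zero_of_mulVec_eq_zero (M := gram c m k) ?_ ?_)
    · rw [Ne, det_gram_eq_zero_iff, not_not]
      have h1 := hord m
      have := hx.eq
      rw [card_halfDiagram_of_lt (by omega)] at h1
      omega
    · ext h
      rw [gram_mulVec_halfCoeff hxm, form_mul]
      exact hform _ (mul_mem (flip_mem (arcSpan_le hx.mem_arc)) (halfVec_mem h))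
  refine ⟨s, hsm, harc, fun a => ?_⟩
  have hr : LinearMap.range (rightMatrix a s).mulVecLin ≤ LinearMap.ker (gram c a k).mulVecLin := by
    rintro _ ⟨w, rfl⟩
    rw [LinearMap.mem_ker, mulVecLin_apply, mulVecLin_apply, rightMatrix_mulVec]
    ext h
    rw [gram_mulVec_halfCoeff (mul_mem (halfComb_mem w) hsm), form_mul]
    exact hform _ (mul_mem (flip_mem (halfComb_mem w)) (halfVec_mem h))
  have hker : LinearMap.ker (rightMatrix a s).mulVecLin ≤
      LinearMap.ker (gram c a (k + 2 * t)).mulVecLin := by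
    intro w hw
    rw [LinearMap.mem_ker, mulVecLin_apply, rightMatrix_mulVec] at hw
    have h1 := mem_arc_of_halfCoeff (mul_mem (halfComb_mem w) hsm) hw
    rw [LinearMap.mem_ker, mulVecLin_apply]
    ext h
    have h2 := mul_mem_arc (flip_mem (halfVec_mem (c := c) h)) h1
    rw [← mulLin_assoc] at h2
    have h3 := harc _ _ (sub_coeffOne_smul_mem
      (mul_mem (flip_mem (halfVec_mem (c := c) h)) (halfComb_mem (c := c) w)))
    rw [map_sub, LinearMap.sub_apply, map_smul, LinearMap.smul_apply, oneTL_mul] at h3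
    have h4 := (Submodule.sub_mem_iff_right _ h2).1 h3
    have h5 : coeffOne (flipLin _ (halfVec c h) ⬝ halfComb c a (k + 2 * t) w) = 0 := by
      by_contra hne
      exact hsa ((Submodule.smul_mem_iff _ hne).1 h4)
    have h6 := gram_mulVec_halfCoeff (halfComb_mem (c := c) w) h
    rw [halfCoeff_halfComb] at h6
    rw [h6]
    exact h5
  have hsum := (rightMatrix a s).mulVecLin.finrank_range_add_finrank_ker
  rw [Module.finrank_fintype_fun_eq_card, ← hord a] at hsum
  have h1 := finrank_ker_gram_le c a k
  have h2 := finrank_ker_gram_le c a (k + 2 * t)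
  have h3 := Submodule.finrank_mono hr
  have h4 := Submodule.finrank_mono hker
  exact ⟨Submodule.eq_of_le_of_finrank_eq hr (by omega),
    Submodule.eq_of_le_of_finrank_eq hker (by omega)⟩

/-- If there is a defect, the form does not vanish: some two half-diagrams form a zigzag without
closed loops. -/
theorem gram_ne_zero (c : ℂ) (k j : ℕ) : gram c (k + 1 + 2 * j) (k + 1) ≠ 0 := by
  suffices h : ∀ a, a = k + 1 + 2 * j →
      ∃ x ∈ planarSpan c a (k + 1), ∃ y ∈ planarSpan c a (k + 1), form x y ≠ 0 by
    obtain ⟨x, hx, y, hy, h⟩ := h _ rfl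
    exact fun h0 => h (form_eq_zero_of_mulVec hx hy (by rw [h0, zero_mulVec]))
  induction j with
  | zero =>
    rintro _ rfl
    refine ⟨_, oneTL_mem, _, oneTL_mem, ?_⟩
    rw [form, flipLin_oneTL, oneTL_mul, coeffOne_oneTL]
    exact one_ne_zero
  | succ j ih =>
    rintro a rfl
    obtain ⟨x, hx, y, hy, h⟩ := ih (k + 2 * j + 1) (by omega)
    rw [show k + 1 + 2 * (j + 1) = k + 2 * j + 1 + 2 by ring]
    refine ⟨cup c _ ⬝ x, mul_mem cup_mem hx, addStrand (cup c (k + 2 * j)) ⬝ y,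
      mul_mem (addStrand_mem cup_mem) hy, ?_⟩
    rwa [form_mul, flipLin_addStrand, flipLin_cup, ← mulLin_assoc, addStrand_cap_mul_cup, oneTL_mul]

end Homs

/-! ### Planar diagrams of two colours -/

section Split

variable {a₀ a₁ b₀ b₁ m n : ℕ}

/-- A division of a row into two parts which respects the order of each part. -/
structure IsSplitting (e : Fin a₀ ⊕ Fin a₁ ≃ Fin n) : Prop where
  inl : StrictMono fun i => e (.inl i)
  inr : StrictMono fun i => e (.inr i)

theorem isSplitting_finSumFinEquiv : IsSplitting (finSumFinEquiv (m := a₀) (n := a₁)) where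
  inl i j h := by
    simp only [finSumFinEquiv_apply_left]
    exact Fin.strictMono_castAdd a₁ h
  inr i j h := by
    simp only [finSumFinEquiv_apply_right]
    exact Fin.strictMono_natAdd a₀ h

namespace Diagram

variable {K : Type} {k₀ k₁ : K} {eX : Fin a₀ ⊕ Fin a₁ ≃ Fin m} {eY : Fin b₀ ⊕ Fin b₁ ≃ Fin n}

theorem join_rel_symm {A₀ A₁ B₀ B₁ X Y : Type} {eX : A₀ ⊕ A₁ ≃ X} {eY : B₀ ⊕ B₁ ≃ Y}
    {d₀ : Diagram Unit A₀ B₀} {d₁ : Diagram Unit A₁ B₁} {u v : (A₀ ⊕ B₀) ⊕ (A₁ ⊕ B₁)} :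
    (join eX eY k₀ k₁ d₀ d₁).rel ((splitRows eX eY).symm u) ((splitRows eX eY).symm v) ↔
      Sum.LiftRel d₀.rel d₁.rel u v := by
  change sumRel _ _ (splitRows eX eY _) (splitRows eX eY _) ↔ _
  rw [Equiv.apply_symm_apply, Equiv.apply_symm_apply, sumRel_iff]

theorem join_colour_symm {A₀ A₁ B₀ B₁ X Y : Type} {eX : A₀ ⊕ A₁ ≃ X} {eY : B₀ ⊕ B₁ ≃ Y}
    {d₀ : Diagram Unit A₀ B₀} {d₁ : Diagram Unit A₁ B₁} {u : (A₀ ⊕ B₀) ⊕ (A₁ ⊕ B₁)} :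
    (join eX eY k₀ k₁ d₀ d₁).colour ((splitRows eX eY).symm u) =
      Sum.elim (fun _ => k₀) (fun _ => k₁) u := by
  simp [join]

theorem before_splitRows_inl (hX : IsSplitting eX) (hY : IsSplitting eY) {u v : Fin a₀ ⊕ Fin b₀} :
    Before ((splitRows eX eY).symm (.inl u)) ((splitRows eX eY).symm (.inl v)) ↔ Before u v := by
  rcases u with u | u <;> rcases v with v | v
  · exact hX.inl.lt_iff_lt
  · exact Iff.rfl
  · exact Iff.rfl
  · exact hY.inl.lt_iff_lt

theorem before_splitRows_inr (hX : IsSplitting eX) (hY : IsSplitting eY) {u v : Fin a₁ ⊕ Fin b₁} :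
    Before ((splitRows eX eY).symm (.inr u)) ((splitRows eX eY).symm (.inr v)) ↔ Before u v := by
  rcases u with u | u <;> rcases v with v | v
  · exact hX.inr.lt_iff_lt
  · exact Iff.rfl
  · exact Iff.rfl
  · exact hY.inr.lt_iff_lt

theorem isPairing_join {A₀ A₁ B₀ B₁ X Y : Type} {eX : A₀ ⊕ A₁ ≃ X} {eY : B₀ ⊕ B₁ ≃ Y}
    {d₀ : Diagram Unit A₀ B₀} {d₁ : Diagram Unit A₁ B₁} :
    (join eX eY k₀ k₁ d₀ d₁).IsPairing ↔ d₀.IsPairing ∧ d₁.IsPairing := by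
  have h : (join eX eY k₀ k₁ d₀ d₁).IsPairing ↔ ∀ u : (A₀ ⊕ B₀) ⊕ (A₁ ⊕ B₁),
      ∃! v, v ≠ u ∧ Sum.LiftRel d₀.rel d₁.rel u v := by
    rw [IsPairing, ← (splitRows eX eY).symm.forall_congr_right]
    refine forall_congr' fun u => ?_
    refine (splitRows eX eY).symm.bijective.existsUnique_iff.trans ?_
    simp only [join_rel_symm, ne_eq, (splitRows eX eY).symm.injective.eq_iff]
  rw [h]
  constructor
  · refine fun h => ⟨fun u => ?_, fun u => ?_⟩
    · obtain ⟨v, ⟨h1, h2⟩, h3⟩ := h (.inl u)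
      cases h2 with
      | @inl _ v h2 =>
        exact ⟨v, ⟨fun e => h1 (by rw [e]), h2⟩, fun v' hv' => Sum.inl_injective
          (h3 (.inl v') ⟨fun e => hv'.1 (Sum.inl_injective e), .inl hv'.2⟩)⟩
    · obtain ⟨v, ⟨h1, h2⟩, h3⟩ := h (.inr u)
      cases h2 with
      | @inr _ v h2 =>
        exact ⟨v, ⟨fun e => h1 (by rw [e]), h2⟩, fun v' hv' => Sum.inr_injective
          (h3 (.inr v') ⟨fun e => hv'.1 (Sum.inr_injective e), .inr hv'.2⟩)⟩
  · rintro ⟨h0, h1⟩ (u | u)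
    · obtain ⟨v, ⟨h1, h2⟩, h3⟩ := h0 u
      refine ⟨.inl v, ⟨fun e => h1 (Sum.inl_injective e), .inl h2⟩, ?_⟩
      rintro _ ⟨hv, ⟨hr⟩ | _⟩
      exact congrArg _ (h3 _ ⟨fun e => hv (by rw [e]), hr⟩)
    · obtain ⟨v, ⟨h1, h2⟩, h3⟩ := h1 u
      refine ⟨.inr v, ⟨fun e => h1 (Sum.inr_injective e), .inr h2⟩, ?_⟩
      rintro _ ⟨hv, _ | ⟨hr⟩⟩
      exact congrArg _ (h3 _ ⟨fun e => hv (by rw [e]), hr⟩)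

theorem isPlanar_join (hk : k₀ ≠ k₁) (hX : IsSplitting eX) (hY : IsSplitting eY)
    {d₀ : TLDiagram a₀ b₀} {d₁ : TLDiagram a₁ b₁} :
    (join eX eY k₀ k₁ d₀ d₁).IsPlanar ↔ d₀.IsPlanar ∧ d₁.IsPlanar := by
  constructor
  · refine fun h => ⟨fun a b c e h1 h2 h3 _ h5 h6 => ?_, fun a b c e h1 h2 h3 _ h5 h6 => ?_⟩
    · exact Sum.liftRel_inl_inl.1 (join_rel_symm.1 (h _ _ _ _
        ((before_splitRows_inl hX hY).2 h1) ((before_splitRows_inl hX hY).2 h2)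
        ((before_splitRows_inl hX hY).2 h3) (by rw [join_colour_symm, join_colour_symm]; rfl)
        (join_rel_symm.2 (.inl h5)) (join_rel_symm.2 (.inl h6))))
    · exact Sum.liftRel_inr_inr.1 (join_rel_symm.1 (h _ _ _ _
        ((before_splitRows_inr hX hY).2 h1) ((before_splitRows_inr hX hY).2 h2)
        ((before_splitRows_inr hX hY).2 h3) (by rw [join_colour_symm, join_colour_symm]; rfl)
        (join_rel_symm.2 (.inr h5)) (join_rel_symm.2 (.inr h6))))
  · rintro ⟨h0, h1⟩ a b c e hab hbc hce hcol hac hbe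
    obtain ⟨a, rfl⟩ := (splitRows eX eY).symm.surjective a
    obtain ⟨b, rfl⟩ := (splitRows eX eY).symm.surjective b
    obtain ⟨c, rfl⟩ := (splitRows eX eY).symm.surjective c
    obtain ⟨e, rfl⟩ := (splitRows eX eY).symm.surjective e
    rw [join_colour_symm, join_colour_symm] at hcol
    rw [join_rel_symm] at *
    cases hac with
    | @inl a c hac =>
      cases hbe with
      | @inl b e hbe =>
        rw [before_splitRows_inl hX hY] at hab hbc hce
        exact .inl (h0 _ _ _ _ hab hbc hce rfl hac hbe)
      | inr _ => exact absurd hcol hk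
    | @inr a c hac =>
      cases hbe with
      | inl _ => exact absurd hcol hk.symm
      | @inr b e hbe =>
        rw [before_splitRows_inr hX hY] at hab hbc hce
        exact .inr (h1 _ _ _ _ hab hbc hce rfl hac hbe)

theorem isBubble_join (hk : k₀ ≠ k₁) (hX : IsSplitting eX) (hY : IsSplitting eY)
    {d₀ : TLDiagram a₀ b₀} {d₁ : TLDiagram a₁ b₁} :
    (join eX eY k₀ k₁ d₀ d₁).IsBubble ↔ d₀.IsBubble ∧ d₁.IsBubble := by
  rw [IsBubble, isPlanar_join hk hX hY, isPairing_join]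
  exact and_and_and_comm

theorem hasArc_join {A₀ A₁ B₀ B₁ X Y : Type} {eX : A₀ ⊕ A₁ ≃ X} {eY : B₀ ⊕ B₁ ≃ Y}
    {d₀ : Diagram Unit A₀ B₀} {d₁ : Diagram Unit A₁ B₁} :
    (join eX eY k₀ k₁ d₀ d₁).HasArc ↔ d₀.HasArc ∨ d₁.HasArc := by
  constructor
  · rintro ⟨i, j, hij, h⟩
    obtain ⟨i | i, rfl⟩ := eY.surjective i <;> obtain ⟨j | j, rfl⟩ := eY.surjective j
    · exact Or.inl ⟨i, j, fun e => hij (by rw [e]), Sum.liftRel_inl_inl.1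
        ((join_rel_symm (u := .inl (.inr i)) (v := .inl (.inr j))).1 h)⟩
    · exact absurd ((join_rel_symm (u := .inl (.inr i)) (v := .inr (.inr j))).1 h)
        Sum.not_liftRel_inl_inr
    · exact absurd ((join_rel_symm (u := .inr (.inr i)) (v := .inl (.inr j))).1 h)
        Sum.not_liftRel_inr_inl
    · exact Or.inr ⟨i, j, fun e => hij (by rw [e]), Sum.liftRel_inr_inr.1
        ((join_rel_symm (u := .inr (.inr i)) (v := .inr (.inr j))).1 h)⟩
  · rintro (⟨i, j, hij, h⟩ | ⟨i, j, hij, h⟩)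
    · exact ⟨eY (.inl i), eY (.inl j), fun e => hij (Sum.inl_injective (eY.injective e)),
        (join_rel_symm (u := .inl (.inr i)) (v := .inl (.inr j))).2 (.inl h)⟩
    · exact ⟨eY (.inr i), eY (.inr j), fun e => hij (Sum.inr_injective (eY.injective e)),
        (join_rel_symm (u := .inr (.inr i)) (v := .inr (.inr j))).2 (.inr h)⟩

/-- A diagram in two colours consists of its parts in each of the colours. -/
theorem exists_eq_join {A₀ A₁ B₀ B₁ X Y : Type} (eX : A₀ ⊕ A₁ ≃ X) (eY : B₀ ⊕ B₁ ≃ Y)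
    (hk : k₀ ≠ k₁) (d : Diagram K X Y)
    (hd : ∀ u, d.colour ((splitRows eX eY).symm u) = Sum.elim (fun _ => k₀) (fun _ => k₁) u) :
    ∃ d₀ d₁, d = join eX eY k₀ k₁ d₀ d₁ := by
  refine ⟨⟨fun _ => (), d.rel.comap ((splitRows eX eY).symm ∘ .inl), fun _ _ _ => rfl⟩,
    ⟨fun _ => (), d.rel.comap ((splitRows eX eY).symm ∘ .inr), fun _ _ _ => rfl⟩, ?_⟩
  refine Diagram.ext (funext fun u => ?_) (Setoid.ext fun u v => ?_)
  · obtain ⟨u, rfl⟩ := (splitRows eX eY).symm.surjective u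
    rw [hd, join_colour_symm]
  · obtain ⟨u, rfl⟩ := (splitRows eX eY).symm.surjective u
    obtain ⟨v, rfl⟩ := (splitRows eX eY).symm.surjective v
    refine Iff.trans ?_ join_rel_symm.symm
    have hc := fun h => d.colour_eq ((splitRows eX eY).symm u) ((splitRows eX eY).symm v) h
    rw [hd, hd] at hc
    rcases u with u | u <;> rcases v with v | v
    · exact ⟨fun h => .inl h, fun h => by cases h; assumption⟩
    · exact iff_of_false (fun h => hk (hc h)) Sum.not_liftRel_inl_inr
    · exact iff_of_false (fun h => hk.symm (hc h)) Sum.not_liftRel_inr_inl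
    · exact ⟨fun h => .inr h, fun h => by cases h; assumption⟩

end Diagram

/-- The number of letters `i` in a word. -/
def wordCount (w : Fin n → Fin 2) (i : Fin 2) : ℕ := Fintype.card {x // w x = i}

theorem wordCount_add (w : Fin n → Fin 2) : wordCount w 0 + wordCount w 1 = n := by
  have h := Fintype.card_subtype_compl fun x => w x = 0
  have h' := Fintype.card_subtype_le fun x => w x = 0
  rw [Fintype.card_fin] at h h'
  have e : Fintype.card {x // w x = 1} = Fintype.card {x // ¬ w x = 0} :=
    Fintype.card_congr (Equiv.subtypeEquivRight fun x => by
      generalize w x = i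
      revert i
      decide)
  rw [wordCount, wordCount, e, h]
  omega

theorem exists_wordCount_eq (h : a₀ + a₁ = n) :
    ∃ w : Fin n → Fin 2, wordCount w 0 = a₀ ∧ wordCount w 1 = a₁ := by
  subst h
  refine ⟨Fin.append (fun _ => 0) (fun _ => 1), ?_⟩
  have h0 : wordCount (Fin.append (fun _ : Fin a₀ => (0 : Fin 2)) (fun _ : Fin a₁ => 1)) 0 = a₀ := by
    rw [wordCount, Fintype.card_subtype, Finset.card_filter, Fin.sum_univ_add]
    simp
  have h1 := wordCount_add (Fin.append (fun _ : Fin a₀ => (0 : Fin 2)) (fun _ : Fin a₁ => 1))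
  omega

/-- The positions of the letter `i`, in increasing order. -/
noncomputable def wordPart (w : Fin n → Fin 2) (i : Fin 2) :
    Fin (wordCount w i) ≃o {x // w x = i} := Fintype.orderIsoFinOfCardEq _ rfl

/-- The division of a row into the nodes of each colour. -/
noncomputable def wordSplit (w : Fin n → Fin 2) :
    Fin (wordCount w 0) ⊕ Fin (wordCount w 1) ≃ Fin n :=
  Equiv.ofBijective (Sum.elim (fun i => (wordPart w 0 i).1) (fun i => (wordPart w 1 i).1)) <| by
    constructor
    · refine Function.Injective.sumElim
        (Subtype.val_injective.comp (wordPart w 0).injective)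
        (Subtype.val_injective.comp (wordPart w 1).injective) fun i j h => ?_
      have h0 := (wordPart w 0 i).2
      rw [h, (wordPart w 1 j).2] at h0
      exact absurd h0 (by decide)
    · intro x
      have h : w x = 0 ∨ w x = 1 := by
        generalize w x = i
        revert i
        decide
      obtain h | h := h
      · exact ⟨.inl ((wordPart w 0).symm ⟨x, h⟩), by simp⟩
      · exact ⟨.inr ((wordPart w 1).symm ⟨x, h⟩), by simp⟩

theorem isSplitting_wordSplit (w : Fin n → Fin 2) : IsSplitting (wordSplit w) where
  inl _ _ h := (wordPart w 0).strictMono h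
  inr _ _ h := (wordPart w 1).strictMono h

theorem wordSplit_inl (w : Fin n → Fin 2) (i : Fin (wordCount w 0)) : w (wordSplit w (.inl i)) = 0 :=
  (wordPart w 0 i).2

theorem wordSplit_inr (w : Fin n → Fin 2) (i : Fin (wordCount w 1)) : w (wordSplit w (.inr i)) = 1 :=
  (wordPart w 1 i).2

theorem elim_wordSplit_symm (w : Fin n → Fin 2) :
    Sum.elim (fun _ => 0) (fun _ => 1) ∘ (wordSplit w).symm = w := by
  funext x
  obtain ⟨i | i, rfl⟩ := (wordSplit w).surjective x
  · simp [wordSplit_inl]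
  · simp [wordSplit_inr]

theorem elim_finSumFinEquiv_symm (μ : Fin 2 → ℕ) :
    Sum.elim (fun _ => 0) (fun _ => 1) ∘ (finSumFinEquiv (m := μ 0) (n := μ 1)).symm =
      standardColour μ := by
  funext x
  obtain ⟨i | i, rfl⟩ := (finSumFinEquiv (m := μ 0) (n := μ 1)).surjective x
  · simp [standardColour]
  · simp [standardColour]

end Split

/-! ### The two-coloured diagrams as pairs of one-coloured diagrams -/

section Words

variable {δ : Fin 2 → ℂ} {n a₀ a₁ b₀ b₁ : ℕ} {μ ν : Fin 2 → ℕ}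

local notation:70 x:70 " ⬝ " y:71 => mulLin (fun _ : Unit => _) x y

theorem coeff_joinLin {K A₀ A₁ B₀ B₁ X Y : Type} (eX : A₀ ⊕ A₁ ≃ X) (eY : B₀ ⊕ B₁ ≃ Y) (k₀ k₁ : K)
    {δ : K → ℂ} {δ₀ δ₁ : Unit → ℂ} (d₀ : Diagram Unit A₀ B₀) (d₁ : Diagram Unit A₁ B₁)
    (x₀ : DiagramSpace δ₀ A₀ B₀) (x₁ : DiagramSpace δ₁ A₁ B₁) :
    coeff δ (Diagram.join eX eY k₀ k₁ d₀ d₁) (joinLin eX eY k₀ k₁ δ δ₀ δ₁ x₀ x₁) =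
      coeff δ₀ d₀ x₀ * coeff δ₁ d₁ x₁ := by
  induction x₀ using space_induction with
  | h0 => simp
  | hadd _ _ h h' => simp only [map_add, LinearMap.add_apply, h, h', add_mul]
  | hs x d =>
  induction x₁ using space_induction with
  | h0 => simp
  | hadd _ _ h h' => simp only [map_add, h, h', mul_add]
  | hs y e =>
  simp only [map_smul, LinearMap.smul_apply, joinLin_single, smul_eq_mul]
  by_cases h : d₀ = d ∧ d₁ = e
  · obtain ⟨rfl, rfl⟩ := h
    rw [coeff_single_self, coeff_single_self, coeff_single_self]
    ring
  · rw [coeff_single_of_ne fun h' => h (Diagram.join_inj _ _ _ _ h')]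
    by_cases h0 : d₀ = d
    · rw [coeff_single_of_ne fun h1 => h ⟨h0, h1⟩]
      ring
    · rw [coeff_single_of_ne h0]
      ring

/-- A bilinear map which vanishes on the basis vectors is zero on `joinLin`. -/
theorem joinLin_induction {K A₀ A₁ B₀ B₁ X Y : Type} {eX : A₀ ⊕ A₁ ≃ X} {eY : B₀ ⊕ B₁ ≃ Y} {k₀ k₁ : K}
    {δ : K → ℂ} {δ₀ δ₁ : Unit → ℂ} {P₀ : Diagram Unit A₀ B₀ → Prop} {P₁ : Diagram Unit A₁ B₁ → Prop}
    {M : Type*} [AddCommGroup M] [Module ℂ M] (f : DiagramSpace δ X Y →ₗ[ℂ] M) {S : Submodule ℂ M}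
    (h : ∀ d₀ d₁, P₀ d₀ → P₁ d₁ → f (single δ (Diagram.join eX eY k₀ k₁ d₀ d₁)) ∈ S)
    {x₀ : DiagramSpace δ₀ A₀ B₀} {x₁ : DiagramSpace δ₁ A₁ B₁} (hx₀ : x₀ ∈ diagramSpan δ₀ P₀)
    (hx₁ : x₁ ∈ diagramSpan δ₁ P₁) : f (joinLin eX eY k₀ k₁ δ δ₀ δ₁ x₀ x₁) ∈ S := by
  refine diagramSpan_map (f ∘ₗ (joinLin eX eY k₀ k₁ δ δ₀ δ₁).flip x₁) (fun d₀ h₀ => ?_) hx₀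
  refine diagramSpan_map (f ∘ₗ joinLin eX eY k₀ k₁ δ δ₀ δ₁ (single _ d₀)) (fun d₁ h₁ => ?_) hx₁
  rw [LinearMap.comp_apply, joinLin_single]
  exact h d₀ d₁ h₀ h₁

theorem join_colour_inl {K A₀ A₁ B₀ B₁ X Y : Type} {eX : A₀ ⊕ A₁ ≃ X} {eY : B₀ ⊕ B₁ ≃ Y} {k₀ k₁ : K}
    {d₀ : Diagram Unit A₀ B₀} {d₁ : Diagram Unit A₁ B₁} (x : X) :
    (Diagram.join eX eY k₀ k₁ d₀ d₁).colour (.inl x) =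
      Sum.elim (fun _ => k₀) (fun _ => k₁) (eX.symm x) := by
  obtain ⟨u | u, rfl⟩ := eX.surjective x <;> simp [Diagram.join]

theorem join_colour_inr {K A₀ A₁ B₀ B₁ X Y : Type} {eX : A₀ ⊕ A₁ ≃ X} {eY : B₀ ⊕ B₁ ≃ Y} {k₀ k₁ : K}
    {d₀ : Diagram Unit A₀ B₀} {d₁ : Diagram Unit A₁ B₁} (y : Y) :
    (Diagram.join eX eY k₀ k₁ d₀ d₁).colour (.inr y) =
      Sum.elim (fun _ => k₀) (fun _ => k₁) (eY.symm y) := by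
  obtain ⟨u | u, rfl⟩ := eY.surjective y <;> simp [Diagram.join]

theorem mulLin_joinLin_of_ne {K A₀ A₁ B₀ B₁ B₀' B₁' C₀ C₁ X Y Z : Type} [Fintype K]
    {eX : A₀ ⊕ A₁ ≃ X} {eY : B₀ ⊕ B₁ ≃ Y} {eY' : B₀' ⊕ B₁' ≃ Y} {eZ : C₀ ⊕ C₁ ≃ Z} {k₀ k₁ : K}
    (h : (Sum.elim (fun _ => k₀) (fun _ => k₁) ∘ eY.symm : Y → K) ≠
      Sum.elim (fun _ => k₀) (fun _ => k₁) ∘ eY'.symm)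
    {δ : K → ℂ} {δ₀ δ₁ : Unit → ℂ} (a : DiagramSpace δ₀ A₀ B₀) (b : DiagramSpace δ₁ A₁ B₁)
    (a' : DiagramSpace δ₀ B₀' C₀) (b' : DiagramSpace δ₁ B₁' C₁) :
    mulLin δ (joinLin eX eY k₀ k₁ δ δ₀ δ₁ a b) (joinLin eY' eZ k₀ k₁ δ δ₀ δ₁ a' b') = 0 := by
  induction a using space_induction with
  | h0 => simp
  | hadd _ _ h h' => simp [h, h']
  | hs x d =>
  induction b using space_induction with
  | h0 => simp
  | hadd _ _ h h' => simp only [map_add, LinearMap.add_apply, h, h', add_zero]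
  | hs y e =>
  induction a' using space_induction with
  | h0 => simp
  | hadd _ _ h h' => simp only [map_add, LinearMap.add_apply, h, h', add_zero]
  | hs x' d' =>
  induction b' using space_induction with
  | h0 => simp
  | hadd _ _ h h' => simp only [map_add, h, h', add_zero]
  | hs y' e' =>
  have hm : mulDiagram δ (Diagram.join eX eY k₀ k₁ d e) (Diagram.join eY' eZ k₀ k₁ d' e') = 0 := by
    unfold mulDiagram
    rw [dif_neg]
    refine fun hm => h (funext fun y => ?_)
    have h1 := hm y
    rwa [join_colour_inr, join_colour_inl] at h1
  simp only [map_smul, LinearMap.smul_apply, joinLin_single, mulLin_single, hm, smul_zero]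

variable (δ) in
/-- The diagrams whose top row is coloured by `w` and `w'`, in terms of the parts of each colour. -/
noncomputable def wordJoin₂ (w w' : Fin n → Fin 2) :
    TL (δ 0) (wordCount w 0) (wordCount w' 0) →ₗ[ℂ] TL (δ 1) (wordCount w 1) (wordCount w' 1) →ₗ[ℂ]
      DiagramSpace δ (Fin n) (Fin n) :=
  joinLin (wordSplit w) (wordSplit w') 0 1 δ _ _

variable (δ μ) in
/-- The diagrams whose top row is coloured by `w`, and whose bottom row has the standard colouring. -/
noncomputable def wordJoin (w : Fin n → Fin 2) :
    TL (δ 0) (wordCount w 0) (μ 0) →ₗ[ℂ] TL (δ 1) (wordCount w 1) (μ 1) →ₗ[ℂ]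
      DiagramSpace δ (Fin n) (Fin (μ 0 + μ 1)) :=
  joinLin (wordSplit w) finSumFinEquiv 0 1 δ _ _

theorem zero_ne_one_fin : (0 : Fin 2) ≠ 1 := by decide

theorem exists_eq_wordJoin₂ {d : Diagram (Fin 2) (Fin n) (Fin n)} (hd : d.IsBubble) :
    ∃ w w' d₀ d₁, d₀.IsBubble ∧ d₁.IsBubble ∧
      d = Diagram.join (wordSplit w) (wordSplit w') 0 1 d₀ d₁ := by
  let w : Fin n → Fin 2 := fun x => d.colour (.inl x)
  let w' : Fin n → Fin 2 := fun x => d.colour (.inr x)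
  obtain ⟨d₀, d₁, h⟩ := Diagram.exists_eq_join (wordSplit w) (wordSplit w') zero_ne_one_fin d (by
    rintro ((u | u) | (u | u))
    · exact wordSplit_inl w u
    · exact wordSplit_inl w' u
    · exact wordSplit_inr w u
    · exact wordSplit_inr w' u)
  rw [h, Diagram.isBubble_join zero_ne_one_fin (isSplitting_wordSplit w)
    (isSplitting_wordSplit w')] at hd
  exact ⟨w, w', d₀, d₁, hd.1, hd.2, h⟩

theorem exists_eq_wordJoin {d : Diagram (Fin 2) (Fin n) (Fin (μ 0 + μ 1))} (hd : IsUpper n μ d) :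
    ∃ w d₀ d₁, d₀.IsBubble ∧ d₁.IsBubble ∧
      d = Diagram.join (wordSplit w) finSumFinEquiv 0 1 d₀ d₁ := by
  let w : Fin n → Fin 2 := fun x => d.colour (.inl x)
  obtain ⟨d₀, d₁, h⟩ := Diagram.exists_eq_join (wordSplit w) (finSumFinEquiv (m := μ 0) (n := μ 1))
    zero_ne_one_fin d (by
    rintro ((u | u) | (u | u))
    · exact wordSplit_inl w u
    · refine (hd.2 _).trans ?_
      rw [← elim_finSumFinEquiv_symm]
      simp
    · exact wordSplit_inr w u
    · refine (hd.2 _).trans ?_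
      rw [← elim_finSumFinEquiv_symm]
      simp)
  have hb := hd.1
  rw [h, Diagram.isBubble_join zero_ne_one_fin (isSplitting_wordSplit w)
    isSplitting_finSumFinEquiv] at hb
  exact ⟨w, d₀, d₁, hb.1, hb.2, h⟩

theorem isUpper_join {w : Fin n → Fin 2} {d₀ : TLDiagram (wordCount w 0) (μ 0)}
    {d₁ : TLDiagram (wordCount w 1) (μ 1)} (h₀ : d₀.IsBubble) (h₁ : d₁.IsBubble) :
    IsUpper n μ (Diagram.join (wordSplit w) finSumFinEquiv 0 1 d₀ d₁) := by
  refine ⟨(Diagram.isBubble_join zero_ne_one_fin (isSplitting_wordSplit w)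
    isSplitting_finSumFinEquiv).2 ⟨h₀, h₁⟩, fun b => ?_⟩
  rw [← elim_finSumFinEquiv_symm]
  exact join_colour_inr b

variable (δ n μ) in
/-- The underlying vector space of `upperModule`. -/
noncomputable abbrev upperSpan : Submodule ℂ (DiagramSpace δ (Fin n) (Fin (μ 0 + μ 1))) :=
  diagramSpan δ (IsUpper n μ)

variable (δ n μ) in
/-- The underlying vector space of `lowerModule`. -/
noncomputable abbrev lowerSpan : Submodule ℂ (DiagramSpace δ (Fin n) (Fin (μ 0 + μ 1))) :=
  diagramSpan δ fun d => IsUpper n μ d ∧ HasBottomArc n μ d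

theorem lowerSpan_le : lowerSpan δ n μ ≤ upperSpan δ n μ :=
  diagramSpan_le fun _ h => single_mem_diagramSpan h.1

theorem wordJoin_mem {w : Fin n → Fin 2} {x₀ : TL (δ 0) (wordCount w 0) (μ 0)}
    {x₁ : TL (δ 1) (wordCount w 1) (μ 1)} (h₀ : x₀ ∈ planarSpan _ _ _) (h₁ : x₁ ∈ planarSpan _ _ _) :
    wordJoin δ μ w x₀ x₁ ∈ upperSpan δ n μ :=
  joinLin_induction LinearMap.id
    (fun _ _ h₀ h₁ => single_mem_diagramSpan (isUpper_join h₀ h₁)) h₀ h₁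

theorem wordJoin_mem_left {w : Fin n → Fin 2} {x₀ : TL (δ 0) (wordCount w 0) (μ 0)}
    {x₁ : TL (δ 1) (wordCount w 1) (μ 1)} (h₀ : x₀ ∈ arcSpan _ _ _) (h₁ : x₁ ∈ planarSpan _ _ _) :
    wordJoin δ μ w x₀ x₁ ∈ lowerSpan δ n μ :=
  joinLin_induction LinearMap.id (fun _ _ h₀ h₁ => single_mem_diagramSpan
    ⟨isUpper_join h₀.1 h₁, Diagram.hasArc_join.2 (Or.inl h₀.2)⟩) h₀ h₁

theorem wordJoin_mem_right {w : Fin n → Fin 2} {x₀ : TL (δ 0) (wordCount w 0) (μ 0)}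
    {x₁ : TL (δ 1) (wordCount w 1) (μ 1)} (h₀ : x₀ ∈ planarSpan _ _ _) (h₁ : x₁ ∈ arcSpan _ _ _) :
    wordJoin δ μ w x₀ x₁ ∈ lowerSpan δ n μ :=
  joinLin_induction LinearMap.id (fun _ _ h₀ h₁ => single_mem_diagramSpan
    ⟨isUpper_join h₀ h₁.1, Diagram.hasArc_join.2 (Or.inr h₁.2)⟩) h₀ h₁

theorem upperSpan_map {M : Type*} [AddCommGroup M] [Module ℂ M]
    (f : DiagramSpace δ (Fin n) (Fin (μ 0 + μ 1)) →ₗ[ℂ] M) {S : Submodule ℂ M}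
    (h : ∀ w, ∀ x₀ ∈ planarSpan (δ 0) (wordCount w 0) (μ 0),
      ∀ x₁ ∈ planarSpan (δ 1) (wordCount w 1) (μ 1), f (wordJoin δ μ w x₀ x₁) ∈ S)
    {x : DiagramSpace δ (Fin n) (Fin (μ 0 + μ 1))} (hx : x ∈ upperSpan δ n μ) : f x ∈ S := by
  refine diagramSpan_map f (fun d hd => ?_) hx
  obtain ⟨w, d₀, d₁, h₀, h₁, rfl⟩ := exists_eq_wordJoin hd
  have := h w _ (single_mem_diagramSpan h₀) _ (single_mem_diagramSpan h₁)
  rwa [wordJoin, joinLin_single] at this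

theorem lowerSpan_map {M : Type*} [AddCommGroup M] [Module ℂ M]
    (f : DiagramSpace δ (Fin n) (Fin (μ 0 + μ 1)) →ₗ[ℂ] M) {S : Submodule ℂ M}
    (h : ∀ w, ∀ x₀ ∈ arcSpan (δ 0) (wordCount w 0) (μ 0),
      ∀ x₁ ∈ planarSpan (δ 1) (wordCount w 1) (μ 1), f (wordJoin δ μ w x₀ x₁) ∈ S)
    (h' : ∀ w, ∀ x₀ ∈ planarSpan (δ 0) (wordCount w 0) (μ 0),
      ∀ x₁ ∈ arcSpan (δ 1) (wordCount w 1) (μ 1), f (wordJoin δ μ w x₀ x₁) ∈ S)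
    {x : DiagramSpace δ (Fin n) (Fin (μ 0 + μ 1))} (hx : x ∈ lowerSpan δ n μ) : f x ∈ S := by
  refine diagramSpan_map f (fun d hd => ?_) hx
  obtain ⟨hd, harc⟩ := hd
  obtain ⟨w, d₀, d₁, h₀, h₁, rfl⟩ := exists_eq_wordJoin hd
  obtain harc | harc := Diagram.hasArc_join.1 harc
  · have := h w _ (single_mem_diagramSpan ⟨h₀, harc⟩) _ (single_mem_diagramSpan h₁)
    rwa [wordJoin, joinLin_single] at this
  · have := h' w _ (single_mem_diagramSpan h₀) _ (single_mem_diagramSpan ⟨h₁, harc⟩)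
    rwa [wordJoin, joinLin_single] at this

/-! ### Products -/

theorem wordJoin₂_mul_wordJoin (w w' : Fin n → Fin 2)
    (x₀ : TL (δ 0) (wordCount w 0) (wordCount w' 0)) (x₁ : TL (δ 1) (wordCount w 1) (wordCount w' 1))
    (y₀ : TL (δ 0) (wordCount w' 0) (μ 0)) (y₁ : TL (δ 1) (wordCount w' 1) (μ 1)) :
    mulLin δ (wordJoin₂ δ w w' x₀ x₁) (wordJoin δ μ w' y₀ y₁) =
      wordJoin δ μ w (x₀ ⬝ y₀) (x₁ ⬝ y₁) :=
  mulLin_joinLin _ _ _ 0 1 (δ := δ) (δ₀ := fun _ => δ 0) (δ₁ := fun _ => δ 1) rfl rfl _ _ _ _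

theorem wordJoin₂_mul_wordJoin_of_ne {w w' w'' : Fin n → Fin 2} (h : w' ≠ w'')
    (x₀ : TL (δ 0) (wordCount w 0) (wordCount w' 0)) (x₁ : TL (δ 1) (wordCount w 1) (wordCount w' 1))
    (y₀ : TL (δ 0) (wordCount w'' 0) (μ 0)) (y₁ : TL (δ 1) (wordCount w'' 1) (μ 1)) :
    mulLin δ (wordJoin₂ δ w w' x₀ x₁) (wordJoin δ μ w'' y₀ y₁) = 0 :=
  mulLin_joinLin_of_ne (by rwa [elim_wordSplit_symm, elim_wordSplit_symm]) _ _ _ _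

theorem wordJoin₂_mem {w w' : Fin n → Fin 2} {x₀ : TL (δ 0) (wordCount w 0) (wordCount w' 0)}
    {x₁ : TL (δ 1) (wordCount w 1) (wordCount w' 1)}
    (h₀ : x₀ ∈ planarSpan _ _ _) (h₁ : x₁ ∈ planarSpan _ _ _) :
    wordJoin₂ δ w w' x₀ x₁ ∈ bubbleAlgebra δ n :=
  joinLin_induction LinearMap.id (S := Subalgebra.toSubmodule (bubbleAlgebra δ n))
    (fun _ _ h₀ h₁ => Algebra.subset_adjoin ⟨_, (Diagram.isBubble_join zero_ne_one_fin
      (isSplitting_wordSplit w) (isSplitting_wordSplit w')).2 ⟨h₀, h₁⟩, rfl⟩) h₀ h₁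

/-- A subspace of diagrams is stable under the bubble algebra if it is stable under the generators. -/
theorem smul_mem_of_forall {Y : Type} [Finite Y] {S : Submodule ℂ (DiagramSpace δ (Fin n) Y)}
    (h : ∀ w w', ∀ x₀ ∈ planarSpan (δ 0) (wordCount w 0) (wordCount w' 0),
      ∀ x₁ ∈ planarSpan (δ 1) (wordCount w 1) (wordCount w' 1), ∀ y ∈ S,
        mulLin δ (wordJoin₂ δ w w' x₀ x₁) y ∈ S)
    (a : bubbleAlgebra δ n) {y : DiagramSpace δ (Fin n) Y} (hy : y ∈ S) : a • y ∈ S := by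
  obtain ⟨a, ha⟩ := a
  change mulLin δ a y ∈ S
  unfold bubbleAlgebra at ha
  induction ha using Algebra.adjoin_induction generalizing y with
  | mem a ha =>
    obtain ⟨d, hd, rfl⟩ := ha
    obtain ⟨w, w', d₀, d₁, h₀, h₁, rfl⟩ := exists_eq_wordJoin₂ hd
    have := h w w' _ (single_mem_diagramSpan h₀) _ (single_mem_diagramSpan h₁) y hy
    rwa [wordJoin₂, joinLin_single] at this
  | algebraMap r =>
    have e : mulLin δ (algebraMap ℂ (PartitionAlgebra δ n) r) y = r • y := by
      rw [Algebra.algebraMap_eq_smul_one, map_smul, LinearMap.smul_apply]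
      exact congrArg _ (oneSpace_mulLin y)
    rw [e]
    exact S.smul_mem r hy
  | add a b _ _ ha hb =>
    rw [map_add, LinearMap.add_apply]
    exact add_mem (ha hy) (hb hy)
  | mul a b _ _ ha hb =>
    have e : mulLin δ (a * b) y = mulLin δ a (mulLin δ b y) := mulLin_assoc _ _ _
    rw [e]
    exact ha (hb hy)

theorem smul_mem_upperSpan (a : bubbleAlgebra δ n) {y : DiagramSpace δ (Fin n) (Fin (μ 0 + μ 1))}
    (hy : y ∈ upperSpan δ n μ) : a • y ∈ upperSpan δ n μ := by
  refine smul_mem_of_forall (fun w w' x₀ h₀ x₁ h₁ y hy => ?_) a hy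
  refine upperSpan_map (mulLin δ _) (fun w'' y₀ k₀ y₁ k₁ => ?_) hy
  by_cases h : w' = w''
  · subst h
    rw [wordJoin₂_mul_wordJoin]
    exact wordJoin_mem (mul_mem h₀ k₀) (mul_mem h₁ k₁)
  · rw [wordJoin₂_mul_wordJoin_of_ne h]
    exact zero_mem _

theorem smul_mem_lowerSpan (a : bubbleAlgebra δ n) {y : DiagramSpace δ (Fin n) (Fin (μ 0 + μ 1))}
    (hy : y ∈ lowerSpan δ n μ) : a • y ∈ lowerSpan δ n μ := by
  refine smul_mem_of_forall (fun w w' x₀ h₀ x₁ h₁ y hy => ?_) a hy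
  refine lowerSpan_map (mulLin δ _) (fun w'' y₀ k₀ y₁ k₁ => ?_) (fun w'' y₀ k₀ y₁ k₁ => ?_) hy
  all_goals
    by_cases h : w' = w''
    · subst h
      rw [wordJoin₂_mul_wordJoin]
      first
      | exact wordJoin_mem_left (mul_mem_arc h₀ k₀) (mul_mem h₁ k₁)
      | exact wordJoin_mem_right (mul_mem h₀ k₀) (mul_mem_arc h₁ k₁)
    · rw [wordJoin₂_mul_wordJoin_of_ne h]
      exact zero_mem _

theorem mem_upperModule_iff {x : DiagramSpace δ (Fin n) (Fin (μ 0 + μ 1))} :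
    x ∈ upperModule δ n μ ↔ x ∈ upperSpan δ n μ := by
  constructor
  · intro hx
    unfold upperModule at hx
    induction hx using Submodule.span_induction with
    | mem x hx =>
      obtain ⟨d, hd, rfl⟩ := hx
      exact single_mem_diagramSpan hd
    | zero => exact zero_mem _
    | add x y _ _ hx hy => exact add_mem hx hy
    | smul a x _ hx => exact smul_mem_upperSpan a hx
  · intro hx
    exact diagramSpan_le (S := (upperModule δ n μ).restrictScalars ℂ)
      (fun d hd => Submodule.subset_span ⟨d, hd, rfl⟩) hx

theorem mem_lowerModule_iff {x : DiagramSpace δ (Fin n) (Fin (μ 0 + μ 1))} :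
    x ∈ lowerModule δ n μ ↔ x ∈ lowerSpan δ n μ := by
  constructor
  · intro hx
    unfold lowerModule at hx
    induction hx using Submodule.span_induction with
    | mem x hx =>
      obtain ⟨d, hd, harc, rfl⟩ := hx
      exact single_mem_diagramSpan ⟨hd, harc⟩
    | zero => exact zero_mem _
    | add x y _ _ hx hy => exact add_mem hx hy
    | smul a x _ hx => exact smul_mem_lowerSpan a hx
  · intro hx
    exact diagramSpan_le (S := (lowerModule δ n μ).restrictScalars ℂ)
      (fun d hd => Submodule.subset_span ⟨d, hd.1, hd.2, rfl⟩) hx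

/-- The pairing is the product of the forms of each colour. -/
theorem pairing_wordJoin (w : Fin n → Fin 2) (x₀ y₀ : TL (δ 0) (wordCount w 0) (μ 0))
    (x₁ y₁ : TL (δ 1) (wordCount w 1) (μ 1)) :
    pairing δ n μ (wordJoin δ μ w x₀ x₁) (wordJoin δ μ w y₀ y₁) = form x₀ y₀ * form x₁ y₁ := by
  rw [pairing_apply, wordJoin, flipLin_joinLin, mulLin_joinLin _ _ _ 0 1 (δ := δ)
    (δ₀ := fun _ => δ 0) (δ₁ := fun _ => δ 1) rfl rfl, ← elim_finSumFinEquiv_symm, ← Diagram.join_id, coeff_joinLin]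
  rfl

theorem pairing_wordJoin_of_ne {w w' : Fin n → Fin 2} (h : w ≠ w')
    (x₀ : TL (δ 0) (wordCount w 0) (μ 0)) (x₁ : TL (δ 1) (wordCount w 1) (μ 1))
    (y₀ : TL (δ 0) (wordCount w' 0) (μ 0)) (y₁ : TL (δ 1) (wordCount w' 1) (μ 1)) :
    pairing δ n μ (wordJoin δ μ w x₀ x₁) (wordJoin δ μ w' y₀ y₁) = 0 := by
  rw [pairing_apply, wordJoin, flipLin_joinLin, wordJoin, mulLin_joinLin_of_ne, map_zero]
  rwa [elim_wordSplit_symm, elim_wordSplit_symm]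

end Words

/-! ### The cell modules in coordinates -/

section Cell

open Matrix

variable {δ : Fin 2 → ℂ} {n : ℕ} {μ ν : Fin 2 → ℕ}

local notation:70 x:70 " ⬝ " y:71 => mulLin (fun _ : Unit => _) x y

variable (δ n μ) in
/-- The class of a combination of diagrams in the cell module. -/
noncomputable def toCell : upperSpan δ n μ →ₗ[ℂ] CellModule δ n μ where
  toFun x := Submodule.Quotient.mk ⟨x.1, mem_upperModule_iff.2 x.2⟩
  map_add' _ _ := rfl
  map_smul' _ _ := rfl

theorem toCell_eq_zero_iff {x : upperSpan δ n μ} : toCell δ n μ x = 0 ↔ x.1 ∈ lowerSpan δ n μ := by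
  rw [← mem_lowerModule_iff]
  exact Submodule.Quotient.mk_eq_zero _

theorem toCell_surjective : Function.Surjective (toCell δ n μ) := by
  intro y
  induction y using Submodule.Quotient.induction_on with | _ y
  exact ⟨⟨y.1, mem_upperModule_iff.1 y.2⟩, rfl⟩

theorem smul_toCell (a : bubbleAlgebra δ n) (x : upperSpan δ n μ) :
    a • toCell δ n μ x = toCell δ n μ ⟨mulLin δ a.1 x.1, smul_mem_upperSpan a x.2⟩ := rfl

theorem cellForm_toCell (x y : upperSpan δ n μ) :
    cellForm δ n μ (toCell δ n μ x) (toCell δ n μ y) = pairing δ n μ x.1 y.1 := rfl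

theorem toCell_eq_iff {x y : upperSpan δ n μ} :
    toCell δ n μ x = toCell δ n μ y ↔ x.1 - y.1 ∈ lowerSpan δ n μ := by
  rw [← sub_eq_zero, ← map_sub, toCell_eq_zero_iff]
  rfl

variable (n μ) in
/-- Coordinates of the elements of a cell module: for each colouring of the top row, a matrix which is
indexed by pairs of half-diagrams. -/
abbrev CellMatrix : Type := ∀ w : Fin n → Fin 2,
  Matrix (HalfDiagram (wordCount w 0) (μ 0)) (HalfDiagram (wordCount w 1) (μ 1)) ℂ

variable (δ) in
/-- The combination of diagrams with given coordinates. -/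
noncomputable def cellRep (z : CellMatrix n μ) : DiagramSpace δ (Fin n) (Fin (μ 0 + μ 1)) :=
  ∑ w, ∑ i, ∑ j, z w i j • wordJoin δ μ w (halfVec (δ 0) i) (halfVec (δ 1) j)

theorem cellRep_mem (z : CellMatrix n μ) : cellRep δ z ∈ upperSpan δ n μ :=
  sum_mem fun _ _ => sum_mem fun i _ => sum_mem fun j _ =>
    Submodule.smul_mem _ _ (wordJoin_mem (halfVec_mem i) (halfVec_mem j))

variable (δ n μ) in
/-- The coordinates of a combination of diagrams. -/
noncomputable def coords : DiagramSpace δ (Fin n) (Fin (μ 0 + μ 1)) →ₗ[ℂ] CellMatrix n μ where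
  toFun x w := Matrix.of fun i j =>
    coeff δ (Diagram.join (wordSplit w) finSumFinEquiv 0 1 i.1 j.1) x
  map_add' x y := by
    funext w
    ext i j
    simp
  map_smul' r x := by
    funext w
    ext i j
    simp

theorem coords_wordJoin (w : Fin n → Fin 2) (x₀ : TL (δ 0) (wordCount w 0) (μ 0))
    (x₁ : TL (δ 1) (wordCount w 1) (μ 1)) (i : HalfDiagram (wordCount w 0) (μ 0))
    (j : HalfDiagram (wordCount w 1) (μ 1)) :
    coords δ n μ (wordJoin δ μ w x₀ x₁) w i j = coeff _ i.1 x₀ * coeff _ j.1 x₁ :=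
  coeff_joinLin _ _ _ _ _ _ _ _

theorem coords_wordJoin_of_ne {w w' : Fin n → Fin 2} (h : w ≠ w')
    (x₀ : TL (δ 0) (wordCount w' 0) (μ 0)) (x₁ : TL (δ 1) (wordCount w' 1) (μ 1)) :
    coords δ n μ (wordJoin δ μ w' x₀ x₁) w = 0 := by
  ext i j
  have htop : ∀ {x₀ : TL (δ 0) (wordCount w' 0) (μ 0)} {x₁ : TL (δ 1) (wordCount w' 1) (μ 1)},
      wordJoin δ μ w' x₀ x₁ ∈ diagramSpan δ fun d => ∀ x, d.colour (.inl x) = w' x := by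
    intro x₀ x₁
    have hall : ∀ {a b : ℕ} {c : ℂ} (x : TL c a b), x ∈ diagramSpan _ fun _ => True := by
      intro a b c x
      induction x using space_induction with
      | h0 => exact zero_mem _
      | hadd _ _ h h' => exact add_mem h h'
      | hs y e => exact Submodule.smul_mem _ _ (single_mem_diagramSpan trivial)
    refine joinLin_induction LinearMap.id (fun _ _ _ _ => single_mem_diagramSpan fun x => ?_)
      (hall x₀) (hall x₁)
    rw [join_colour_inl]
    exact congrFun (elim_wordSplit_symm w') x
  refine coeff_eq_zero_of_mem htop fun hc => h (funext fun x => ?_)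
  rw [← hc x, join_colour_inl]
  exact (congrFun (elim_wordSplit_symm w) x).symm

theorem coords_lowerSpan {x : DiagramSpace δ (Fin n) (Fin (μ 0 + μ 1))}
    (hx : x ∈ lowerSpan δ n μ) : coords δ n μ x = 0 := by
  funext w
  ext i j
  refine coeff_eq_zero_of_mem hx fun h => ?_
  obtain h | h := Diagram.hasArc_join.1 h.2
  · exact i.2.2 h
  · exact j.2.2 h

theorem coords_cellRep (z : CellMatrix n μ) : coords δ n μ (cellRep δ z) = z := by
  classical
  funext w
  ext x y
  rw [cellRep, map_sum, Finset.sum_apply, Finset.sum_eq_single w]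
  · simp only [map_sum, map_smul, Finset.sum_apply, Pi.smul_apply, Matrix.sum_apply,
      Matrix.smul_apply, coords_wordJoin, coeff_halfVec, smul_eq_mul]
    simp
  · intro w' _ hw'
    simp only [map_sum, map_smul, Finset.sum_apply, Pi.smul_apply,
      coords_wordJoin_of_ne (Ne.symm hw'), smul_zero, Finset.sum_const_zero]
  · simp

theorem cellRep_add (z z' : CellMatrix n μ) : cellRep δ (z + z') = cellRep δ z + cellRep δ z' := by
  simp only [cellRep, Pi.add_apply, Matrix.add_apply, add_smul, Finset.sum_add_distrib]

theorem cellRep_smul (r : ℂ) (z : CellMatrix n μ) : cellRep δ (r • z) = r • cellRep δ z := by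
  simp only [cellRep, Pi.smul_apply, Matrix.smul_apply, smul_assoc, Finset.smul_sum]

/-- The sums in `cellRep` factor on matrices of rank one. -/
theorem cellRep_coords_wordJoin (w : Fin n → Fin 2) (x₀ : TL (δ 0) (wordCount w 0) (μ 0))
    (x₁ : TL (δ 1) (wordCount w 1) (μ 1)) :
    cellRep δ (coords δ n μ (wordJoin δ μ w x₀ x₁)) =
      wordJoin δ μ w (halfComb _ _ _ (halfCoeff _ _ _ x₀)) (halfComb _ _ _ (halfCoeff _ _ _ x₁)) := by
  rw [cellRep, Finset.sum_eq_single w]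
  · simp only [coords_wordJoin, halfComb_apply, map_sum, map_smul, LinearMap.sum_apply,
      LinearMap.smul_apply, halfCoeff_apply, Finset.smul_sum, smul_smul]
    rw [Finset.sum_comm]
    refine Finset.sum_congr rfl fun i _ => Finset.sum_congr rfl fun j _ => ?_
    rw [mul_comm]
  · intro w' _ hw'
    simp [coords_wordJoin_of_ne hw']
  · simp

theorem sub_cellRep_mem {x : DiagramSpace δ (Fin n) (Fin (μ 0 + μ 1))} (hx : x ∈ upperSpan δ n μ) :
    x - cellRep δ (coords δ n μ x) ∈ lowerSpan δ n μ := by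
  let R : CellMatrix n μ →ₗ[ℂ] DiagramSpace δ (Fin n) (Fin (μ 0 + μ 1)) :=
    ⟨⟨cellRep δ, cellRep_add⟩, cellRep_smul⟩
  refine upperSpan_map (LinearMap.id - R ∘ₗ coords δ n μ) (fun w x₀ h₀ x₁ h₁ => ?_) hx
  change wordJoin δ μ w x₀ x₁ - cellRep δ (coords δ n μ (wordJoin δ μ w x₀ x₁)) ∈ _
  rw [cellRep_coords_wordJoin]
  have e := add_mem (wordJoin_mem_left (sub_halfComb_mem h₀) h₁)
    (wordJoin_mem_right (halfComb_mem (halfCoeff _ _ _ x₀)) (sub_halfComb_mem h₁))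
  rw [map_sub, LinearMap.sub_apply, map_sub, sub_add_sub_cancel] at e
  exact e

variable (δ n μ) in
/-- The element of the cell module with given coordinates. -/
noncomputable def cellOf (z : CellMatrix n μ) : CellModule δ n μ :=
  toCell δ n μ ⟨cellRep δ z, cellRep_mem z⟩

theorem cellOf_add (z z' : CellMatrix n μ) :
    cellOf δ n μ (z + z') = cellOf δ n μ z + cellOf δ n μ z' := by
  rw [cellOf, cellOf, cellOf, ← map_add]
  exact congrArg _ (Subtype.ext (cellRep_add z z'))

theorem toCell_eq_cellOf (x : upperSpan δ n μ) : toCell δ n μ x = cellOf δ n μ (coords δ n μ x.1) :=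
  toCell_eq_iff.2 (sub_cellRep_mem x.2)

theorem cellOf_surjective : Function.Surjective (cellOf δ n μ) := fun y => by
  obtain ⟨x, rfl⟩ := toCell_surjective y
  exact ⟨_, (toCell_eq_cellOf x).symm⟩

theorem cellOf_injective : Function.Injective (cellOf δ n μ) := fun z z' h => by
  have h1 := coords_lowerSpan (toCell_eq_iff.1 h)
  rwa [map_sub, coords_cellRep, coords_cellRep, sub_eq_zero] at h1

theorem pairing_cellRep (w : Fin n → Fin 2) (i : HalfDiagram (wordCount w 0) (μ 0))
    (j : HalfDiagram (wordCount w 1) (μ 1)) (z : CellMatrix n μ) :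
    pairing δ n μ (wordJoin δ μ w (halfVec _ i) (halfVec _ j)) (cellRep δ z) =
      (gram (δ 0) (wordCount w 0) (μ 0) * z w * (gram (δ 1) (wordCount w 1) (μ 1))ᵀ) i j := by
  rw [cellRep, map_sum, Finset.sum_eq_single w]
  · simp only [map_sum, map_smul, pairing_wordJoin, Matrix.mul_apply, Matrix.transpose_apply,
      smul_eq_mul, Finset.sum_mul]
    rw [Finset.sum_comm]
    refine Finset.sum_congr rfl fun k _ => Finset.sum_congr rfl fun l _ => ?_
    rw [gram, gram, Matrix.of_apply, Matrix.of_apply]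
    ring
  · intro w' _ hw'
    simp only [map_sum, map_smul, pairing_wordJoin_of_ne (Ne.symm hw'), smul_zero,
      Finset.sum_const_zero]
  · simp

/-- The radical in coordinates. -/
theorem cellOf_mem_cellRadical {z : CellMatrix n μ} : cellOf δ n μ z ∈ cellRadical δ n μ ↔
    ∀ w, gram (δ 0) (wordCount w 0) (μ 0) * z w * (gram (δ 1) (wordCount w 1) (μ 1))ᵀ = 0 := by
  constructor
  · intro h w
    ext i j
    rw [← pairing_cellRep]
    exact h (toCell δ n μ ⟨_, wordJoin_mem (halfVec_mem i) (halfVec_mem j)⟩)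
  · intro h x
    obtain ⟨z', rfl⟩ := cellOf_surjective x
    rw [cellOf, cellOf, cellForm_toCell]
    change pairing δ n μ (cellRep δ z') (cellRep δ z) = 0
    conv_lhs => enter [1, 2]; rw [cellRep]
    simp only [map_sum, map_smul, LinearMap.sum_apply, LinearMap.smul_apply, pairing_cellRep, h,
      Matrix.zero_apply, smul_zero, Finset.sum_const_zero]

/-! ### Homomorphisms of cell modules -/

/-- Right multiplication by `s` induces homomorphisms of the cell modules of one colour. -/
def IsCellHom {c : ℂ} {m k : ℕ} (s : TL c m k) : Prop :=
  s ∈ planarSpan c m k ∧ ∀ b, ∀ u ∈ arcSpan c b m, u ⬝ s ∈ arcSpan c b k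

theorem isCellHom_oneTL {c : ℂ} {m : ℕ} : IsCellHom (oneTL c m) :=
  ⟨oneTL_mem, fun b u hu => by rwa [mul_oneTL]⟩

theorem rightMatrix_oneTL {c : ℂ} {a m : ℕ} : rightMatrix a (oneTL c m) = 1 := by
  ext x y
  rw [rightMatrix, Matrix.of_apply, mul_oneTL, coeff_halfVec, Matrix.one_apply]

/-- Right multiplication commutes with the bubble algebra. -/
noncomputable def rightMul {Y Z : Type} [Finite Y] [Finite Z] (F : DiagramSpace δ Y Z) :
    DiagramSpace δ (Fin n) Y →ₗ[bubbleAlgebra δ n] DiagramSpace δ (Fin n) Z where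
  toFun x := mulLin δ x F
  map_add' x y := by rw [map_add, LinearMap.add_apply]
  map_smul' a x := mulLin_assoc a.1 x F

variable {s₀ : TL (δ 0) (μ 0) (ν 0)} {s₁ : TL (δ 1) (μ 1) (ν 1)}

variable (s₀ s₁) in
/-- Two elements, drawn next to each other in the two colours. -/
noncomputable def pairJoin : DiagramSpace δ (Fin (μ 0 + μ 1)) (Fin (ν 0 + ν 1)) :=
  joinLin finSumFinEquiv finSumFinEquiv 0 1 δ _ _ s₀ s₁

theorem wordJoin_mul_pairJoin (w : Fin n → Fin 2) (x₀ : TL (δ 0) (wordCount w 0) (μ 0))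
    (x₁ : TL (δ 1) (wordCount w 1) (μ 1)) :
    mulLin δ (wordJoin δ μ w x₀ x₁) (pairJoin s₀ s₁) = wordJoin δ ν w (x₀ ⬝ s₀) (x₁ ⬝ s₁) :=
  mulLin_joinLin _ _ _ 0 1 (δ := δ) (δ₀ := fun _ => δ 0) (δ₁ := fun _ => δ 1) rfl rfl _ _ _ _

theorem mul_pairJoin_mem (h₀ : IsCellHom s₀) (h₁ : IsCellHom s₁)
    {x : DiagramSpace δ (Fin n) (Fin (μ 0 + μ 1))} (hx : x ∈ upperSpan δ n μ) :
    mulLin δ x (pairJoin s₀ s₁) ∈ upperSpan δ n ν := by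
  refine upperSpan_map ((mulLin δ).flip (pairJoin s₀ s₁)) (fun w x₀ k₀ x₁ k₁ => ?_) hx
  rw [LinearMap.flip_apply, wordJoin_mul_pairJoin]
  exact wordJoin_mem (mul_mem k₀ h₀.1) (mul_mem k₁ h₁.1)

theorem mul_pairJoin_mem_lower (h₀ : IsCellHom s₀) (h₁ : IsCellHom s₁)
    {x : DiagramSpace δ (Fin n) (Fin (μ 0 + μ 1))} (hx : x ∈ lowerSpan δ n μ) :
    mulLin δ x (pairJoin s₀ s₁) ∈ lowerSpan δ n ν := by
  refine lowerSpan_map ((mulLin δ).flip (pairJoin s₀ s₁)) (fun w x₀ k₀ x₁ k₁ => ?_)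
    (fun w x₀ k₀ x₁ k₁ => ?_) hx
  · rw [LinearMap.flip_apply, wordJoin_mul_pairJoin]
    exact wordJoin_mem_left (h₀.2 _ _ k₀) (mul_mem k₁ h₁.1)
  · rw [LinearMap.flip_apply, wordJoin_mul_pairJoin]
    exact wordJoin_mem_right (mul_mem k₀ h₀.1) (h₁.2 _ _ k₁)

variable (n) in
/-- The homomorphism of cell modules which is induced by right multiplication. -/
noncomputable def cellHom (h₀ : IsCellHom s₀) (h₁ : IsCellHom s₁) :
    CellModule δ n μ →ₗ[bubbleAlgebra δ n] CellModule δ n ν :=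
  Submodule.mapQ _ _
    ((rightMul (pairJoin s₀ s₁)).restrict fun _ hx =>
      mem_upperModule_iff.2 (mul_pairJoin_mem h₀ h₁ (mem_upperModule_iff.1 hx)))
    fun _ hx => mem_lowerModule_iff.2 (mul_pairJoin_mem_lower h₀ h₁ (mem_lowerModule_iff.1 hx))

theorem cellHom_toCell (h₀ : IsCellHom s₀) (h₁ : IsCellHom s₁) (x : upperSpan δ n μ) :
    cellHom n h₀ h₁ (toCell δ n μ x) =
      toCell δ n ν ⟨mulLin δ x.1 (pairJoin s₀ s₁), mul_pairJoin_mem h₀ h₁ x.2⟩ := rfl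

theorem cellHom_cellOf (h₀ : IsCellHom s₀) (h₁ : IsCellHom s₁) (z : CellMatrix n μ) :
    cellHom n h₀ h₁ (cellOf δ n μ z) =
      cellOf δ n ν fun w => rightMatrix (wordCount w 0) s₀ * z w * (rightMatrix (wordCount w 1) s₁)ᵀ := by
  rw [cellOf, cellHom_toCell, toCell_eq_cellOf]
  congr 1
  funext w
  ext x y
  change coords δ n ν (mulLin δ (cellRep δ z) (pairJoin s₀ s₁)) w x y = _
  rw [cellRep, map_sum, LinearMap.sum_apply, map_sum, Finset.sum_apply, Finset.sum_eq_single w]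
  · simp only [map_sum, map_smul, LinearMap.sum_apply, LinearMap.smul_apply, Finset.sum_apply,
      Pi.smul_apply, Matrix.sum_apply, Matrix.smul_apply, wordJoin_mul_pairJoin, coords_wordJoin,
      Matrix.mul_apply, Matrix.transpose_apply, smul_eq_mul, Finset.sum_mul]
    rw [Finset.sum_comm]
    refine Finset.sum_congr rfl fun k _ => Finset.sum_congr rfl fun l _ => ?_
    rw [rightMatrix, rightMatrix, Matrix.of_apply, Matrix.of_apply]
    ring
  · intro w' _ hw'
    simp only [map_sum, map_smul, LinearMap.sum_apply, LinearMap.smul_apply, Finset.sum_apply,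
      Pi.smul_apply, wordJoin_mul_pairJoin, coords_wordJoin_of_ne (Ne.symm hw'), smul_zero,
      Finset.sum_const_zero]
  · simp

/-! ### Generators of the cell modules -/

theorem mulLin_flip_mem {x y : DiagramSpace δ (Fin n) (Fin (μ 0 + μ 1))}
    (hx : x ∈ upperSpan δ n μ) (hy : y ∈ upperSpan δ n μ) :
    mulLin δ x (flipLin δ y) ∈ bubbleAlgebra δ n := by
  refine upperSpan_map ((mulLin δ).flip (flipLin δ y))
    (S := Subalgebra.toSubmodule (bubbleAlgebra δ n)) (fun w x₀ h₀ x₁ h₁ => ?_) hx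
  refine upperSpan_map (mulLin δ (wordJoin δ μ w x₀ x₁) ∘ₗ flipLin δ)
    (S := Subalgebra.toSubmodule (bubbleAlgebra δ n)) (fun w' y₀ k₀ y₁ k₁ => ?_) hy
  rw [LinearMap.comp_apply, wordJoin, wordJoin, flipLin_joinLin,
    mulLin_joinLin _ _ _ 0 1 (δ := δ) (δ₀ := fun _ => δ 0) (δ₁ := fun _ => δ 1) rfl rfl]
  exact wordJoin₂_mem (mul_mem h₀ (flip_mem k₀)) (mul_mem h₁ (flip_mem k₁))

theorem mul_flip_mul_sub_mem {c : ℂ} {a b k : ℕ} {z : TL c b k} {x y : TL c a k}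
    (hz : z ∈ planarSpan c b k) (hx : x ∈ planarSpan c a k) (hy : y ∈ planarSpan c a k) :
    z ⬝ flipLin _ y ⬝ x - form y x • z ∈ arcSpan c b k := by
  have := mul_mem_arc hz (sub_coeffOne_smul_mem (mul_mem (flip_mem hy) hx))
  rwa [map_sub, map_smul, mul_oneTL, ← mulLin_assoc] at this

/-- The defining property of a cellular basis. -/
theorem mulLin_flip_mulLin_sub_mem {x y z : DiagramSpace δ (Fin n) (Fin (μ 0 + μ 1))}
    (hz : z ∈ upperSpan δ n μ) (hy : y ∈ upperSpan δ n μ) (hx : x ∈ upperSpan δ n μ) :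
    mulLin δ (mulLin δ z (flipLin δ y)) x - pairing δ n μ y x • z ∈ lowerSpan δ n μ := by
  refine upperSpan_map ((mulLin δ).flip x ∘ₗ (mulLin δ).flip (flipLin δ y) -
    pairing δ n μ y x • LinearMap.id) (fun w z₀ h₀ z₁ h₁ => ?_) hz
  change mulLin δ (mulLin δ (wordJoin δ μ w z₀ z₁) (flipLin δ y)) x -
    pairing δ n μ y x • wordJoin δ μ w z₀ z₁ ∈ _
  set z := wordJoin δ μ w z₀ z₁ with hz
  refine upperSpan_map ((mulLin δ).flip x ∘ₗ mulLin δ z ∘ₗ flipLin δ -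
    ((pairing δ n μ).flip x).smulRight z) (fun w' y₀ k₀ y₁ k₁ => ?_) hy
  change mulLin δ (mulLin δ z (flipLin δ (wordJoin δ μ w' y₀ y₁))) x -
    pairing δ n μ (wordJoin δ μ w' y₀ y₁) x • z ∈ _
  set y := wordJoin δ μ w' y₀ y₁ with hy
  refine upperSpan_map (mulLin δ (mulLin δ z (flipLin δ y)) -
    (pairing δ n μ y).smulRight z) (fun w'' x₀ l₀ x₁ l₁ => ?_) hx
  change mulLin δ (mulLin δ z (flipLin δ y)) (wordJoin δ μ w'' x₀ x₁) -
    pairing δ n μ y (wordJoin δ μ w'' x₀ x₁) • z ∈ _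
  have e : mulLin δ z (flipLin δ y) =
      wordJoin₂ δ w w' (z₀ ⬝ flipLin _ y₀) (z₁ ⬝ flipLin _ y₁) := by
    rw [hz, hy, wordJoin, wordJoin, flipLin_joinLin,
      mulLin_joinLin _ _ _ 0 1 (δ := δ) (δ₀ := fun _ => δ 0) (δ₁ := fun _ => δ 1) rfl rfl]
    rfl
  by_cases h : w' = w''
  · subst h
    rw [e, wordJoin₂_mul_wordJoin, hy, pairing_wordJoin, hz]
    have m := add_mem (wordJoin_mem_left (mul_flip_mul_sub_mem h₀ l₀ k₀)
      (mul_mem (mul_mem h₁ (flip_mem k₁)) l₁))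
      (wordJoin_mem_right (Submodule.smul_mem _ (form y₀ x₀) h₀) (mul_flip_mul_sub_mem h₁ l₁ k₁))
    rw [map_sub, LinearMap.sub_apply, map_sub, sub_add_sub_cancel, map_smul, map_smul,
      LinearMap.smul_apply, smul_smul, mul_comm] at m
    exact m
  · rw [e, wordJoin₂_mul_wordJoin_of_ne h, hy, pairing_wordJoin_of_ne h, zero_smul, sub_zero]
    exact zero_mem _

/-- An element outside the radical generates the cell module. -/
theorem exists_smul_eq {x : CellModule δ n μ} (hx : x ∉ cellRadical δ n μ) (z : CellModule δ n μ) :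
    ∃ a : bubbleAlgebra δ n, a • x = z := by
  have hx' : ∃ y, cellForm δ n μ y x ≠ 0 := by
    by_contra! h
    exact hx h
  obtain ⟨y, hy⟩ := hx'
  obtain ⟨x, rfl⟩ := toCell_surjective x
  obtain ⟨y, rfl⟩ := toCell_surjective y
  obtain ⟨z, rfl⟩ := toCell_surjective z
  rw [cellForm_toCell] at hy
  refine ⟨(pairing δ n μ y.1 x.1)⁻¹ • ⟨_, mulLin_flip_mem z.2 y.2⟩, ?_⟩
  rw [smul_toCell, toCell_eq_iff]
  have h := Submodule.smul_mem _ (pairing δ n μ y.1 x.1)⁻¹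
    (mulLin_flip_mulLin_sub_mem z.2 y.2 x.2)
  rw [smul_sub, smul_smul, inv_mul_cancel₀ hy, one_smul] at h
  convert h using 2
  change mulLin δ ((pairing δ n μ y.1 x.1)⁻¹ • mulLin δ z.1 (flipLin δ y.1)) x.1 = _
  rw [map_smul, LinearMap.smul_apply]

variable (δ) in
/-- The identity diagram with colouring `w`. -/
noncomputable def wordIdem (w : Fin n → Fin 2) : bubbleAlgebra δ n :=
  ⟨wordJoin₂ δ w w (oneTL _ _) (oneTL _ _), wordJoin₂_mem oneTL_mem oneTL_mem⟩

theorem exists_not_mem_cellRadical {w : Fin n → Fin 2} (h₀ : gram (δ 0) (wordCount w 0) (μ 0) ≠ 0)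
    (h₁ : gram (δ 1) (wordCount w 1) (μ 1) ≠ 0) :
    ∃ x ∉ cellRadical δ n μ, wordIdem δ w • x = x := by
  have hne : ∀ {c : ℂ} {a k : ℕ}, gram c a k ≠ 0 → ∃ x y, gram c a k x y ≠ 0 := by
    intro c a k h
    by_contra! h'
    exact h (by ext x y; exact h' x y)
  obtain ⟨i, i', hi⟩ := hne h₀
  obtain ⟨j, j', hj⟩ := hne h₁
  refine ⟨toCell δ n μ ⟨_, wordJoin_mem (w := w) (halfVec_mem i') (halfVec_mem j')⟩,
    fun h => mul_ne_zero hi hj ?_, ?_⟩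
  · have := h (toCell δ n μ ⟨_, wordJoin_mem (w := w) (halfVec_mem i) (halfVec_mem j)⟩)
    rwa [cellForm_toCell, pairing_wordJoin] at this
  · rw [smul_toCell]
    congr 2
    exact (wordJoin₂_mul_wordJoin _ _ _ _ _ _).trans (by rw [oneTL_mul, oneTL_mul])

theorem wordIdem_smul_eq_zero {w : Fin n → Fin 2}
    (h : wordCount w 0 < μ 0 ∨ wordCount w 1 < μ 1) (x : CellModule δ n μ) :
    wordIdem δ w • x = 0 := by
  obtain ⟨x, rfl⟩ := toCell_surjective x
  rw [smul_toCell, toCell_eq_zero_iff]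
  refine upperSpan_map (mulLin δ _) (fun w' x₀ h₀ x₁ h₁ => ?_) x.2
  by_cases e : w = w'
  · subst e
    change mulLin δ (wordJoin₂ δ w w _ _) _ ∈ _
    rw [wordJoin₂_mul_wordJoin, oneTL_mul, oneTL_mul]
    obtain h | h := h
    · exact wordJoin_mem_left (mem_arc_of_lt h h₀) h₁
    · exact wordJoin_mem_right h₀ (mem_arc_of_lt h h₁)
  · change mulLin δ (wordJoin₂ δ w w _ _) _ ∈ _
    rw [wordJoin₂_mul_wordJoin_of_ne e]
    exact zero_mem _

theorem subsingleton_cellModule (h : n < μ 0 + μ 1) : Subsingleton (CellModule δ n μ) := by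
  refine ⟨fun x y => ?_⟩
  obtain ⟨z, rfl⟩ := cellOf_surjective x
  obtain ⟨z', rfl⟩ := cellOf_surjective y
  congr 1
  funext w
  ext i j
  have h₀ := i.le
  have h₁ := j.le
  have := wordCount_add w
  omega

end Cell

/-! ### The radical series of a module with a diamond of submodules -/

section Diamond

variable {R M M₀ M₁ M' : Type} [Ring R] [AddCommGroup M] [Module R M] [AddCommGroup M₀] [Module R M₀]
  [AddCommGroup M₁] [Module R M₁] [AddCommGroup M'] [Module R M']

/-- The intersection of the maximal submodules of a submodule. -/
def radStep (N : Submodule R M) : Submodule R M := (Module.jacobson R N).map N.subtype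

theorem radicalSeries_succ (k : ℕ) :
    radicalSeries R M (k + 1) = radStep (radicalSeries R M k) := rfl

theorem radStep_le (N : Submodule R M) : radStep N ≤ N := Submodule.map_subtype_le _ _

theorem radStep_top : radStep (⊤ : Submodule R M) = Module.jacobson R M :=
  Module.map_jacobson_of_bijective (f := (⊤ : Submodule R M).subtype)
    ⟨Subtype.val_injective, fun x => ⟨⟨x, trivial⟩, rfl⟩⟩

theorem radStep_eq_bot {N : Submodule R M} (f : N →ₗ[R] M') (hf : Function.Injective f)
    (h : Module.jacobson R M' = ⊥) : radStep N = ⊥ := by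
  rw [radStep, Module.jacobson_eq_bot_of_injective f hf h, Submodule.map_bot]

theorem jacobson_prod_eq_bot (h₀ : Module.jacobson R M₀ = ⊥) (h₁ : Module.jacobson R M₁ = ⊥) :
    Module.jacobson R (M₀ × M₁) = ⊥ := by
  rw [eq_bot_iff]
  intro x hx
  have e₀ := Module.le_comap_jacobson (LinearMap.fst R M₀ M₁) hx
  have e₁ := Module.le_comap_jacobson (LinearMap.snd R M₀ M₁) hx
  rw [h₀] at e₀
  rw [h₁] at e₁
  exact Prod.ext e₀ e₁

/-- If a submodule `N` is the sum of the images of two modules, whose intersection is the image of a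
third one, and the preimages of the intersection are the radicals, then `N` is an extension of the sum
of the first two heads by the third one. -/
theorem exists_exact_of_diamond {N : Submodule R M} {F₀ : M₀ →ₗ[R] M} {F₁ : M₁ →ₗ[R] M}
    {F : M' →ₗ[R] M} (hsup : LinearMap.range F₀ ⊔ LinearMap.range F₁ = N)
    (hinf : LinearMap.range F₀ ⊓ LinearMap.range F₁ = LinearMap.range F)
    (h₀ : (LinearMap.range F).comap F₀ = Module.jacobson R M₀)
    (h₁ : (LinearMap.range F).comap F₁ = Module.jacobson R M₁)
    (hker : LinearMap.ker F = Module.jacobson R M') :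
    ∃ (f : (M' ⧸ Module.jacobson R M') →ₗ[R] N)
      (g : N →ₗ[R] (M₀ ⧸ Module.jacobson R M₀) × (M₁ ⧸ Module.jacobson R M₁)),
      Function.Injective f ∧ Function.Exact f g ∧ Function.Surjective g ∧
        (LinearMap.range f).map N.subtype = LinearMap.range F := by
  have hF₀ : ∀ x, F₀ x ∈ N := fun x => hsup.le (Submodule.mem_sup_left ⟨x, rfl⟩)
  have hF₁ : ∀ x, F₁ x ∈ N := fun x => hsup.le (Submodule.mem_sup_right ⟨x, rfl⟩)
  have hF : ∀ x, F x ∈ N := fun x => by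
    obtain ⟨y, hy⟩ := (hinf.ge ⟨x, rfl⟩).1
    rw [← hy]
    exact hF₀ y
  let f : (M' ⧸ Module.jacobson R M') →ₗ[R] N :=
    (Module.jacobson R M').liftQ (F.codRestrict N hF) (by rw [LinearMap.ker_codRestrict, hker])
  let h : M₀ × M₁ →ₗ[R] N :=
    (F₀.coprod F₁).codRestrict N fun x => add_mem (hF₀ x.1) (hF₁ x.2)
  have hh : ∀ x, (h x : M) = F₀ x.1 + F₁ x.2 := fun x => rfl
  have hsurj : Function.Surjective h := by
    rintro ⟨y, hy⟩
    rw [← hsup, Submodule.mem_sup] at hy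
    obtain ⟨_, ⟨u, rfl⟩, _, ⟨v, rfl⟩, rfl⟩ := hy
    exact ⟨(u, v), rfl⟩
  let p : M₀ × M₁ →ₗ[R] (M₀ ⧸ Module.jacobson R M₀) × (M₁ ⧸ Module.jacobson R M₁) :=
    (Module.jacobson R M₀).mkQ.prodMap (Module.jacobson R M₁).mkQ
  have hp : ∀ x, p x = 0 ↔ F₀ x.1 ∈ LinearMap.range F ∧ F₁ x.2 ∈ LinearMap.range F := by
    intro x
    rw [← Submodule.mem_comap, ← Submodule.mem_comap, h₀, h₁, Prod.ext_iff]
    exact and_congr (Submodule.Quotient.mk_eq_zero _) (Submodule.Quotient.mk_eq_zero _)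
  have hle : LinearMap.ker h ≤ LinearMap.ker p := by
    intro x hx
    have e : F₀ x.1 + F₁ x.2 = 0 := congrArg Subtype.val (LinearMap.mem_ker.1 hx)
    have e' : F₀ x.1 = F₁ (-x.2) := by rw [map_neg, eq_neg_iff_add_eq_zero, e]
    have m : F₀ x.1 ∈ LinearMap.range F := hinf.le ⟨⟨_, rfl⟩, ⟨_, e'.symm⟩⟩
    rw [LinearMap.mem_ker, hp]
    refine ⟨m, ?_⟩
    rwa [← neg_mem_iff, ← map_neg, ← e']
  obtain ⟨g, hg⟩ : ∃ g : N →ₗ[R] (M₀ ⧸ Module.jacobson R M₀) × (M₁ ⧸ Module.jacobson R M₁),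
      ∀ x, g (h x) = p x := by
    refine ⟨(LinearMap.ker h).liftQ p hle ∘ₗ (h.quotKerEquivOfSurjective hsurj).symm.toLinearMap,
      fun x => ?_⟩
    have e : (h.quotKerEquivOfSurjective hsurj).symm (h x) = Submodule.Quotient.mk x := by
      rw [LinearEquiv.symm_apply_eq]
      rfl
    rw [LinearMap.comp_apply, LinearEquiv.coe_coe, e]
    rfl
  have hrange : (LinearMap.range f).map N.subtype = LinearMap.range F := by
    rw [Submodule.range_liftQ, ← LinearMap.range_comp]
    rfl
  have hmem : ∀ y : N, y ∈ LinearMap.range f ↔ (y : M) ∈ LinearMap.range F := by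
    intro y
    rw [← hrange]
    refine ⟨fun h => ⟨y, h, rfl⟩, ?_⟩
    rintro ⟨y', h, e⟩
    rwa [← Subtype.ext e]
  refine ⟨f, g, ?_, fun y => ?_, fun y => ?_, hrange⟩
  · rw [← LinearMap.ker_eq_bot]
    exact Submodule.ker_liftQ_eq_bot _ _ _ (by rw [LinearMap.ker_codRestrict, hker])
  · obtain ⟨x, rfl⟩ := hsurj y
    rw [hg, hp]
    refine Iff.trans ?_ (hmem _).symm
    rw [hh]
    refine ⟨fun e => add_mem e.1 e.2, fun e => ?_⟩
    have m := hinf.ge e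
    have m₀ : F₀ x.1 ∈ LinearMap.range F := hinf.le ⟨⟨_, rfl⟩, by
      have := sub_mem m.2 (LinearMap.mem_range_self F₁ x.2)
      rwa [add_sub_cancel_right] at this⟩
    exact ⟨m₀, by simpa using sub_mem e m₀⟩
  · obtain ⟨⟨u, hu⟩, ⟨v, hv⟩⟩ := (⟨(Module.jacobson R M₀).mkQ_surjective y.1,
      (Module.jacobson R M₁).mkQ_surjective y.2⟩ : (∃ u, _ = y.1) ∧ ∃ v, _ = y.2)
    exact ⟨h (u, v), (hg _).trans (Prod.ext hu hv)⟩

/-- The image of `f` lies in every maximal submodule of `N` if some element of `R` separates a generator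
of the first module from the third one. -/
theorem range_le_radStep {N : Submodule R M} {F₀ : M₀ →ₗ[R] M} {F : M' →ₗ[R] M}
    (hle : LinearMap.range F ≤ LinearMap.range F₀) (hN : LinearMap.range F₀ ≤ N)
    (h : Subsingleton M' ∨ ∃ (e : R) (x : M₀), (∀ z, ∃ a : R, a • x = z) ∧ e • x = x ∧
      ∀ m : M', e • m = 0) :
    LinearMap.range F ≤ radStep N := by
  obtain h | ⟨e, x, hgen, hex, he⟩ := h
  · rintro _ ⟨m, rfl⟩
    rw [Subsingleton.elim m 0, map_zero]
    exact zero_mem _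
  rintro _ ⟨m, rfl⟩
  have hFN : ∀ m, F m ∈ N := fun m => hN (hle ⟨m, rfl⟩)
  refine ⟨⟨F m, hFN m⟩, ?_, rfl⟩
  rw [SetLike.mem_coe, Module.jacobson, Submodule.mem_sInf]
  intro P hP
  by_contra hm
  -- The maximal submodule `P` and the image of `F` generate `N`; the element `e` kills the latter.
  let y : N := ⟨F₀ x, hN ⟨x, rfl⟩⟩
  have htop : P ⊔ LinearMap.range (F.codRestrict N hFN) = ⊤ :=
    hP.2 _ (left_lt_sup.2 fun hle' => hm (hle' ⟨m, rfl⟩))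
  have hy : y ∈ P ⊔ LinearMap.range (F.codRestrict N hFN) := htop.ge trivial
  obtain ⟨a, ha, _, ⟨b, rfl⟩, hab⟩ := Submodule.mem_sup.1 hy
  have hey : e • y = y := Subtype.ext (by
    change e • F₀ x = F₀ x
    rw [← map_smul, hex])
  have heb : e • F.codRestrict N hFN b = 0 := by
    rw [← map_smul, he, map_zero]
  have hyP : y ∈ P := by
    rw [← hey, ← hab, smul_add, heb, add_zero]
    exact P.smul_mem e ha
  obtain ⟨z, hz⟩ := hle ⟨m, rfl⟩
  obtain ⟨r, rfl⟩ := hgen z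
  refine hm ?_
  have : (⟨F m, hFN m⟩ : N) = r • y := Subtype.ext (show F m = r • F₀ x by
    rw [← hz, map_smul])
  rw [this]
  exact P.smul_mem r hyP

end Diamond

/-! ### Linear algebra of the diamond -/

section KerRange

open Matrix

variable {m m' p p' : Type} [Fintype m] [Fintype m'] [Fintype p] [Fintype p']

/-- The matrix `A` maps onto the kernel of `G`, and its kernel is that of `G'`. -/
structure IsKerRange (A : Matrix m m' ℂ) (G : Matrix m m ℂ) (G' : Matrix m' m' ℂ) : Prop where
  range : LinearMap.range A.mulVecLin = LinearMap.ker G.mulVecLin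
  ker : LinearMap.ker A.mulVecLin = LinearMap.ker G'.mulVecLin

theorem exists_mul_mul_eq (A : Matrix m m' ℂ) : ∃ B : Matrix m' m ℂ, A * B * A = A := by
  classical
  obtain ⟨g, hg⟩ := A.mulVecLin.rangeRestrict.exists_rightInverse_of_surjective
    (LinearMap.range_rangeRestrict _)
  obtain ⟨g', hg'⟩ := LinearMap.exists_extend g
  refine ⟨LinearMap.toMatrix' g', ?_⟩
  refine Matrix.toLin'.injective (LinearMap.ext fun v => ?_)
  rw [Matrix.toLin'_mul, Matrix.toLin'_mul, Matrix.toLin'_toMatrix']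
  have h1 : g' (A.mulVecLin v) = g (A.mulVecLin.rangeRestrict v) :=
    LinearMap.congr_fun hg' (A.mulVecLin.rangeRestrict v)
  have h2 := congrArg Subtype.val (LinearMap.congr_fun hg (A.mulVecLin.rangeRestrict v))
  simp only [LinearMap.comp_apply, Matrix.toLin'_apply]
  rw [Matrix.mulVecLin_apply] at h1
  rw [h1]
  exact h2

namespace IsKerRange

variable {A : Matrix m m' ℂ} {G : Matrix m m ℂ} {G' : Matrix m' m' ℂ}
  {B : Matrix p p' ℂ} {H : Matrix p p ℂ} {H' : Matrix p' p' ℂ}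

theorem exists_eq_mul {q : Type} (h : IsKerRange A G G') {z : Matrix m q ℂ} (hz : G * z = 0) :
    ∃ u : Matrix m' q ℂ, z = A * u := by
  have : ∀ j, ∃ u, A *ᵥ u = fun i => z i j := by
    intro j
    have : (fun i => z i j) ∈ LinearMap.ker G.mulVecLin := by
      rw [LinearMap.mem_ker]
      ext i
      exact congrFun (congrFun hz i) j
    rw [← h.range] at this
    exact this
  choose u hu using this
  refine ⟨Matrix.of fun i j => u j i, ?_⟩
  ext i j
  exact (congrFun (hu j) i).symm

theorem mul_eq_zero (h : IsKerRange A G G') : G * A = 0 := by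
  classical
  refine Matrix.toLin'.injective (LinearMap.ext fun v => ?_)
  have : A *ᵥ v ∈ LinearMap.ker G.mulVecLin := by
    rw [← h.range]
    exact ⟨v, rfl⟩
  rw [Matrix.toLin'_mul]
  simpa using this

theorem mul_eq_zero_iff {q : Type} (h : IsKerRange A G G') {u : Matrix m' q ℂ} :
    A * u = 0 ↔ G' * u = 0 := by
  have key : ∀ {r : Type} (C : Matrix r m' ℂ), C * u = 0 ↔ ∀ j, C *ᵥ (fun i => u i j) = 0 := by
    intro r C
    refine ⟨fun e j => funext fun i => congrFun (congrFun e i) j, fun e => ?_⟩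
    ext i j
    exact congrFun (e j) i
  rw [key, key]
  refine forall_congr' fun j => ?_
  have := SetLike.ext_iff.1 h.ker (fun i => u i j)
  simpa using this

theorem exists_eq_add (hA : IsKerRange A G G') (hB : IsKerRange B H H') {z : Matrix m p ℂ}
    (hz : G * z * Hᵀ = 0) : ∃ (u : Matrix m' p ℂ) (v : Matrix m p' ℂ), z = A * u + v * Bᵀ := by
  rw [Matrix.mul_assoc] at hz
  obtain ⟨w, hw⟩ := hA.exists_eq_mul hz
  obtain ⟨K, hK⟩ := exists_mul_mul_eq H
  have h1 : H * (z - A * (w * Kᵀ))ᵀ = 0 := by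
    rw [← Matrix.transpose_eq_zero, Matrix.transpose_mul, Matrix.transpose_transpose,
      Matrix.sub_mul, ← Matrix.mul_assoc A, ← hw, Matrix.mul_assoc, Matrix.mul_assoc,
      ← Matrix.transpose_mul, ← Matrix.transpose_mul, hK, sub_self]
  obtain ⟨v, hv⟩ := hB.exists_eq_mul h1
  refine ⟨w * Kᵀ, vᵀ, ?_⟩
  rw [← Matrix.transpose_mul, ← hv, Matrix.transpose_transpose, add_sub_cancel]

theorem mul_add_mul_eq_zero (hA : IsKerRange A G G') (hB : IsKerRange B H H') (u : Matrix m' p ℂ)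
    (v : Matrix m p' ℂ) : G * (A * u + v * Bᵀ) * Hᵀ = 0 := by
  rw [Matrix.mul_add, Matrix.add_mul, ← Matrix.mul_assoc, hA.mul_eq_zero, Matrix.zero_mul,
    Matrix.zero_mul, zero_add, Matrix.mul_assoc, Matrix.mul_assoc, ← Matrix.transpose_mul,
    hB.mul_eq_zero, Matrix.transpose_zero, Matrix.mul_zero, Matrix.mul_zero]

theorem exists_eq_mul_mul {r : Type} {A : Matrix r m' ℂ} {u : Matrix m' p ℂ} {v : Matrix r p' ℂ}
    (h : A * u = v * Bᵀ) : ∃ x : Matrix m' p' ℂ, A * u = A * x * Bᵀ := by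
  obtain ⟨K, hK⟩ := exists_mul_mul_eq B
  refine ⟨u * Kᵀ, ?_⟩
  rw [← Matrix.mul_assoc, h, Matrix.mul_assoc, Matrix.mul_assoc, ← Matrix.transpose_mul,
    ← Matrix.transpose_mul, hK]

theorem exists_mul_eq_iff (hA : IsKerRange A G G') (hB : IsKerRange B H H') {u : Matrix m' p ℂ} :
    (∃ x : Matrix m' p' ℂ, A * u = A * x * Bᵀ) ↔ G' * u * Hᵀ = 0 := by
  constructor
  · rintro ⟨x, hx⟩
    rw [Matrix.mul_assoc, ← sub_eq_zero, ← Matrix.mul_sub, hA.mul_eq_zero_iff, Matrix.mul_sub,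
      sub_eq_zero] at hx
    rw [hx, ← Matrix.mul_assoc, Matrix.mul_assoc, ← Matrix.transpose_mul, hB.mul_eq_zero,
      Matrix.transpose_zero, Matrix.mul_zero]
  · intro h
    rw [Matrix.mul_assoc, ← hA.mul_eq_zero_iff, ← Matrix.mul_assoc, ← Matrix.transpose_eq_zero,
      Matrix.transpose_mul, Matrix.transpose_transpose] at h
    obtain ⟨v, hv⟩ := hB.exists_eq_mul h
    refine exists_eq_mul_mul (v := vᵀ) ?_
    rw [← Matrix.transpose_mul, ← hv, Matrix.transpose_transpose]

theorem exists_mul_transpose_eq_iff (hA : IsKerRange A G G') (hB : IsKerRange B H H')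
    {v : Matrix m p' ℂ} : (∃ x : Matrix m' p' ℂ, v * Bᵀ = A * x * Bᵀ) ↔ G * v * H'ᵀ = 0 := by
  have h := hB.exists_mul_eq_iff hA (u := vᵀ)
  rw [← Matrix.transpose_eq_zero, Matrix.transpose_mul, Matrix.transpose_transpose,
    Matrix.transpose_mul, Matrix.transpose_transpose, ← Matrix.mul_assoc] at h
  rw [← h]
  constructor
  · rintro ⟨x, hx⟩
    refine ⟨xᵀ, Matrix.transpose_injective ?_⟩
    simp only [Matrix.transpose_mul, Matrix.transpose_transpose, hx, Matrix.mul_assoc]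
  · rintro ⟨x, hx⟩
    refine ⟨xᵀ, Matrix.transpose_injective ?_⟩
    simp only [Matrix.transpose_mul, Matrix.transpose_transpose, hx, Matrix.mul_assoc]

theorem mul_mul_eq_zero_iff (hA : IsKerRange A G G') (hB : IsKerRange B H H')
    {x : Matrix m' p' ℂ} : A * x * Bᵀ = 0 ↔ G' * x * H'ᵀ = 0 := by
  rw [Matrix.mul_assoc, hA.mul_eq_zero_iff, ← Matrix.mul_assoc, ← Matrix.transpose_eq_zero,
    Matrix.transpose_mul, Matrix.transpose_transpose, hB.mul_eq_zero_iff,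
    ← Matrix.transpose_eq_zero, Matrix.transpose_mul, Matrix.transpose_transpose]

end IsKerRange

end KerRange

/-! ### The diamond in a cell module -/

section Main

open Matrix

variable {δ : Fin 2 → ℂ} {n : ℕ} {lam : Fin 2 → ℕ} {m₀ m₁ : ℕ}

/-- As an element outside the radical is a generator, the radical is the only maximal submodule. -/
theorem jacobson_eq_cellRadical {μ : Fin 2 → ℕ} (h : cellRadical δ n μ ≠ ⊤) :
    Module.jacobson (bubbleAlgebra δ n) (CellModule δ n μ) = cellRadical δ n μ := by
  have hle : ∀ N : Submodule (bubbleAlgebra δ n) (CellModule δ n μ), N ≠ ⊤ →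
      N ≤ cellRadical δ n μ := by
    intro N hN x hx
    by_contra hx'
    refine hN (eq_top_iff.2 fun z _ => ?_)
    obtain ⟨a, rfl⟩ := exists_smul_eq hx' z
    exact N.smul_mem a hx
  have hco : IsCoatom (cellRadical δ n μ) :=
    ⟨h, fun N hN => by_contra fun hN' => absurd (hle N hN') (not_le_of_gt hN)⟩
  refine le_antisymm (sInf_le hco) (le_sInf fun N hN => ?_)
  have h1 := hle N hN.1
  obtain h2 | h2 := h1.lt_or_eq
  · exact absurd (hN.2 _ h2) h
  · exact h2.ge

theorem jacobson_eq_of_exists {μ : Fin 2 → ℕ}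
    (h : μ 0 + μ 1 ≤ n → ∃ x : CellModule δ n μ, x ∉ cellRadical δ n μ) :
    Module.jacobson (bubbleAlgebra δ n) (CellModule δ n μ) = cellRadical δ n μ := by
  by_cases hn : μ 0 + μ 1 ≤ n
  · obtain ⟨x, hx⟩ := h hn
    exact jacobson_eq_cellRadical fun e => hx (by rw [e]; trivial)
  · have := subsingleton_cellModule (δ := δ) (n := n) (μ := μ) (by omega)
    exact Subsingleton.elim _ _

variable {s₀ : TL (δ 0) m₀ (lam 0)} {s₁ : TL (δ 1) m₁ (lam 1)}

variable (δ n lam) in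
/-- The homomorphism given by `s₀` in the first colour. -/
noncomputable def homFst (h₀ : IsCellHom s₀) :
    CellModule δ n ![m₀, lam 1] →ₗ[bubbleAlgebra δ n] CellModule δ n lam :=
  cellHom n (μ := ![m₀, lam 1]) (s₀ := s₀) (s₁ := oneTL (δ 1) (lam 1)) h₀ isCellHom_oneTL

variable (δ n lam) in
/-- The homomorphism given by `s₁` in the second colour. -/
noncomputable def homSnd (h₁ : IsCellHom s₁) :
    CellModule δ n ![lam 0, m₁] →ₗ[bubbleAlgebra δ n] CellModule δ n lam :=
  cellHom n (μ := ![lam 0, m₁]) (s₀ := oneTL (δ 0) (lam 0)) (s₁ := s₁) isCellHom_oneTL h₁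

variable (δ n lam) in
/-- The homomorphism given by `s₀` and `s₁`. -/
noncomputable def homBoth (h₀ : IsCellHom s₀) (h₁ : IsCellHom s₁) :
    CellModule δ n ![m₀, m₁] →ₗ[bubbleAlgebra δ n] CellModule δ n lam :=
  cellHom n (μ := ![m₀, m₁]) (s₀ := s₀) (s₁ := s₁) h₀ h₁

variable (n) in
/-- Coordinates of the elements of the cell module with `k₀` and `k₁` defects. -/
abbrev PairMatrix (k₀ k₁ : ℕ) : Type := ∀ w : Fin n → Fin 2,
  Matrix (HalfDiagram (wordCount w 0) k₀) (HalfDiagram (wordCount w 1) k₁) ℂ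

variable (δ) in
/-- The element with given coordinates of the cell module with `k₀` and `k₁` defects. -/
noncomputable def pairOf {k₀ k₁ : ℕ} (z : PairMatrix n k₀ k₁) : CellModule δ n ![k₀, k₁] :=
  cellOf δ n ![k₀, k₁] z

theorem pairOf_surjective {k₀ k₁ : ℕ} :
    Function.Surjective (pairOf δ : PairMatrix n k₀ k₁ → CellModule δ n ![k₀, k₁]) :=
  cellOf_surjective

theorem pairOf_mem_cellRadical {k₀ k₁ : ℕ} {z : PairMatrix n k₀ k₁} :
    pairOf δ z ∈ cellRadical δ n ![k₀, k₁] ↔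
      ∀ w, gram (δ 0) (wordCount w 0) k₀ * z w * (gram (δ 1) (wordCount w 1) k₁)ᵀ = 0 :=
  cellOf_mem_cellRadical (μ := ![k₀, k₁])

theorem homFst_pairOf (h₀ : IsCellHom s₀) (u : PairMatrix n m₀ (lam 1)) :
    homFst δ n lam h₀ (pairOf δ u) = cellOf δ n lam fun w => rightMatrix (wordCount w 0) s₀ * u w := by
  refine (cellHom_cellOf (μ := ![m₀, lam 1]) _ _ u).trans (congrArg _ (funext fun w => ?_))
  have e : rightMatrix (wordCount w 0) s₀ * u w *
      (rightMatrix (wordCount w 1) (oneTL (δ 1) (lam 1)))ᵀ =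
        rightMatrix (wordCount w 0) s₀ * u w := by
    rw [rightMatrix_oneTL, Matrix.transpose_one, Matrix.mul_one]
  exact e

theorem homSnd_pairOf (h₁ : IsCellHom s₁) (v : PairMatrix n (lam 0) m₁) :
    homSnd δ n lam h₁ (pairOf δ v) =
      cellOf δ n lam fun w => v w * (rightMatrix (wordCount w 1) s₁)ᵀ := by
  refine (cellHom_cellOf (μ := ![lam 0, m₁]) _ _ v).trans (congrArg _ (funext fun w => ?_))
  have e : rightMatrix (wordCount w 0) (oneTL (δ 0) (lam 0)) * v w = v w := by
    rw [rightMatrix_oneTL, Matrix.one_mul]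
  exact congrArg (fun y : Matrix (HalfDiagram (wordCount w 0) (lam 0))
    (HalfDiagram (wordCount w 1) m₁) ℂ => y * (rightMatrix (wordCount w 1) s₁)ᵀ) e

theorem homBoth_pairOf (h₀ : IsCellHom s₀) (h₁ : IsCellHom s₁) (x : PairMatrix n m₀ m₁) :
    homBoth δ n lam h₀ h₁ (pairOf δ x) = cellOf δ n lam fun w =>
      rightMatrix (wordCount w 0) s₀ * x w * (rightMatrix (wordCount w 1) s₁)ᵀ :=
  cellHom_cellOf (μ := ![m₀, m₁]) _ _ x


theorem range_homFst_sup_range_homSnd (h₀ : IsCellHom s₀) (h₁ : IsCellHom s₁)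
    (k₀ : ∀ a, IsKerRange (rightMatrix a s₀) (gram (δ 0) a (lam 0)) (gram (δ 0) a m₀))
    (k₁ : ∀ a, IsKerRange (rightMatrix a s₁) (gram (δ 1) a (lam 1)) (gram (δ 1) a m₁)) :
    LinearMap.range (homFst δ n lam h₀) ⊔ LinearMap.range (homSnd δ n lam h₁) = cellRadical δ n lam := by
  apply le_antisymm
  · rw [sup_le_iff]
    constructor
    · rintro _ ⟨x, rfl⟩
      obtain ⟨u, rfl⟩ := pairOf_surjective x
      rw [homFst_pairOf, cellOf_mem_cellRadical]
      intro w
      simpa using (k₀ _).mul_add_mul_eq_zero (k₁ _) (u w) 0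
    · rintro _ ⟨x, rfl⟩
      obtain ⟨v, rfl⟩ := pairOf_surjective x
      rw [homSnd_pairOf, cellOf_mem_cellRadical]
      intro w
      simpa using (k₀ _).mul_add_mul_eq_zero (k₁ _) 0 (v w)
  · intro x hx
    obtain ⟨z, rfl⟩ := cellOf_surjective x
    rw [cellOf_mem_cellRadical] at hx
    choose u v huv using fun w => (k₀ _).exists_eq_add (k₁ _) (hx w)
    have e : cellOf δ n lam z = homFst δ n lam h₀ (pairOf δ u) +
        homSnd δ n lam h₁ (pairOf δ v) := by
      rw [homFst_pairOf, homSnd_pairOf, ← cellOf_add]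
      exact congrArg _ (funext huv)
    rw [e]
    exact Submodule.add_mem_sup ⟨_, rfl⟩ ⟨_, rfl⟩

theorem homFst_mem_range_homBoth (h₀ : IsCellHom s₀) (h₁ : IsCellHom s₁)
    {u : PairMatrix n m₀ (lam 1)} :
    homFst δ n lam h₀ (pairOf δ u) ∈ LinearMap.range (homBoth δ n lam h₀ h₁) ↔
      ∀ w, ∃ x : Matrix (HalfDiagram (wordCount w 0) m₀) (HalfDiagram (wordCount w 1) m₁) ℂ,
        rightMatrix (wordCount w 0) s₀ * u w =
          rightMatrix (wordCount w 0) s₀ * x * (rightMatrix (wordCount w 1) s₁)ᵀ := by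
  constructor
  · rintro ⟨x, hx⟩ w
    obtain ⟨x, rfl⟩ := pairOf_surjective x
    rw [homBoth_pairOf, homFst_pairOf] at hx
    exact ⟨x w, (congrFun (cellOf_injective hx) w).symm⟩
  · intro h
    choose x hx using h
    refine ⟨pairOf δ x, ?_⟩
    rw [homBoth_pairOf, homFst_pairOf]
    exact congrArg _ (funext fun w => (hx w).symm)

theorem homSnd_mem_range_homBoth (h₀ : IsCellHom s₀) (h₁ : IsCellHom s₁)
    {v : PairMatrix n (lam 0) m₁} :
    homSnd δ n lam h₁ (pairOf δ v) ∈ LinearMap.range (homBoth δ n lam h₀ h₁) ↔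
      ∀ w, ∃ x : Matrix (HalfDiagram (wordCount w 0) m₀) (HalfDiagram (wordCount w 1) m₁) ℂ,
        v w * (rightMatrix (wordCount w 1) s₁)ᵀ =
          rightMatrix (wordCount w 0) s₀ * x * (rightMatrix (wordCount w 1) s₁)ᵀ := by
  constructor
  · rintro ⟨x, hx⟩ w
    obtain ⟨x, rfl⟩ := pairOf_surjective x
    rw [homBoth_pairOf, homSnd_pairOf] at hx
    exact ⟨x w, (congrFun (cellOf_injective hx) w).symm⟩
  · intro h
    choose x hx using h
    refine ⟨pairOf δ x, ?_⟩
    rw [homBoth_pairOf, homSnd_pairOf]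
    exact congrArg _ (funext fun w => (hx w).symm)

theorem range_homFst_inf_range_homSnd (h₀ : IsCellHom s₀) (h₁ : IsCellHom s₁) :
    LinearMap.range (homFst δ n lam h₀) ⊓ LinearMap.range (homSnd δ n lam h₁) =
      LinearMap.range (homBoth δ n lam h₀ h₁) := by
  apply le_antisymm
  · rintro _ ⟨⟨x, rfl⟩, ⟨y, hy⟩⟩
    obtain ⟨u, rfl⟩ := pairOf_surjective x
    obtain ⟨v, rfl⟩ := pairOf_surjective y
    rw [homFst_mem_range_homBoth]
    intro w
    rw [homSnd_pairOf, homFst_pairOf] at hy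
    exact IsKerRange.exists_eq_mul_mul (congrFun (cellOf_injective hy) w).symm
  · rintro _ ⟨x, rfl⟩
    obtain ⟨x, rfl⟩ := pairOf_surjective x
    rw [homBoth_pairOf]
    constructor
    · refine ⟨pairOf δ fun w => x w * (rightMatrix (wordCount w 1) s₁)ᵀ, ?_⟩
      rw [homFst_pairOf]
      exact congrArg _ (funext fun w => (Matrix.mul_assoc _ _ _).symm)
    · refine ⟨pairOf δ fun w => rightMatrix (wordCount w 0) s₀ * x w, ?_⟩
      rw [homSnd_pairOf]

theorem comap_homFst (h₀ : IsCellHom s₀) (h₁ : IsCellHom s₁)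
    (k₀ : ∀ a, IsKerRange (rightMatrix a s₀) (gram (δ 0) a (lam 0)) (gram (δ 0) a m₀))
    (k₁ : ∀ a, IsKerRange (rightMatrix a s₁) (gram (δ 1) a (lam 1)) (gram (δ 1) a m₁)) :
    (LinearMap.range (homBoth δ n lam h₀ h₁)).comap (homFst δ n lam h₀) =
    cellRadical δ n ![m₀, lam 1] := by
  ext x
  obtain ⟨u, rfl⟩ := pairOf_surjective x
  rw [Submodule.mem_comap, homFst_mem_range_homBoth, pairOf_mem_cellRadical]
  exact forall_congr' fun w => (k₀ _).exists_mul_eq_iff (k₁ _)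

theorem comap_homSnd (h₀ : IsCellHom s₀) (h₁ : IsCellHom s₁)
    (k₀ : ∀ a, IsKerRange (rightMatrix a s₀) (gram (δ 0) a (lam 0)) (gram (δ 0) a m₀))
    (k₁ : ∀ a, IsKerRange (rightMatrix a s₁) (gram (δ 1) a (lam 1)) (gram (δ 1) a m₁)) :
    (LinearMap.range (homBoth δ n lam h₀ h₁)).comap (homSnd δ n lam h₁) =
    cellRadical δ n ![lam 0, m₁] := by
  ext x
  obtain ⟨v, rfl⟩ := pairOf_surjective x
  rw [Submodule.mem_comap, homSnd_mem_range_homBoth, pairOf_mem_cellRadical]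
  exact forall_congr' fun w => (k₀ _).exists_mul_transpose_eq_iff (k₁ _)

theorem ker_homBoth (h₀ : IsCellHom s₀) (h₁ : IsCellHom s₁)
    (k₀ : ∀ a, IsKerRange (rightMatrix a s₀) (gram (δ 0) a (lam 0)) (gram (δ 0) a m₀))
    (k₁ : ∀ a, IsKerRange (rightMatrix a s₁) (gram (δ 1) a (lam 1)) (gram (δ 1) a m₁)) :
    LinearMap.ker (homBoth δ n lam h₀ h₁) = cellRadical δ n ![m₀, m₁] := by
  ext x
  obtain ⟨x, rfl⟩ := pairOf_surjective x
  have h0 : cellOf δ n lam 0 = 0 := by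
    have := cellOf_add (δ := δ) (0 : CellMatrix n lam) 0
    rwa [add_zero, left_eq_add] at this
  rw [LinearMap.mem_ker, homBoth_pairOf, pairOf_mem_cellRadical, ← h0, cellOf_injective.eq_iff,
    funext_iff]
  exact forall_congr' fun w => (k₀ _).mul_mul_eq_zero_iff (k₁ _)

end Main

/-! ### The Loewy length of a module with a diamond of submodules -/

section Loewy

variable {R M M' M'' : Type} [Ring R] [AddCommGroup M] [Module R M] [AddCommGroup M'] [Module R M']
  [AddCommGroup M''] [Module R M''] {N : Submodule R M} {f : M' →ₗ[R] N} {g : N →ₗ[R] M''}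

theorem radStep_le_map_range (hfg : Function.Exact f g) (h : Module.jacobson R M'' = ⊥) :
    radStep N ≤ (LinearMap.range f).map N.subtype := by
  refine Submodule.map_mono fun x hx => ?_
  have := Module.le_comap_jacobson g hx
  rw [h, Submodule.mem_comap, Submodule.mem_bot] at this
  exact (hfg x).1 this

theorem radStep_eq_bot_of_le_map_range (hf : Function.Injective f) (h : Module.jacobson R M' = ⊥)
    {P : Submodule R M} (hP : P ≤ (LinearMap.range f).map N.subtype) : radStep P = ⊥ :=
  radStep_eq_bot ((LinearEquiv.ofInjective f hf).symm.toLinearMap ∘ₗ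
    (Submodule.equivMapOfInjective N.subtype N.injective_subtype _).symm.toLinearMap ∘ₗ
    Submodule.inclusion hP)
    (fun _ _ e => Submodule.inclusion_injective hP
      ((Submodule.equivMapOfInjective N.subtype N.injective_subtype _).symm.injective
        ((LinearEquiv.ofInjective f hf).symm.injective e))) h

/-- If `N` is the only maximal submodule, or the whole module, and is an extension of two modules
without radical, then the third term of the radical series is zero. -/
theorem radicalSeries_three_eq_bot (hN : N ≠ ⊤ → Module.jacobson R M = N)
    (hf : Function.Injective f) (hfg : Function.Exact f g) (h' : Module.jacobson R M' = ⊥)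
    (h'' : Module.jacobson R M'' = ⊥) : radicalSeries R M 3 = ⊥ := by
  have hle := radStep_le_map_range hfg h''
  refine radStep_eq_bot_of_le_map_range hf h' ?_
  by_cases h : N = ⊤
  · have h1 : radicalSeries R M 1 = radStep N := congrArg radStep h.symm
    exact (radStep_le _).trans (h1.trans_le hle)
  · have h1 : radicalSeries R M 1 = N := radStep_top.trans (hN h)
    rwa [radicalSeries_succ, h1]

end Loewy

/-! ### The structure of the radical of the form -/

section Main

variable {δ : Fin 2 → ℂ} {n : ℕ} {μ ν κ : Fin 2 → ℕ}

theorem gram_self_ne_zero (c : ℂ) (k : ℕ) : gram c k k ≠ 0 := by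
  obtain ⟨x, -⟩ := Fintype.card_eq_one_iff.1 (card_halfDiagram_self k)
  intro h
  have := congrFun (congrFun (gram_self.symm.trans h) x) x
  rw [Matrix.one_apply_eq] at this
  exact one_ne_zero this

theorem jacobson_eq_of_gram_ne_zero (h : μ 0 + μ 1 ≤ n → ∃ a₀ a₁, a₀ + a₁ = n ∧
    gram (δ 0) a₀ (μ 0) ≠ 0 ∧ gram (δ 1) a₁ (μ 1) ≠ 0) :
    Module.jacobson (bubbleAlgebra δ n) (CellModule δ n μ) = cellRadical δ n μ := by
  refine jacobson_eq_of_exists fun hn => ?_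
  obtain ⟨a₀, a₁, ha, h₀, h₁⟩ := h hn
  obtain ⟨w, rfl, rfl⟩ := exists_wordCount_eq ha
  obtain ⟨x, hx, -⟩ := exists_not_mem_cellRadical h₀ h₁
  exact ⟨x, hx⟩

/-- The idempotent of a colouring with too few nodes of the second colour for the third module
separates that module from a generator of the first one. -/
theorem range_le_radStep_of_gram_ne_zero {N : Submodule (bubbleAlgebra δ n) (CellModule δ n κ)}
    {F₀ : CellModule δ n μ →ₗ[bubbleAlgebra δ n] CellModule δ n κ}
    {F : CellModule δ n ν →ₗ[bubbleAlgebra δ n] CellModule δ n κ}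
    (hle : LinearMap.range F ≤ LinearMap.range F₀) (hN : LinearMap.range F₀ ≤ N)
    (h : ν 0 + ν 1 ≤ n → ∃ a₀ a₁, a₀ + a₁ = n ∧ a₁ < ν 1 ∧
      gram (δ 0) a₀ (μ 0) ≠ 0 ∧ gram (δ 1) a₁ (μ 1) ≠ 0) :
    LinearMap.range F ≤ radStep N := by
  refine range_le_radStep hle hN ?_
  by_cases hn : ν 0 + ν 1 ≤ n
  · obtain ⟨a₀, a₁, ha, hlt, h₀, h₁⟩ := h hn
    obtain ⟨w, rfl, rfl⟩ := exists_wordCount_eq ha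
    obtain ⟨x, hx, hwx⟩ := exists_not_mem_cellRadical h₀ h₁
    exact Or.inr ⟨wordIdem δ w, x, exists_smul_eq hx, hwx,
      fun m => wordIdem_smul_eq_zero (Or.inr hlt) m⟩
  · exact Or.inl (subsingleton_cellModule (not_le.1 hn))

theorem cellForm_eq_zero (h : cellRadical δ n μ = ⊤) : cellForm δ n μ = 0 :=
  LinearMap.ext fun x => LinearMap.ext fun y => (h.ge trivial : y ∈ cellRadical δ n μ) x

variable {lam : Fin 2 → ℕ} {m₀ m₁ : ℕ} {s₀ : TL (δ 0) m₀ (lam 0)} {s₁ : TL (δ 1) m₁ (lam 1)}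

/-- The diamond of the images of three cell modules determines the structure of the radical, provided
that the radicals of these modules are known and that the third image lies in all maximal submodules of
the radical. -/
theorem exists_exact_cellRadical (h₀ : IsCellHom s₀) (h₁ : IsCellHom s₁)
    (k₀ : ∀ a, IsKerRange (rightMatrix a s₀) (gram (δ 0) a (lam 0)) (gram (δ 0) a m₀))
    (k₁ : ∀ a, IsKerRange (rightMatrix a s₁) (gram (δ 1) a (lam 1)) (gram (δ 1) a m₁))
    (j₀ : Module.jacobson (bubbleAlgebra δ n) (CellModule δ n ![m₀, lam 1]) =
      cellRadical δ n ![m₀, lam 1])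
    (j₁ : Module.jacobson (bubbleAlgebra δ n) (CellModule δ n ![lam 0, m₁]) =
      cellRadical δ n ![lam 0, m₁])
    (j : Module.jacobson (bubbleAlgebra δ n) (CellModule δ n ![m₀, m₁]) =
      cellRadical δ n ![m₀, m₁])
    (hrad : m₀ + m₁ ≤ n → ∃ a₀ a₁, a₀ + a₁ = n ∧ a₁ < m₁ ∧
      gram (δ 0) a₀ m₀ ≠ 0 ∧ gram (δ 1) a₁ (lam 1) ≠ 0) :
    ∃ (f : Head δ n ![m₀, m₁] →ₗ[bubbleAlgebra δ n] cellRadical δ n lam)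
      (g : cellRadical δ n lam →ₗ[bubbleAlgebra δ n]
        Head δ n ![m₀, lam 1] × Head δ n ![lam 0, m₁]),
      Function.Injective f ∧ Function.Exact f g ∧ Function.Surjective g ∧
      radicalSeries (bubbleAlgebra δ n) (CellModule δ n lam) 3 = ⊥ ∧
      (cellForm δ n lam ≠ 0 →
        radicalSeries (bubbleAlgebra δ n) (CellModule δ n lam) 1 = cellRadical δ n lam ∧
        radicalSeries (bubbleAlgebra δ n) (CellModule δ n lam) 2 =
          (LinearMap.range f).map (cellRadical δ n lam).subtype) := by
  have hsup := range_homFst_sup_range_homSnd (δ := δ) (n := n) (lam := lam) h₀ h₁ k₀ k₁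
  have hinf := range_homFst_inf_range_homSnd (δ := δ) (n := n) (lam := lam) h₀ h₁
  obtain ⟨f, g, hf, hfg, hg, hF⟩ := exists_exact_of_diamond (M₀ := CellModule δ n ![m₀, lam 1])
    (M₁ := CellModule δ n ![lam 0, m₁]) (M' := CellModule δ n ![m₀, m₁])
    hsup hinf ((comap_homFst h₀ h₁ k₀ k₁).trans j₀.symm) ((comap_homSnd h₀ h₁ k₀ k₁).trans j₁.symm)
    ((ker_homBoth h₀ h₁ k₀ k₁).trans j.symm)
  have hprod := jacobson_prod_eq_bot
    (Module.jacobson_quotient_jacobson (bubbleAlgebra δ n) (CellModule δ n ![m₀, lam 1]))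
    (Module.jacobson_quotient_jacobson (bubbleAlgebra δ n) (CellModule δ n ![lam 0, m₁]))
  refine ⟨f, g, hf, hfg, hg, radicalSeries_three_eq_bot jacobson_eq_cellRadical hf hfg
    (Module.jacobson_quotient_jacobson _ _) hprod, fun hform => ?_⟩
  have h : radicalSeries (bubbleAlgebra δ n) (CellModule δ n lam) 1 = cellRadical δ n lam :=
    radStep_top.trans (jacobson_eq_cellRadical fun h => hform (cellForm_eq_zero h))
  refine ⟨h, ?_⟩
  rw [radicalSeries_succ, h]
  refine (radStep_le_map_range hfg hprod).antisymm ?_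
  rw [hF]
  exact range_le_radStep_of_gram_ne_zero (F₀ := homFst δ n lam h₀)
    (hinf.ge.trans inf_le_left) (le_sup_left.trans hsup.le) hrad

end Main

end Bubble

theorem theorem7p2 (n v : ℕ) (q δ : Fin 2 → ℂ) (l t lam : Fin 2 → ℕ)
    (hδ : ∀ i, δ i = q i + (q i)⁻¹)
    (hl : ∀ i, IsLeast {k : ℕ | 0 < k ∧ q i ^ (2 * k) = 1} (l i))
    (hlam : lam 0 + lam 1 + 2 * v = n)
    (ht : ∀ i, 0 < t i ∧ t i < l i)
    (hmod : ∀ i, lam i + t i + 1 ≡ 0 [MOD l i]) :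
    ∃ (f : Bubble.Head δ n ![lam 0 + 2 * t 0, lam 1 + 2 * t 1] →ₗ[Bubble.bubbleAlgebra δ n]
          Bubble.cellRadical δ n lam)
      (g : Bubble.cellRadical δ n lam →ₗ[Bubble.bubbleAlgebra δ n]
          Bubble.Head δ n ![lam 0 + 2 * t 0, lam 1] ×
            Bubble.Head δ n ![lam 0, lam 1 + 2 * t 1]),
      Function.Injective f ∧ Function.Exact f g ∧ Function.Surjective g ∧
      -- the Loewy length is at most three
      Bubble.radicalSeries (Bubble.bubbleAlgebra δ n) (Bubble.CellModule δ n lam) 3 = ⊥ ∧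
      -- the radical layers
      (Bubble.cellForm δ n lam ≠ 0 →
        Bubble.radicalSeries (Bubble.bubbleAlgebra δ n) (Bubble.CellModule δ n lam) 1 =
          Bubble.cellRadical δ n lam ∧
        Bubble.radicalSeries (Bubble.bubbleAlgebra δ n) (Bubble.CellModule δ n lam) 2 =
          (LinearMap.range f).map (Bubble.cellRadical δ n lam).subtype) := by
  open Bubble in
  have hs : ∀ i, ∃ s : TL (δ i) (lam i + 2 * t i) (lam i), IsCellHom s ∧
      ∀ a, IsKerRange (rightMatrix a s) (gram (δ i) a (lam i)) (gram (δ i) a (lam i + 2 * t i)) := by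
    intro i
    have hl2 : 2 ≤ l i := by have := ht i; omega
    obtain ⟨s, h₁, h₂, h₃⟩ := exists_rightMatrix hl2 (qOrder_eq (hδ i) (hl i) hl2) (ht i).1 (ht i).2
      ((Nat.modEq_zero_iff_dvd).1 (hmod i))
    exact ⟨s, ⟨h₁, h₂⟩, fun a => ⟨(h₃ a).1, (h₃ a).2⟩⟩
  obtain ⟨s₀, h₀, k₀⟩ := hs 0
  obtain ⟨s₁, h₁, k₁⟩ := hs 1
  have g₀ : ∀ j, Bubble.gram (δ 0) (lam 0 + 2 * t 0 + 2 * j) (lam 0 + 2 * t 0) ≠ 0 := by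
    intro j
    obtain ⟨k, hk⟩ : ∃ k, lam 0 + 2 * t 0 = k + 1 := ⟨lam 0 + 2 * t 0 - 1, by have := ht 0; omega⟩
    rw [hk]
    exact Bubble.gram_ne_zero _ _ _
  have g₁ : ∀ j, Bubble.gram (δ 1) (lam 1 + 2 * t 1 + 2 * j) (lam 1 + 2 * t 1) ≠ 0 := by
    intro j
    obtain ⟨k, hk⟩ : ∃ k, lam 1 + 2 * t 1 = k + 1 := ⟨lam 1 + 2 * t 1 - 1, by have := ht 1; omega⟩
    rw [hk]
    exact Bubble.gram_ne_zero _ _ _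
  have j₀ := Bubble.jacobson_eq_of_gram_ne_zero (δ := δ) (n := n)
    (μ := ![lam 0 + 2 * t 0, lam 1]) fun h =>
      ⟨lam 0 + 2 * t 0 + 2 * (v - t 0), lam 1, by
        have h : lam 0 + 2 * t 0 + lam 1 ≤ n := h
        omega, g₀ _, Bubble.gram_self_ne_zero _ _⟩
  have j₁ := Bubble.jacobson_eq_of_gram_ne_zero (δ := δ) (n := n)
    (μ := ![lam 0, lam 1 + 2 * t 1]) fun h =>
      ⟨lam 0, lam 1 + 2 * t 1 + 2 * (v - t 1), by
        have h : lam 0 + (lam 1 + 2 * t 1) ≤ n := h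
        omega, Bubble.gram_self_ne_zero _ _, g₁ _⟩
  have j := Bubble.jacobson_eq_of_gram_ne_zero (δ := δ) (n := n)
    (μ := ![lam 0 + 2 * t 0, lam 1 + 2 * t 1]) fun h =>
      ⟨lam 0 + 2 * t 0 + 2 * 0, lam 1 + 2 * t 1 + 2 * (v - t 0 - t 1), by
        have h : lam 0 + 2 * t 0 + (lam 1 + 2 * t 1) ≤ n := h
        omega, g₀ _, g₁ _⟩
  exact Bubble.exists_exact_cellRadical h₀ h₁ k₀ k₁ j₀ j₁ j fun hn =>
    ⟨lam 0 + 2 * t 0 + 2 * (v - t 0), lam 1, by omega,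
      Nat.lt_add_of_pos_right (by have := ht 1; omega), g₀ _, Bubble.gram_self_ne_zero _ _⟩
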